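/- Let $a_1,b_1,a_2,b_2$ be integers with $a_1>0$, $a_2>0$ and $D:=a_1b_2-a_2b_1\neq 0$. Let $\varphi$ be Euler's function and $\sigma$ the sum-of-divisors function, both defined on the positive integers. Let $N(x)$ be the number of integers $n\le x$ with $a_1n+b_1>0$, $a_2n+b_2>0$ and $\varphi(a_1n+b_1)=\varphi(a_2n+b_2)$ that are not of the following form: $n=(m_1q_1-b_1)/a_1$, where $m_1,m_2,k_1,k_2,l$ are positive integers with $k_1\ne k_2$, $$m_1=\frac{k_2D}{a_2(k_1-k_2)},\qquad m_2=\frac{k_1D}{a_1(k_1-k_2)},\qquad k_1\varphi(m_1)=k_2\varphi(m_2),$$ and $q_i=k_il+1$ is a prime not dividing $m_i$ for $i=1,2$. Let $M(x)$ be the number of integers $n\le x$ with $a_1n+b_1>0$, $a_2n+b_2>0$ and $\sigma(a_1n+b_1)=\sigma(a_2n+b_2)$ that are not of the following form: $n=(m_1q_1-b_1)/a_1$, where $m_1,m_2,k_1,k_2,l$ are positive integers with $k_1\ne k_2$, $$m_1=\frac{k_2D}{a_2(k_2-k_1)},\qquad m_2=\frac{k_1D}{a_1(k_2-k_1)},\qquad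 k_1\sigma(m_1)=k_2\sigma(m_2),$$ and $q_i=k_il-1$ is a prime not dividing $m_i$ for $i=1,2$. Then, as $x\to\infty$, both $N(x)$ and $M(x)$ are $$\ll x\exp\left(-2^{-1/2}(\log x\,\log\log\log x)^{1/2}\right),$$ where the implied constants may depend on $a_1,b_1,a_2,b_2$. -/

import Mathlib

open Filter Asymptotics

/-- The integer `n` is a solution of `φ (a₁ n + b₁) = φ (a₂ n + b₂)`, where both arguments are
positive integers. -/
def IsPhiSolution (a₁ b₁ a₂ b₂ n : ℤ) : Prop :=
  0 < a₁ * n + b₁ ∧ 0 < a₂ * n + b₂ ∧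
    Nat.totient (a₁ * n + b₁).toNat = Nat.totient (a₂ * n + b₂).toNat

/-- The integer `n` is a solution of `σ (a₁ n + b₁) = σ (a₂ n + b₂)`, where both arguments are
positive integers and `σ` is the sum-of-divisors function. -/
def IsSigmaSolution (a₁ b₁ a₂ b₂ n : ℤ) : Prop :=
  0 < a₁ * n + b₁ ∧ 0 < a₂ * n + b₂ ∧
    ArithmeticFunction.sigma 1 (a₁ * n + b₁).toNat =
      ArithmeticFunction.sigma 1 (a₂ * n + b₂).toNat

/-- The special parametric form of solutions for `φ`: the primes are `qᵢ = kᵢ l + 1`, and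
`n = (m₁ q₁ - b₁) / a₁`. -/
def IsPhiForm (a₁ b₁ a₂ b₂ n : ℤ) : Prop :=
  ∃ m₁ m₂ k₁ k₂ l q₁ q₂ : ℕ,
    0 < m₁ ∧ 0 < m₂ ∧ 0 < k₁ ∧ 0 < k₂ ∧ 0 < l ∧ k₁ ≠ k₂ ∧
    (m₁ : ℚ) = k₂ * (a₁ * b₂ - a₂ * b₁) / (a₂ * (k₁ - k₂)) ∧
    (m₂ : ℚ) = k₁ * (a₁ * b₂ - a₂ * b₁) / (a₁ * (k₁ - k₂)) ∧
    k₁ * Nat.totient m₁ = k₂ * Nat.totient m₂ ∧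
    (q₁ : ℤ) = k₁ * l + 1 ∧ (q₂ : ℤ) = k₂ * l + 1 ∧
    q₁.Prime ∧ q₂.Prime ∧ ¬ q₁ ∣ m₁ ∧ ¬ q₂ ∣ m₂ ∧
    (n : ℚ) = (m₁ * q₁ - b₁) / a₁

/-- The special parametric form of solutions for `σ`: the primes are `qᵢ = kᵢ l - 1`, and
`n = (m₁ q₁ - b₁) / a₁`. -/
def IsSigmaForm (a₁ b₁ a₂ b₂ n : ℤ) : Prop :=
  ∃ m₁ m₂ k₁ k₂ l q₁ q₂ : ℕ,
    0 < m₁ ∧ 0 < m₂ ∧ 0 < k₁ ∧ 0 < k₂ ∧ 0 < l ∧ k₁ ≠ k₂ ∧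
    (m₁ : ℚ) = k₂ * (a₁ * b₂ - a₂ * b₁) / (a₂ * (k₂ - k₁)) ∧
    (m₂ : ℚ) = k₁ * (a₁ * b₂ - a₂ * b₁) / (a₁ * (k₂ - k₁)) ∧
    k₁ * ArithmeticFunction.sigma 1 m₁ = k₂ * ArithmeticFunction.sigma 1 m₂ ∧
    (q₁ : ℤ) = k₁ * l - 1 ∧ (q₂ : ℤ) = k₂ * l - 1 ∧
    q₁.Prime ∧ q₂.Prime ∧ ¬ q₁ ∣ m₁ ∧ ¬ q₂ ∣ m₂ ∧
    (n : ℚ) = (m₁ * q₁ - b₁) / a₁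

/-- The integers `n ≤ x` that solve the equation for `φ` and are not of the special form. -/
def phiExceptional (a₁ b₁ a₂ b₂ : ℤ) (x : ℝ) : Set ℤ :=
  {n : ℤ | (n : ℝ) ≤ x ∧ IsPhiSolution a₁ b₁ a₂ b₂ n ∧ ¬ IsPhiForm a₁ b₁ a₂ b₂ n}

/-- The integers `n ≤ x` that solve the equation for `σ` and are not of the special form. -/
def sigmaExceptional (a₁ b₁ a₂ b₂ : ℤ) (x : ℝ) : Set ℤ :=
  {n : ℤ | (n : ℝ) ≤ x ∧ IsSigmaSolution a₁ b₁ a₂ b₂ n ∧ ¬ IsSigmaForm a₁ b₁ a₂ b₂ n}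

/-- The integers `n ≤ x` with `a n + b > 0` are finitely many if `a > 0`, so the cardinalities
below are genuine. -/
theorem finite_le_and_pos (a b : ℤ) (ha : 0 < a) (x : ℝ) :
    {n : ℤ | (n : ℝ) ≤ x ∧ 0 < a * n + b}.Finite := by
  refine (Set.finite_Icc (-|b|) ⌊x⌋).subset ?_
  rintro n ⟨hx, hn⟩
  refine ⟨?_, Int.le_floor.2 hx⟩
  have h1 := le_abs_self b
  have h2 := abs_nonneg b
  by_contra h
  nlinarith

theorem phiExceptional_finite (a₁ b₁ a₂ b₂ : ℤ) (h : 0 < a₁) (x : ℝ) :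
    (phiExceptional a₁ b₁ a₂ b₂ x).Finite :=
  (finite_le_and_pos a₁ b₁ h x).subset fun _ hn => ⟨hn.1, hn.2.1.1⟩

theorem sigmaExceptional_finite (a₁ b₁ a₂ b₂ : ℤ) (h : 0 < a₁) (x : ℝ) :
    (sigmaExceptional a₁ b₁ a₂ b₂ x).Finite :=
  (finite_le_and_pos a₁ b₁ h x).subset fun _ hn => ⟨hn.1, hn.2.1.1⟩

/-- `N (a₁, b₁, a₂, b₂; x)`, the count for `φ`. -/
noncomputable def countPhi (a₁ b₁ a₂ b₂ : ℤ) (x : ℝ) : ℕ :=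
  (phiExceptional a₁ b₁ a₂ b₂ x).ncard

/-- `M (a₁, b₁, a₂, b₂; x)`, the count for `σ`. -/
noncomputable def countSigma (a₁ b₁ a₂ b₂ : ℤ) (x : ℝ) : ℕ :=
  (sigmaExceptional a₁ b₁ a₂ b₂ x).ncard

/-- The bound `x exp (-2^(-1/2) (log x log log log x)^(1/2))`. -/
noncomputable def savingBound (x : ℝ) : ℝ :=
  x * Real.exp (-(2 : ℝ) ^ (-(1 / 2) : ℝ) *
    (Real.log x * Real.log (Real.log (Real.log x))) ^ (1 / 2 : ℝ))

/-! Let `f` be φ or σ, so `f p = p + ε` with ε = ∓1, put A_i = a_i n + b_i and L = (log x · log log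
log x)^(1/2). Suppose A₁ = m₁p and A₂ = m₂q with primes p ∤ m₁, q ∤ m₂. For fixed m₁, m₂,
eliminating n from A₁, A₂ and using f(A₁) = f(A₂) gives two linear equations in p and q. If this
system is singular, solving for m₁, m₂ shows that n has the special form (`cofactor_relations`).
Hence for every exceptional n all such systems are nonsingular, and n is determined by the pair (m₁,
m₂) (`IsGenericSolution.eq_of_cofactors_eq`).

The generic n are counted according to the prime factors of the common value f(A₁). If it is
e^L-smooth, Rankin's method applies directly. If it has a prime factor r > R, then r divides f(p^e)
and f(q^e') for exact prime powers p^e, q^e' of A₁, A₂. Either one of these is a proper prime power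
exceeding R/2, which is rare; or p ≡ q ≡ -ε mod r. In the latter case, when pq ≤ XB one counts n
modulo pq and sums over p, q, r; when pq > XB the cofactors satisfy m₁m₂ ≤ X/B, and pairs of
cofactors are counted, again with Rankin weights (`card_generic_large_prime_factor_le`). This is
applied with R = e^(9L/5) and no smoothness, and with R = e^L for values that are e^(9L/5)-smooth.

What makes Rankin's method effective is that the sum of m^(-(1-η)) over m with f(m) e^V-smooth is
e^(o(V)). An Euler product (`TotientLike.sum_smooth_le`) reduces this to primes p with p + ε smooth,
whose sum is at most V^(7/8) (`eventually_sum_smooth_shifted_prime_le`). Smooth integers alone would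
not give a power of V below the first; the gain comes from sieving, by Brun's pure sieve, for the
primality of p. The sum tolerates e^(ηV) up to (log V)^(19/20), so ηV can be (9/10) log log log x,
and L² = log x · log log log x turns x^(-η) into a power of e^(-L). Every range then saves e^(-3L/4)
apart from a factor e^(3L/200), and 3/4 - 3/200 exceeds 2^(-1/2). -/

/-! ### Euler products and Rankin sums. -/

/-- A finite sum of a nonnegative multiplicative function over integers composed of primes in `s`
is at most the corresponding product of local factors. -/
theorem sum_le_prod_of_multiplicative {g : ℕ → ℝ} (hg : ∀ n, 0 ≤ g n) (h1 : g 1 ≤ 1)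
    (hmul : ∀ p e m, p.Prime → ¬ p ∣ m → g (p ^ e * m) ≤ g (p ^ e) * g m)
    {h : ℕ → ℝ} (s : Finset ℕ) (hs : ∀ p ∈ s, p.Prime)
    (hh : ∀ p ∈ s, ∀ E, ∑ e ∈ Finset.range E, g (p ^ e) ≤ h p)
    (T : Finset ℕ) (hT : ∀ m ∈ T, m ≠ 0 ∧ ∀ p, p.Prime → p ∣ m → p ∈ s) :
    ∑ m ∈ T, g m ≤ ∏ p ∈ s, h p := by
  classical
  induction s using Finset.induction_on generalizing T with
  | empty =>
    have hsub : T ⊆ {1} := by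
      intro m hm
      by_contra hne
      obtain ⟨p, hp, hpm⟩ := Nat.exists_prime_and_dvd (by simpa using hne)
      exact absurd ((hT m hm).2 p hp hpm) (by simp)
    calc ∑ m ∈ T, g m ≤ ∑ m ∈ {1}, g m :=
          Finset.sum_le_sum_of_subset_of_nonneg hsub fun _ _ _ => hg _
      _ ≤ _ := by simpa using h1
  | insert p s hps ih =>
    have hp : p.Prime := hs p (by simp)
    set E := T.sup (fun m => m.factorization p) + 1 with hE
    set T' := T.image (fun m => ordCompl[p] m) with hT'
    have hT'' : ∀ m ∈ T', m ≠ 0 ∧ ∀ q, q.Prime → q ∣ m → q ∈ s := by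
      intro m hm
      obtain ⟨n, hn, rfl⟩ := Finset.mem_image.1 hm
      have hn0 := (hT n hn).1
      refine ⟨(Nat.ordCompl_pos p hn0).ne', fun q hq hqm => ?_⟩
      have h2 := (hT n hn).2 q hq (hqm.trans (Nat.ordCompl_dvd n p))
      rcases Finset.mem_insert.1 h2 with rfl | h2
      · exact absurd hqm (Nat.not_dvd_ordCompl hp hn0)
      · exact h2
    have ih' := ih (fun q hq => hs q (by simp [hq])) (fun q hq => hh q (by simp [hq])) T' hT''
    have hs0 : 0 ≤ ∑ m ∈ T', g m := Finset.sum_nonneg fun _ _ => hg _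
    have hhp : 0 ≤ h p := by simpa using hh p (by simp) 0
    rw [Finset.prod_insert hps]
    calc ∑ m ∈ T, g m ≤ ∑ m ∈ T, g (p ^ (m.factorization p)) * g (ordCompl[p] m) := by
          refine Finset.sum_le_sum fun m hm => ?_
          conv_lhs => rw [← Nat.ordProj_mul_ordCompl_eq_self m p]
          exact hmul p _ _ hp (Nat.not_dvd_ordCompl hp (hT m hm).1)
      -- Each m is recovered from its exponent at p and its prime-to-p part, so the sum embeds in a
      -- product set, where it factors.
      _ = ∑ x ∈ T.image (fun m => (m.factorization p, ordCompl[p] m)), g (p ^ x.1) * g x.2 := by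
          rw [Finset.sum_image]
          intro a _ b _ hab
          simp only [Prod.mk.injEq] at hab
          rw [← Nat.ordProj_mul_ordCompl_eq_self a p, ← Nat.ordProj_mul_ordCompl_eq_self b p,
            hab.2, hab.1]
      _ ≤ ∑ x ∈ Finset.range E ×ˢ T', g (p ^ x.1) * g x.2 := by
          refine Finset.sum_le_sum_of_subset_of_nonneg ?_ fun _ _ _ => mul_nonneg (hg _) (hg _)
          intro x hx
          obtain ⟨m, hm, rfl⟩ := Finset.mem_image.1 hx
          refine Finset.mem_product.2 ⟨Finset.mem_range.2 ?_, Finset.mem_image_of_mem _ hm⟩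
          exact Nat.lt_succ_of_le (Finset.le_sup (f := fun m => m.factorization p) hm)
      _ = (∑ e ∈ Finset.range E, g (p ^ e)) * ∑ m ∈ T', g m := by
          rw [Finset.sum_product, Finset.sum_mul_sum]
      _ ≤ h p * ∏ q ∈ s, h q := mul_le_mul (hh p (by simp) E) ih' hs0 hhp

theorem geom_sum_le_inv {t : ℝ} (h0 : 0 ≤ t) (h1 : t < 1) (E : ℕ) :
    ∑ e ∈ Finset.range E, t ^ e ≤ (1 - t)⁻¹ := by
  rw [← tsum_geometric_of_lt_one h0 h1]
  exact (summable_geometric_of_lt_one h0 h1).sum_le_tsum _ fun _ _ => pow_nonneg h0 _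

theorem inv_one_sub_le_exp {t : ℝ} (h0 : 0 ≤ t) (h1 : t ≤ 3 / 4) :
    (1 - t)⁻¹ ≤ Real.exp (4 * t) := by
  have h2 : 0 < 1 - t := by linarith
  have h3 : (1 - t)⁻¹ = t / (1 - t) + 1 := by field_simp; ring
  rw [h3]
  refine (Real.add_one_le_exp _).trans (Real.exp_le_exp.2 ?_)
  rw [div_le_iff₀ h2]
  nlinarith

/-- The worst case is 2^(-1/2) < 3/4. Staying below 3/4 keeps every local geometric series,
including the one at 2, bounded by 4. -/
theorem prime_rpow_neg_le {p : ℕ} (hp : 2 ≤ p) {σ : ℝ} (hσ : 1 / 2 ≤ σ) :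
    (p : ℝ) ^ (-σ) ≤ 3 / 4 := by
  have h2 : (2 : ℝ) ≤ p := by exact_mod_cast hp
  calc (p : ℝ) ^ (-σ) ≤ (p : ℝ) ^ (-(1 / 2) : ℝ) :=
        Real.rpow_le_rpow_of_exponent_le (by linarith) (by linarith)
    _ ≤ 3 / 4 := by
      rw [Real.rpow_neg (by linarith), ← Real.sqrt_eq_rpow]
      have : 4 / 3 ≤ √(p : ℝ) := Real.le_sqrt_of_sq_le (by linarith)
      calc (√(p : ℝ))⁻¹ ≤ (4 / 3)⁻¹ := inv_anti₀ (by norm_num) this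
        _ = 3 / 4 := by norm_num

/-- Rankin-type bound for sums over integers composed of primes in a finite set. -/
theorem sum_rpow_neg_le_exp {σ : ℝ} (hσ : 1 / 2 ≤ σ) (s : Finset ℕ) (hs : ∀ p ∈ s, p.Prime)
    (T : Finset ℕ) (hT : ∀ m ∈ T, m ≠ 0 ∧ ∀ p, p.Prime → p ∣ m → p ∈ s) :
    ∑ m ∈ T, (m : ℝ) ^ (-σ) ≤ Real.exp (4 * ∑ p ∈ s, (p : ℝ) ^ (-σ)) := by
  have hpos : ∀ n : ℕ, 0 ≤ (n : ℝ) ^ (-σ) := fun n => Real.rpow_nonneg n.cast_nonneg _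
  rw [Finset.mul_sum, Real.exp_sum]
  refine sum_le_prod_of_multiplicative (g := fun m => (m : ℝ) ^ (-σ)) hpos (by simp) ?_ s hs ?_ T hT
  · intro p e m _ _
    rw [Nat.cast_mul, Real.mul_rpow (by positivity) (by positivity)]
  · intro p hp E
    have h34 := prime_rpow_neg_le (hs p hp).two_le hσ
    refine le_trans ?_ (inv_one_sub_le_exp (hpos p) h34)
    refine le_trans (le_of_eq ?_) (geom_sum_le_inv (hpos p) (by linarith) E)
    refine Finset.sum_congr rfl fun e _ => ?_
    rw [Nat.cast_pow, ← Real.rpow_natCast, ← Real.rpow_natCast, ← Real.rpow_mul (by positivity),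
      ← Real.rpow_mul (by positivity), mul_comm]

/-! ### Mertens-type estimates, with primes on a logarithmic scale. -/

/-- Every n ≤ z is composed of primes up to z, so the inverse product dominates the harmonic sum,
hence log z. -/
theorem prod_one_sub_inv_le (z : ℕ) (hz : 2 ≤ z) :
    ∏ p ∈ (Finset.range (z + 1)).filter Nat.Prime, (1 - (p : ℝ)⁻¹) ≤ (Real.log z)⁻¹ := by
  have hlog : 0 < Real.log z := Real.log_pos (by exact_mod_cast hz)
  have hlt : ∀ p ∈ (Finset.range (z + 1)).filter Nat.Prime, (p : ℝ)⁻¹ < 1 := by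
    intro p hp
    exact inv_lt_one_of_one_lt₀ (by exact_mod_cast (Finset.mem_filter.1 hp).2.one_lt)
  have hprod : 0 < ∏ p ∈ (Finset.range (z + 1)).filter Nat.Prime, (1 - (p : ℝ)⁻¹) :=
    Finset.prod_pos fun p hp => by linarith [hlt p hp]
  rw [le_inv_comm₀ hprod hlog, ← Finset.prod_inv_distrib]
  have h1 : Real.log z ≤ ∑ n ∈ Finset.Icc 1 z, (n : ℝ)⁻¹ := by
    have h := log_add_one_le_harmonic z
    rw [harmonic_eq_sum_Icc] at h
    push_cast at h
    refine le_trans (Real.log_le_log (by positivity) (by linarith)) h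
  refine h1.trans ?_
  refine sum_le_prod_of_multiplicative (g := fun m => (m : ℝ)⁻¹) (fun n => by positivity)
    (by simp) ?_ _ (fun p hp => (Finset.mem_filter.1 hp).2) ?_ _ ?_
  · intro p e m _ _
    rw [Nat.cast_mul, mul_inv]
  · intro p hp E
    simpa using geom_sum_le_inv (by positivity) (hlt p hp) E
  · intro m hm
    rw [Finset.mem_Icc] at hm
    refine ⟨by omega, fun p hp hpm => ?_⟩
    have := Nat.le_of_dvd (by omega) hpm
    simp [hp]; omega

/-- The upper bound in Mertens' first theorem. -/
theorem sum_log_div_prime_le (N : ℕ) :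
    ∑ p ∈ (Finset.range (N + 1)).filter Nat.Prime, Real.log p / p ≤ Real.log N + Real.log 4 := by
  rcases Nat.eq_zero_or_pos N with rfl | hN
  · simp [Finset.filter_singleton, Nat.not_prime_zero]
    positivity
  set P := (Finset.range (N + 1)).filter Nat.Prime with hP
  have hNpos : (0 : ℝ) < N := by exact_mod_cast hN
  -- Only the first term of Legendre's formula is kept. With N! ≤ N^N it bounds the sum of ⌊N/p⌋ log
  -- p, and removing the floors costs Chebyshev's θ(N) ≤ N log 4.
  have hdvd : ∏ p ∈ P, p ^ (N / p) ∣ N.factorial := by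
    refine Finset.prod_dvd_of_isRelPrime ?_ fun p hp => ?_
    · intro p hp q hq hpq
      exact Nat.coprime_iff_isRelPrime.1 (Nat.Coprime.pow _ _
        ((Nat.coprime_primes (Finset.mem_filter.1 hp).2 (Finset.mem_filter.1 hq).2).2 hpq))
    · have hpp := (Finset.mem_filter.1 hp).2
      rw [hpp.pow_dvd_factorial_iff (Nat.lt_succ_self _)]
      by_cases h0 : N < p
      · simp [Nat.div_eq_of_lt h0]
      · have hl : 1 ≤ Nat.log p N := Nat.log_pos hpp.one_lt (not_lt.1 h0)
        calc N / p = N / p ^ 1 := by simp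
          _ ≤ _ := Finset.single_le_sum (f := fun i => N / p ^ i) (fun _ _ => Nat.zero_le _)
              (Finset.mem_Ico.2 ⟨le_rfl, Nat.lt_succ_of_le hl⟩)
  have h1 : ∑ p ∈ P, ((N / p : ℕ) : ℝ) * Real.log p ≤ N * Real.log N := by
    have h2 : ((∏ p ∈ P, p ^ (N / p) : ℕ) : ℝ) ≤ (N : ℝ) ^ N := by
      exact_mod_cast (Nat.le_of_dvd (Nat.factorial_pos N) hdvd).trans (Nat.factorial_le_pow N)
    have h3 : (0 : ℝ) < ((∏ p ∈ P, p ^ (N / p) : ℕ) : ℝ) := by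
      have : 0 < ∏ p ∈ P, p ^ (N / p) :=
        Finset.prod_pos fun p hp => pow_pos (Finset.mem_filter.1 hp).2.pos _
      exact_mod_cast this
    have h4 := Real.log_le_log h3 h2
    rw [Real.log_pow] at h4
    refine le_trans (le_of_eq ?_) h4
    push_cast
    rw [Real.log_prod]
    · exact Finset.sum_congr rfl fun p _ => by rw [Real.log_pow]
    · intro p hp
      have := (Finset.mem_filter.1 hp).2.pos
      positivity
  have h2 : ∑ p ∈ P, Real.log p ≤ Real.log 4 * N := by
    have h := Chebyshev.theta_le_log4_mul_x (x := N) hNpos.le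
    rw [Chebyshev.theta_eq_sum_primesLE] at h
    refine le_trans (le_of_eq ?_) h
    refine Finset.sum_congr ?_ fun _ _ => rfl
    ext p
    simp [hP, Nat.mem_primesLE]
  have h3 : N * ∑ p ∈ P, Real.log p / p ≤
      ∑ p ∈ P, ((N / p : ℕ) : ℝ) * Real.log p + ∑ p ∈ P, Real.log p := by
    rw [Finset.mul_sum, ← Finset.sum_add_distrib]
    refine Finset.sum_le_sum fun p hp => ?_
    have hpp : (0 : ℝ) < p := by exact_mod_cast (Finset.mem_filter.1 hp).2.pos
    have hl : 0 ≤ Real.log p := Real.log_natCast_nonneg p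
    have h5 : (N : ℝ) / p ≤ ((N / p : ℕ) : ℝ) + 1 := by
      rw [← Nat.floor_div_eq_div (K := ℝ)]
      exact (Nat.lt_floor_add_one _).le
    calc (N : ℝ) * (Real.log p / p) = N / p * Real.log p := by ring
      _ ≤ (((N / p : ℕ) : ℝ) + 1) * Real.log p := by gcongr
      _ = _ := by ring
  have h4 : N * ∑ p ∈ P, Real.log p / p ≤ N * (Real.log N + Real.log 4) := by linarith
  exact le_of_mul_le_mul_left h4 hNpos

/-- The primes `p` with `u < log p ≤ v`. -/
noncomputable def logPrimes (u v : ℝ) : Finset ℕ :=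
  (Finset.range (⌊Real.exp v⌋₊ + 1)).filter fun p => p.Prime ∧ u < Real.log p

theorem mem_logPrimes {u v : ℝ} {p : ℕ} :
    p ∈ logPrimes u v ↔ p.Prime ∧ u < Real.log p ∧ Real.log p ≤ v := by
  simp only [logPrimes, Finset.mem_filter, Finset.mem_range, Nat.lt_succ_iff]
  constructor
  · rintro ⟨h1, h2, h3⟩
    have hp : (0 : ℝ) < p := by exact_mod_cast h2.pos
    exact ⟨h2, h3, (Real.log_le_iff_le_exp hp).2 ((Nat.le_floor_iff (Real.exp_pos v).le).1 h1)⟩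
  · rintro ⟨h1, h2, h3⟩
    have hp : (0 : ℝ) < p := by exact_mod_cast h1.pos
    exact ⟨(Nat.le_floor_iff (Real.exp_pos v).le).2 ((Real.log_le_iff_le_exp hp).1 h3), h1, h2⟩

theorem sum_logPrimes_log_div_le (u : ℝ) {v : ℝ} (hv : 0 ≤ v) :
    ∑ p ∈ logPrimes u v, Real.log p / p ≤ v + Real.log 4 := by
  have h1 : (1 : ℝ) ≤ Real.exp v := Real.one_le_exp hv
  have hfl : 1 ≤ ⌊Real.exp v⌋₊ := (Nat.one_le_floor_iff _).2 h1
  calc ∑ p ∈ logPrimes u v, Real.log p / p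
      ≤ ∑ p ∈ (Finset.range (⌊Real.exp v⌋₊ + 1)).filter Nat.Prime, Real.log p / p := by
        refine Finset.sum_le_sum_of_subset_of_nonneg ?_ fun p _ _ =>
          div_nonneg (Real.log_natCast_nonneg p) p.cast_nonneg
        exact Finset.monotone_filter_right _ fun p _ hp => hp.1
    _ ≤ Real.log ⌊Real.exp v⌋₊ + Real.log 4 := sum_log_div_prime_le _
    _ ≤ v + Real.log 4 := by
        gcongr
        rw [Real.log_le_iff_le_exp (by exact_mod_cast hfl)]
        exact Nat.floor_le (Real.exp_pos v).le

/-- On this range 1/p ≤ (log p / p)/u, and the Mertens bound 2u + log 4 is at most 4u. -/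
theorem sum_inv_logPrimes_double_le {u : ℝ} (hu : Real.log 2 ≤ u) :
    ∑ p ∈ logPrimes u (2 * u), (p : ℝ)⁻¹ ≤ 4 := by
  have hl2 : 0 < Real.log 2 := Real.log_pos (by norm_num)
  have hu0 : 0 < u := hl2.trans_le hu
  have h4 : Real.log 4 = 2 * Real.log 2 := by
    rw [show (4 : ℝ) = 2 ^ 2 by norm_num, Real.log_pow]; norm_num
  have h := sum_logPrimes_log_div_le u (v := 2 * u) (by linarith)
  have h2 : u * ∑ p ∈ logPrimes u (2 * u), (p : ℝ)⁻¹ ≤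
      ∑ p ∈ logPrimes u (2 * u), Real.log p / p := by
    rw [Finset.mul_sum]
    refine Finset.sum_le_sum fun p hp => ?_
    rw [div_eq_mul_inv]
    exact mul_le_mul_of_nonneg_right (mem_logPrimes.1 hp).2.1.le (by positivity)
  have h3 : u * ∑ p ∈ logPrimes u (2 * u), (p : ℝ)⁻¹ ≤ u * 4 := by linarith
  exact le_of_mul_le_mul_left h3 hu0

theorem sum_inv_logPrimes_pow_le {u : ℝ} (hu : Real.log 2 ≤ u) (j : ℕ) :
    ∑ p ∈ logPrimes u (2 ^ j * u), (p : ℝ)⁻¹ ≤ 4 * j := by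
  have hl2 : 0 < Real.log 2 := Real.log_pos (by norm_num)
  induction j with
  | zero =>
    have : logPrimes u (2 ^ 0 * u) = ∅ := by
      refine Finset.eq_empty_of_forall_notMem fun p hp => ?_
      have := mem_logPrimes.1 hp
      simp at this
      linarith
    rw [this]
    simp
  | succ j ih =>
    have hsub : logPrimes u (2 ^ (j + 1) * u) ⊆
        logPrimes u (2 ^ j * u) ∪ logPrimes (2 ^ j * u) (2 * (2 ^ j * u)) := by
      intro p hp
      rw [Finset.mem_union, mem_logPrimes, mem_logPrimes]
      obtain ⟨h1, h2, h3⟩ := mem_logPrimes.1 hp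
      rcases le_or_gt (Real.log p) (2 ^ j * u) with h | h
      · exact Or.inl ⟨h1, h2, h⟩
      · exact Or.inr ⟨h1, h, by rw [pow_succ] at h3; linarith⟩
    have hge : Real.log 2 ≤ 2 ^ j * u := by
      have : (1 : ℝ) ≤ 2 ^ j := one_le_pow₀ (by norm_num)
      nlinarith
    calc ∑ p ∈ logPrimes u (2 ^ (j + 1) * u), (p : ℝ)⁻¹
        ≤ ∑ p ∈ logPrimes u (2 ^ j * u) ∪ logPrimes (2 ^ j * u) (2 * (2 ^ j * u)), (p : ℝ)⁻¹ :=
          Finset.sum_le_sum_of_subset_of_nonneg hsub fun _ _ _ => by positivity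
      _ ≤ ∑ p ∈ logPrimes u (2 ^ j * u), (p : ℝ)⁻¹ +
          ∑ p ∈ logPrimes (2 ^ j * u) (2 * (2 ^ j * u)), (p : ℝ)⁻¹ := by
          rw [← Finset.sum_union_inter]
          exact le_add_of_nonneg_right (Finset.sum_nonneg fun _ _ => by positivity)
      _ ≤ 4 * j + 4 := add_le_add ih (sum_inv_logPrimes_double_le hge)
      _ = _ := by push_cast; ring

/-- About log₂(v/u) doublings cover the range, each costing 4, and 4/log 2 < 6. -/
theorem sum_inv_logPrimes_le {u v : ℝ} (hu : Real.log 2 ≤ u) (huv : u ≤ v) :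
    ∑ p ∈ logPrimes u v, (p : ℝ)⁻¹ ≤ 4 + 6 * Real.log (v / u) := by
  have hl2 : 0 < Real.log 2 := Real.log_pos (by norm_num)
  have hu0 : 0 < u := hl2.trans_le hu
  set t := Real.log (v / u) / Real.log 2 with ht
  have hlog : 0 ≤ Real.log (v / u) := Real.log_nonneg ((one_le_div hu0).2 huv)
  have ht0 : 0 ≤ t := div_nonneg hlog hl2.le
  have hv : v ≤ 2 ^ ⌈t⌉₊ * u := by
    rw [← div_le_iff₀ hu0, ← Real.log_le_log_iff (div_pos (hu0.trans_le huv) hu0) (by positivity),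
      Real.log_pow, ← div_le_iff₀ hl2]
    exact Nat.le_ceil t
  calc ∑ p ∈ logPrimes u v, (p : ℝ)⁻¹ ≤ ∑ p ∈ logPrimes u (2 ^ ⌈t⌉₊ * u), (p : ℝ)⁻¹ := by
        refine Finset.sum_le_sum_of_subset_of_nonneg (fun p hp => ?_) fun _ _ _ => by positivity
        obtain ⟨h1, h2, h3⟩ := mem_logPrimes.1 hp
        exact mem_logPrimes.2 ⟨h1, h2, h3.trans hv⟩
    _ ≤ 4 * ⌈t⌉₊ := sum_inv_logPrimes_pow_le hu _
    _ ≤ 4 * (t + 1) := by gcongr; exact (Nat.ceil_lt_add_one ht0).le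
    _ ≤ 4 + 6 * Real.log (v / u) := by
        have h69 : 0.6931471803 < Real.log 2 := Real.log_two_gt_d9
        have : t ≤ 1.5 * Real.log (v / u) := by
          rw [ht, div_le_iff₀ hl2]
          nlinarith
        linarith

/-- By convexity, exp on [0, ηv] lies below its chord. The excess over 1/p is thus weighted by log
p, so that Mertens' first theorem sums it to O(e^(ηv)) without an extra logarithm. -/
theorem rpow_neg_one_sub_le {p : ℕ} (hp : 0 < p) {η v : ℝ} (hv : 0 < v)
    (hpv : Real.log p ≤ v) :
    (p : ℝ) ^ (-(1 - η)) ≤ (p : ℝ)⁻¹ + Real.exp (η * v) / v * (Real.log p / p) := by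
  have hp0 : (0 : ℝ) < p := by exact_mod_cast hp
  have hl : 0 ≤ Real.log p := Real.log_natCast_nonneg p
  have h1 : (p : ℝ) ^ (-(1 - η)) = (p : ℝ)⁻¹ * Real.exp (η * Real.log p) := by
    rw [show -(1 - η) = -1 + η by ring, Real.rpow_add hp0, Real.rpow_neg_one,
      Real.rpow_def_of_pos hp0 η, mul_comm η]
  set t := Real.log p / v with ht
  have ht0 : 0 ≤ t := div_nonneg hl hv.le
  have ht1 : t ≤ 1 := (div_le_one hv).2 hpv
  have h2 : Real.exp (η * Real.log p) ≤ 1 + t * Real.exp (η * v) := by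
    have hc := convexOn_exp.2 (Set.mem_univ (0 : ℝ)) (Set.mem_univ (η * v))
      (sub_nonneg.2 ht1) ht0 (by ring)
    simp only [smul_eq_mul, mul_zero, zero_add, Real.exp_zero, mul_one] at hc
    have : t * (η * v) = η * Real.log p := by rw [ht]; field_simp
    rw [this] at hc
    linarith
  rw [h1]
  calc (p : ℝ)⁻¹ * Real.exp (η * Real.log p) ≤ (p : ℝ)⁻¹ * (1 + t * Real.exp (η * v)) := by gcongr
    _ = _ := by rw [ht]; field_simp

theorem sum_rpow_logPrimes_le {u v : ℝ} (η : ℝ) (hu : Real.log 2 ≤ u) (huv : u ≤ v) :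
    ∑ p ∈ logPrimes u v, (p : ℝ) ^ (-(1 - η)) ≤
      4 + 6 * Real.log (v / u) + 3 * Real.exp (η * v) := by
  have hl2 : 0 < Real.log 2 := Real.log_pos (by norm_num)
  have hv0 : 0 < v := by linarith
  have h4 : Real.log 4 = 2 * Real.log 2 := by
    rw [show (4 : ℝ) = 2 ^ 2 by norm_num, Real.log_pow]; norm_num
  calc ∑ p ∈ logPrimes u v, (p : ℝ) ^ (-(1 - η))
      ≤ ∑ p ∈ logPrimes u v, ((p : ℝ)⁻¹ + Real.exp (η * v) / v * (Real.log p / p)) := by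
        refine Finset.sum_le_sum fun p hp => ?_
        obtain ⟨h1, h2, h3⟩ := mem_logPrimes.1 hp
        exact rpow_neg_one_sub_le h1.pos hv0 h3
    _ = ∑ p ∈ logPrimes u v, (p : ℝ)⁻¹ +
        Real.exp (η * v) / v * ∑ p ∈ logPrimes u v, Real.log p / p := by
        rw [Finset.sum_add_distrib, Finset.mul_sum]
    _ ≤ 4 + 6 * Real.log (v / u) + Real.exp (η * v) / v * (v + Real.log 4) := by
        gcongr
        · exact sum_inv_logPrimes_le hu huv
        · exact sum_logPrimes_log_div_le u hv0.le
    _ ≤ 4 + 6 * Real.log (v / u) + Real.exp (η * v) / v * (3 * v) := by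
        gcongr
        linarith
    _ = _ := by field_simp

/-! ### Brun's pure sieve. -/

/-- An upper Bonferroni inequality: truncating the alternating sum over subsets at an even level
bounds the indicator of the empty set from above. -/
theorem ite_empty_le_sum_powerset {α : Type*} [DecidableEq α] (D : Finset α) (m : ℕ) :
    (if D = ∅ then (1 : ℝ) else 0) ≤
      ∑ S ∈ D.powerset, if S.card ≤ 2 * m then (-1 : ℝ) ^ S.card else 0 := by
  have h := Finset.sum_powerset_apply_card
    (f := fun j => if j ≤ 2 * m then (-1 : ℝ) ^ j else 0) (x := D)
  rw [h]
  have h2 : ∑ j ∈ Finset.range (D.card + 1), D.card.choose j •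
      (if j ≤ 2 * m then (-1 : ℝ) ^ j else 0) =
      ∑ j ∈ Finset.range (2 * m + 1), (-1 : ℝ) ^ j * D.card.choose j := by
    have h3 : ∀ j, D.card.choose j • (if j ≤ 2 * m then (-1 : ℝ) ^ j else 0) =
        if j ∈ Finset.range (2 * m + 1) then (-1 : ℝ) ^ j * D.card.choose j else 0 := by
      intro j
      simp only [nsmul_eq_mul, Finset.mem_range, Nat.lt_succ_iff]
      split_ifs <;> ring
    simp_rw [h3]
    rw [← Finset.sum_filter, ← Finset.sum_filter_add_sum_filter_not (Finset.range (2 * m + 1))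
      (· ∈ Finset.range (D.card + 1)), Finset.filter_mem_eq_inter, Finset.filter_mem_eq_inter,
      Finset.inter_comm, left_eq_add]
    refine Finset.sum_eq_zero fun j hj => ?_
    rw [Finset.mem_filter, Finset.mem_range, Finset.mem_range] at hj
    rw [Nat.choose_eq_zero_of_lt (by omega)]
    simp
  rw [h2]
  rcases Nat.eq_zero_or_pos D.card with h0 | h0
  · rw [if_pos (Finset.card_eq_zero.1 h0), h0, Finset.sum_range_succ']
    simp
  · obtain ⟨n, hn⟩ : ∃ n, D.card = n + 1 := ⟨D.card - 1, by omega⟩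
    rw [if_neg (by rintro rfl; simp at h0), hn]
    -- The alternating sum of C(n+1, j) over j ≤ 2m equals C(n, 2m), which is nonnegative.
    have h4 := @Int.alternating_sum_range_choose_eq_choose n (2 * m)
    have h5 : ∑ j ∈ Finset.range (2 * m + 1), (-1 : ℝ) ^ j * ((n + 1).choose j : ℝ) =
        (-1) ^ (2 * m) * (n.choose (2 * m) : ℝ) := by exact_mod_cast h4
    rw [h5, pow_mul]
    simp

/-- As `a` is invertible modulo `d`, the condition selects one residue class, and a half-open
interval of length `B` meets it B/d times up to an error of 1. -/
theorem abs_card_filter_dvd_sub_le {a d : ℕ} (hd : 0 < d) (had : a.Coprime d) (c : ℤ) (B : ℕ) :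
    |(((Finset.Ioc B (2 * B)).filter fun b : ℕ => (d : ℤ) ∣ a * b + c).card : ℝ) - B / d| ≤ 1 := by
  have hu : ∃ v : ℕ, ∀ b : ℕ, (d : ℤ) ∣ a * b + c ↔ b ≡ v [MOD d] := by
    obtain ⟨u, w, huw⟩ := Nat.isCoprime_iff_coprime.2 had
    have hd' : (d : ℤ) ≠ 0 := by exact_mod_cast hd.ne'
    refine ⟨((-u * c) % d).toNat, fun b => ?_⟩
    rw [← Int.natCast_modEq_iff, Int.toNat_of_nonneg (Int.emod_nonneg _ hd')]
    have h1 : (b : ℤ) ≡ -u * c % d [ZMOD d] ↔ (d : ℤ) ∣ b + u * c := by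
      rw [Int.modEq_comm, Int.ModEq, Int.emod_emod, ← Int.ModEq, Int.modEq_iff_dvd]
      ring_nf
    rw [h1]
    constructor
    · intro h
      have h2 : (b : ℤ) + u * c = u * (a * b + c) + d * (w * b) := by linear_combination b * -huw
      exact h2 ▸ dvd_add (h.mul_left u) (dvd_mul_right _ _)
    · intro h
      have h2 : (a : ℤ) * b + c = a * (b + u * c) + d * (w * c) := by linear_combination c * -huw
      exact h2 ▸ dvd_add (h.mul_left _) (dvd_mul_right _ _)
  obtain ⟨v, hv⟩ := hu
  simp_rw [hv]
  have h := Nat.Ioc_filter_modEq_card B (2 * B) hd v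
  set n := ((Finset.Ioc B (2 * B)).filter fun b => b ≡ v [MOD d]).card
  have hle : ((B : ℚ) - v) / d ≤ ((2 * B : ℕ) - v) / d := by
    gcongr
    linarith [(Nat.cast_nonneg B : (0 : ℚ) ≤ B)]
  rw [max_eq_left (sub_nonneg.2 (Int.floor_mono hle))] at h
  have h1 := Int.floor_le (((B : ℚ) - v) / d)
  have h2 := Int.lt_floor_add_one (((B : ℚ) - v) / d)
  have h3 := Int.floor_le ((((2 * B : ℕ) : ℚ) - v) / d)
  have h4 := Int.lt_floor_add_one ((((2 * B : ℕ) : ℚ) - v) / d)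
  have h5 : (((2 * B : ℕ) : ℚ) - v) / d = ((B : ℚ) - v) / d + B / d := by
    push_cast; ring
  have h6 : (n : ℚ) = ⌊(((2 * B : ℕ) : ℚ) - v) / d⌋ - ⌊((B : ℚ) - v) / d⌋ := by exact_mod_cast h
  have h7 : |(n : ℚ) - B / d| ≤ 1 := by
    rw [abs_le]
    constructor <;> linarith
  have h8 : ((|(n : ℚ) - B / d| : ℚ) : ℝ) ≤ ((1 : ℚ) : ℝ) := Rat.cast_le.2 h7
  push_cast at h8
  exact h8

theorem card_powerset_card_le {α : Type*} [DecidableEq α] (P : Finset α) (k : ℕ) :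
    (P.powerset.filter fun S => S.card ≤ k).card ≤ (P.card + 1) ^ k := by
  have h : (P.powerset.filter fun S => S.card ≤ k).card =
      ∑ j ∈ Finset.range (k + 1), P.card.choose j := by
    rw [Finset.card_eq_sum_card_fiberwise (f := Finset.card) (t := Finset.range (k + 1))]
    · refine Finset.sum_congr rfl fun j hj => ?_
      rw [← Finset.card_powersetCard]
      congr 1
      ext S
      simp only [Finset.mem_filter, Finset.mem_powerset, Finset.mem_powersetCard]
      have := Finset.mem_range.1 hj
      constructor
      · rintro ⟨⟨h1, _⟩, h2⟩; exact ⟨h1, h2⟩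
      · rintro ⟨h1, h2⟩; exact ⟨⟨h1, by omega⟩, h2⟩
    · intro S hS
      have := (Finset.mem_filter.1 hS).2
      simp only [Finset.coe_range, Set.mem_Iio]
      omega
  rw [h, add_pow]
  refine Finset.sum_le_sum fun j hj => ?_
  have h2 : j ≤ k := Nat.lt_succ_iff.1 (Finset.mem_range.1 hj)
  calc P.card.choose j ≤ P.card ^ j := Nat.choose_le_pow _ _
    _ ≤ _ := by
      rw [one_pow, mul_one]
      exact Nat.le_mul_of_pos_right _ (Nat.choose_pos h2)

open Classical in
/-- Brun's pure sieve for the values of a linear form on a dyadic interval. -/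
theorem card_sifted_le {a z : ℕ} (ha : ∀ p : ℕ, p.Prime → p ≤ z → ¬ p ∣ a) (c : ℤ) (B m : ℕ) :
    (((Finset.Ioc B (2 * B)).filter fun b : ℕ =>
      ∀ p : ℕ, p.Prime → p ≤ z → ¬ (p : ℤ) ∣ a * b + c).card : ℝ) ≤
      B * (∏ p ∈ (Finset.range (z + 1)).filter Nat.Prime, (1 - (p : ℝ)⁻¹) +
        Real.exp (-(2 * m)) *
          ∏ p ∈ (Finset.range (z + 1)).filter Nat.Prime, (1 + Real.exp 1 * (p : ℝ)⁻¹)) +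
      (z + 1) ^ (2 * m) := by
  set P := (Finset.range (z + 1)).filter Nat.Prime with hP
  have hPp : ∀ p ∈ P, p.Prime := fun p hp => (Finset.mem_filter.1 hp).2
  have hPz : ∀ p, p ∈ P ↔ p.Prime ∧ p ≤ z := by
    intro p; simp [hP, and_comm]
  set I := Finset.Ioc B (2 * B)
  let D : ℕ → Finset ℕ := fun b => P.filter fun p => ((p : ℕ) : ℤ) ∣ a * b + c
  let w : Finset ℕ → ℝ := fun S => if S.card ≤ 2 * m then (-1 : ℝ) ^ S.card else 0
  let N : Finset ℕ → ℝ := fun S => ((I.filter fun b => S ⊆ D b).card : ℝ)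
  have hcard : ((I.filter fun b : ℕ => ∀ p : ℕ, p.Prime → p ≤ z → ¬ (p : ℤ) ∣ a * b + c).card : ℝ) =
      ∑ b ∈ I, if D b = ∅ then (1 : ℝ) else 0 := by
    rw [← Finset.sum_filter, Finset.sum_const, nsmul_eq_mul, mul_one]
    congr 2
    refine Finset.filter_congr fun b _ => ?_
    simp only [D, Finset.filter_eq_empty_iff, hPz, and_imp]
  have hstep1 : ∑ b ∈ I, (if D b = ∅ then (1 : ℝ) else 0) ≤ ∑ S ∈ P.powerset, w S * N S := by
    calc ∑ b ∈ I, (if D b = ∅ then (1 : ℝ) else 0)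
        ≤ ∑ b ∈ I, ∑ S ∈ (D b).powerset, w S :=
          Finset.sum_le_sum fun b _ => ite_empty_le_sum_powerset (D b) m
      _ = ∑ b ∈ I, ∑ S ∈ P.powerset, if S ⊆ D b then w S else 0 := by
          refine Finset.sum_congr rfl fun b _ => ?_
          have hpow : (D b).powerset = P.powerset.filter (· ⊆ D b) := by
            ext S
            simp only [Finset.mem_powerset, Finset.mem_filter]
            exact ⟨fun h => ⟨h.trans (Finset.filter_subset _ _), h⟩, fun h => h.2⟩
          rw [hpow, Finset.sum_filter]
      _ = ∑ S ∈ P.powerset, w S * N S := by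
          rw [Finset.sum_comm]
          refine Finset.sum_congr rfl fun S _ => ?_
          rw [← Finset.sum_filter, Finset.sum_const, nsmul_eq_mul, mul_comm]
  have hN : ∀ S ∈ P.powerset, |N S - B * ∏ p ∈ S, (p : ℝ)⁻¹| ≤ 1 := by
    intro S hS
    have hSP := Finset.mem_powerset.1 hS
    have hd0 : 0 < ∏ p ∈ S, p := Finset.prod_pos fun p hp => (hPp p (hSP hp)).pos
    have hcop : a.Coprime (∏ p ∈ S, p) := by
      refine Nat.Coprime.prod_right fun p hp => ?_
      have h := (hPz p).1 (hSP hp)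
      exact ((Nat.Prime.coprime_iff_not_dvd h.1).2 (ha p h.1 h.2)).symm
    have h := abs_card_filter_dvd_sub_le hd0 hcop c B
    have heq : (I.filter fun b => S ⊆ D b) =
        I.filter fun b : ℕ => ((∏ p ∈ S, p : ℕ) : ℤ) ∣ a * b + c := by
      refine Finset.filter_congr fun b _ => ?_
      constructor
      · intro hSD
        rw [← Int.natAbs_dvd_natAbs, Int.natAbs_natCast]
        refine Finset.prod_primes_dvd _ (fun p hp => (hPp p (hSP hp)).prime) fun p hp => ?_
        have := (Finset.mem_filter.1 (hSD hp)).2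
        rwa [← Int.natAbs_dvd_natAbs, Int.natAbs_natCast] at this
      · intro hdvd p hp
        refine Finset.mem_filter.2 ⟨hSP hp, dvd_trans ?_ hdvd⟩
        exact_mod_cast Finset.dvd_prod_of_mem (fun p => p) hp
    simp only [N, heq]
    rw [Finset.prod_inv_distrib, ← div_eq_mul_inv, ← Nat.cast_prod]
    exact h
  have hw : ∀ S, |w S| ≤ if S.card ≤ 2 * m then 1 else 0 := by
    intro S
    simp only [w]
    split_ifs <;> simp
  have hstep2 : ∑ S ∈ P.powerset, w S * N S ≤
      B * ∑ S ∈ P.powerset, w S * ∏ p ∈ S, (p : ℝ)⁻¹ + (z + 1) ^ (2 * m) := by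
    have h1 : ∑ S ∈ P.powerset, (w S * N S - w S * (B * ∏ p ∈ S, (p : ℝ)⁻¹)) ≤
        ∑ S ∈ P.powerset, if S.card ≤ 2 * m then (1 : ℝ) else 0 := by
      refine Finset.sum_le_sum fun S hS => ?_
      calc w S * N S - w S * (B * ∏ p ∈ S, (p : ℝ)⁻¹)
          ≤ |w S * (N S - B * ∏ p ∈ S, (p : ℝ)⁻¹)| := by rw [mul_sub]; exact le_abs_self _
        _ = |w S| * |N S - B * ∏ p ∈ S, (p : ℝ)⁻¹| := abs_mul _ _
        _ ≤ |w S| * 1 := mul_le_mul_of_nonneg_left (hN S hS) (abs_nonneg _)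
        _ ≤ _ := by rw [mul_one]; exact hw S
    have h2 : ∑ S ∈ P.powerset, (if S.card ≤ 2 * m then (1 : ℝ) else 0) ≤ (z + 1) ^ (2 * m) := by
      rw [← Finset.sum_filter, Finset.sum_const, nsmul_eq_mul, mul_one]
      have h3 := card_powerset_card_le P (2 * m)
      have h4 : P.card ≤ z := by
        have : P ⊆ Finset.Ioc 0 z := fun p hp => by
          have := (hPz p).1 hp
          exact Finset.mem_Ioc.2 ⟨this.1.pos, this.2⟩
        simpa using Finset.card_le_card this
      calc ((P.powerset.filter fun S => S.card ≤ 2 * m).card : ℝ)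
          ≤ ((P.card + 1) ^ (2 * m) : ℕ) := by exact_mod_cast h3
        _ ≤ ((z + 1) ^ (2 * m) : ℕ) := by exact_mod_cast Nat.pow_le_pow_left (by omega) _
        _ = _ := by push_cast; rfl
    rw [Finset.sum_sub_distrib] at h1
    have h5 : ∑ S ∈ P.powerset, w S * (B * ∏ p ∈ S, (p : ℝ)⁻¹) =
        B * ∑ S ∈ P.powerset, w S * ∏ p ∈ S, (p : ℝ)⁻¹ := by
      rw [Finset.mul_sum]
      exact Finset.sum_congr rfl fun S _ => by ring
    linarith
  -- The sum is completed to all S. For |S| > 2m the discrepancy is at most 1 ≤ e^(|S| - 2m), and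
  -- with this weight the sum over all S is an Euler product.
  have hmain : ∑ S ∈ P.powerset, w S * ∏ p ∈ S, (p : ℝ)⁻¹ ≤
      ∏ p ∈ P, (1 - (p : ℝ)⁻¹) +
        Real.exp (-(2 * m)) * ∏ p ∈ P, (1 + Real.exp 1 * (p : ℝ)⁻¹) := by
    have h1 : ∏ p ∈ P, (1 - (p : ℝ)⁻¹) =
        ∑ S ∈ P.powerset, (-1 : ℝ) ^ S.card * ∏ p ∈ S, (p : ℝ)⁻¹ := by
      simp_rw [sub_eq_add_neg]
      rw [Finset.prod_one_add]
      refine Finset.sum_congr rfl fun S _ => ?_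
      rw [Finset.prod_neg]
    rw [h1, Finset.prod_one_add, Finset.mul_sum, ← Finset.sum_add_distrib]
    refine Finset.sum_le_sum fun S _ => ?_
    have hpr : 0 ≤ ∏ p ∈ S, (p : ℝ)⁻¹ := Finset.prod_nonneg fun _ _ => by positivity
    rw [Finset.prod_mul_distrib, Finset.prod_const, ← Real.exp_nat_mul, mul_one, ← mul_assoc,
      ← add_mul, ← Real.exp_add]
    refine mul_le_mul_of_nonneg_right ?_ hpr
    simp only [w]
    split_ifs with h
    · linarith [Real.exp_pos (-(2 * m) + S.card : ℝ)]
    · have h2 : (2 * m : ℝ) ≤ S.card := by exact_mod_cast (not_le.1 h).le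
      have h3 : 1 ≤ Real.exp (-(2 * m) + S.card : ℝ) := Real.one_le_exp (by linarith)
      have h4 : -1 ≤ (-1 : ℝ) ^ S.card := by
        rcases neg_one_pow_eq_or ℝ S.card with h | h <;> linarith
      linarith
  calc _ = _ := hcard
    _ ≤ _ := hstep1
    _ ≤ _ := hstep2
    _ ≤ _ := add_le_add_left (mul_le_mul_of_nonneg_left hmain B.cast_nonneg) _

-- Taking m about 2(1 + log z), and using only that the sum of 1/p over p ≤ z is at most 1 + log z,
-- makes the truncation term at most 1/z, while the remainder is only exp(O(log² z)).
open Classical in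
theorem card_sifted_le' {a z : ℕ} (hz : 2 ≤ z) (ha : ∀ p : ℕ, p.Prime → p ≤ z → ¬ p ∣ a) (c : ℤ)
    (B : ℕ) :
    (((Finset.Ioc B (2 * B)).filter fun b : ℕ =>
      ∀ p : ℕ, p.Prime → p ≤ z → ¬ (p : ℤ) ∣ a * b + c).card : ℝ) ≤
      2 * B / Real.log z + Real.exp ((6 + 4 * Real.log z) * Real.log (z + 1)) := by
  have hz1 : (2 : ℝ) ≤ z := by exact_mod_cast hz
  have hlog : 0 < Real.log z := Real.log_pos (by linarith)
  set m := ⌈2 * (1 + Real.log z)⌉₊ with hm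
  have hm1 : 2 * (1 + Real.log z) ≤ m := Nat.le_ceil _
  have hm2 : (m : ℝ) < 2 * (1 + Real.log z) + 1 := Nat.ceil_lt_add_one (by positivity)
  have h1 := prod_one_sub_inv_le z hz
  have h2 : ∏ p ∈ (Finset.range (z + 1)).filter Nat.Prime, (1 + Real.exp 1 * (p : ℝ)⁻¹) ≤
      Real.exp (3 * (1 + Real.log z)) := by
    calc _ ≤ ∏ p ∈ (Finset.range (z + 1)).filter Nat.Prime, Real.exp (3 * (p : ℝ)⁻¹) := by
          refine Finset.prod_le_prod (fun p _ => by positivity) fun p _ => ?_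
          have h3 : Real.exp 1 ≤ 3 := by linarith [Real.exp_one_lt_d9]
          have h4 : (0 : ℝ) ≤ (p : ℝ)⁻¹ := by positivity
          have := Real.add_one_le_exp (3 * (p : ℝ)⁻¹)
          nlinarith
      _ = Real.exp (3 * ∑ p ∈ (Finset.range (z + 1)).filter Nat.Prime, (p : ℝ)⁻¹) := by
          rw [← Real.exp_sum, Finset.mul_sum]
      _ ≤ _ := by
          gcongr
          have h := harmonic_le_one_add_log z
          rw [harmonic_eq_sum_Icc] at h
          push_cast at h
          refine le_trans (Finset.sum_le_sum_of_subset_of_nonneg ?_ fun _ _ _ => by positivity) h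
          intro p hp
          rw [Finset.mem_filter, Finset.mem_range] at hp
          exact Finset.mem_Icc.2 ⟨hp.2.one_lt.le, by omega⟩
  have h3 : Real.exp (-(2 * m)) *
      ∏ p ∈ (Finset.range (z + 1)).filter Nat.Prime, (1 + Real.exp 1 * (p : ℝ)⁻¹) ≤
      (Real.log z)⁻¹ := by
    calc _ ≤ Real.exp (-(2 * m)) * Real.exp (3 * (1 + Real.log z)) := by gcongr
      _ = Real.exp (-(2 * m) + 3 * (1 + Real.log z)) := (Real.exp_add _ _).symm
      _ ≤ Real.exp (-Real.log z) := by
          apply Real.exp_le_exp.2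
          linarith
      _ = (z : ℝ)⁻¹ := by rw [Real.exp_neg, Real.exp_log (by linarith)]
      _ ≤ _ := inv_anti₀ hlog (by linarith [Real.log_le_sub_one_of_pos (show (0 : ℝ) < z by linarith)])
  have h4 : ((z : ℝ) + 1) ^ (2 * m) ≤ Real.exp ((6 + 4 * Real.log z) * Real.log (z + 1)) := by
    rw [← Real.rpow_natCast, Real.rpow_def_of_pos (by positivity), mul_comm]
    refine Real.exp_le_exp.2 (mul_le_mul_of_nonneg_right ?_ (Real.log_nonneg (by linarith)))
    push_cast
    linarith
  refine (card_sifted_le ha c B m).trans ?_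
  calc _ ≤ B * ((Real.log z)⁻¹ + (Real.log z)⁻¹) +
        Real.exp ((6 + 4 * Real.log z) * Real.log (z + 1)) := by gcongr
    _ = _ := by ring

/-! ### Smooth shifted primes. -/

theorem rpow_neg_one_sub_eq {b : ℕ} (hb : b ≠ 0) (η : ℝ) :
    (b : ℝ) ^ (-(1 - η)) = (b : ℝ)⁻¹ * Real.exp (η * Real.log b) := by
  have hp0 : (0 : ℝ) < b := by exact_mod_cast Nat.pos_of_ne_zero hb
  rw [show -(1 - η) = -1 + η by ring, Real.rpow_add hp0, Real.rpow_neg_one,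
    Real.rpow_def_of_pos hp0 η, mul_comm η]

theorem rpow_neg_one_sub_le_of_log_le {b : ℕ} (hb : b ≠ 0) {η V : ℝ} (hη : 0 ≤ η)
    (hV : Real.log b ≤ V) : (b : ℝ) ^ (-(1 - η)) ≤ (b : ℝ)⁻¹ * Real.exp (η * V) := by
  rw [rpow_neg_one_sub_eq hb]
  gcongr

theorem sum_inv_le_of_log_le (T : Finset ℕ) {W : ℝ} (hW : 0 ≤ W)
    (hT : ∀ b ∈ T, b ≠ 0 ∧ Real.log b ≤ W) : ∑ b ∈ T, (b : ℝ)⁻¹ ≤ 1 + W := by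
  set N := ⌊Real.exp W⌋₊ with hN
  have hN1 : 1 ≤ N := (Nat.one_le_floor_iff _).2 (Real.one_le_exp hW)
  have hsub : T ⊆ Finset.Icc 1 N := by
    intro b hb
    have hb0 : (0 : ℝ) < b := by exact_mod_cast Nat.pos_of_ne_zero (hT b hb).1
    refine Finset.mem_Icc.2 ⟨Nat.pos_of_ne_zero (hT b hb).1, ?_⟩
    exact (Nat.le_floor_iff (Real.exp_pos W).le).2 ((Real.log_le_iff_le_exp hb0).1 (hT b hb).2)
  have h := harmonic_le_one_add_log N
  rw [harmonic_eq_sum_Icc] at h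
  push_cast at h
  calc ∑ b ∈ T, (b : ℝ)⁻¹ ≤ ∑ b ∈ Finset.Icc 1 N, (b : ℝ)⁻¹ :=
        Finset.sum_le_sum_of_subset_of_nonneg hsub fun _ _ _ => by positivity
    _ ≤ 1 + Real.log N := h
    _ ≤ 1 + W := by
      gcongr
      rw [Real.log_le_iff_le_exp (by exact_mod_cast hN1)]
      exact Nat.floor_le (Real.exp_pos W).le

/-- The sum over `b ≤ e ^ V` for which `a b + c` is prime, where `a` has no small prime factor and
`c = ±1`. -/
theorem sum_sifted_le {a z : ℕ} (hz : 2 ≤ z) (ha : ∀ p : ℕ, p.Prime → p ≤ z → ¬ p ∣ a) {c : ℤ}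
    (hc : -1 ≤ c) {V W η : ℝ} (hη : 0 ≤ η) (hW : 0 ≤ W) (hWV : W ≤ V)
    (hzW : (z : ℝ) + 2 ≤ Real.exp W) (T : Finset ℕ)
    (hT : ∀ b ∈ T, b ≠ 0 ∧ Real.log b ≤ V ∧ ∃ p : ℕ, p.Prime ∧ (p : ℤ) = a * b + c) :
    ∑ b ∈ T, (b : ℝ) ^ (-(1 - η)) ≤ Real.exp (η * V) * (1 + W) +
      Real.exp (η * V) * ((2 * V + 1) * (2 / Real.log z +
        2 * Real.exp ((6 + 4 * Real.log z) * Real.log (z + 1) - W))) := by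
  classical
  have ha0 : 1 ≤ a := by
    rcases Nat.eq_zero_or_pos a with rfl | h
    · exact absurd (dvd_zero 2) (ha 2 Nat.prime_two hz)
    · exact h
  have hlz : 0 < Real.log z := Real.log_pos (by exact_mod_cast hz)
  -- Up to e^W the harmonic sum is affordable. Beyond e^W, dyadic blocks are long enough for the
  -- sieve remainder to be negligible.
  rw [← Finset.sum_filter_add_sum_filter_not T (fun b : ℕ => Real.log b ≤ W)]
  refine add_le_add ?_ ?_
  · calc ∑ b ∈ T.filter (fun b : ℕ => Real.log b ≤ W), (b : ℝ) ^ (-(1 - η))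
        ≤ ∑ b ∈ T.filter (fun b : ℕ => Real.log b ≤ W), (b : ℝ)⁻¹ * Real.exp (η * V) := by
          refine Finset.sum_le_sum fun b hb => ?_
          have hb := hT b (Finset.mem_filter.1 hb).1
          exact rpow_neg_one_sub_le_of_log_le hb.1 hη hb.2.1
      _ = Real.exp (η * V) * ∑ b ∈ T.filter (fun b : ℕ => Real.log b ≤ W), (b : ℝ)⁻¹ := by
          rw [← Finset.sum_mul, mul_comm]
      _ ≤ _ := by
          gcongr
          refine sum_inv_le_of_log_le _ hW fun b hb => ?_
          exact ⟨(hT b (Finset.mem_filter.1 hb).1).1, (Finset.mem_filter.1 hb).2⟩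
  set T₂ := T.filter fun b : ℕ => ¬ Real.log b ≤ W with hT₂
  set X := (6 + 4 * Real.log z) * Real.log (z + 1) with hX
  have hlarge : ∀ b ∈ T₂, Real.exp W < b := by
    intro b hb
    have hb0 : (0 : ℝ) < b := by
      exact_mod_cast Nat.pos_of_ne_zero (hT b (Finset.mem_filter.1 hb).1).1
    exact (Real.lt_log_iff_exp_lt hb0).1 (not_le.1 (Finset.mem_filter.1 hb).2)
  have hzb : ∀ b ∈ T₂, z + 2 < b := by
    intro b hb
    exact_mod_cast hzW.trans_lt (hlarge b hb)
  -- The logarithm is taken at b - 1 so that the blocks are (2^i, 2^(i+1)], the half-open form used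
  -- in the sieve.
  have hpow : ∀ b ∈ T₂, 2 ^ Nat.log 2 (b - 1) < b ∧ b ≤ 2 * 2 ^ Nat.log 2 (b - 1) := by
    intro b hb
    have := hzb b hb
    have h1 := Nat.pow_log_le_self 2 (show b - 1 ≠ 0 by omega)
    have h2 := Nat.lt_pow_succ_log_self (b := 2) (by norm_num) (b - 1)
    rw [pow_succ] at h2
    omega
  set J := ⌊2 * V⌋₊ + 1 with hJ
  have hmaps : ∀ b ∈ T₂, Nat.log 2 (b - 1) ∈ Finset.range J := by
    intro b hb
    rw [Finset.mem_range, hJ, Nat.lt_succ_iff, Nat.le_floor_iff (by linarith)]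
    have h1 : ((2 : ℝ) ^ Nat.log 2 (b - 1)) ≤ b := by exact_mod_cast (hpow b hb).1.le
    have h2 := Real.log_le_log (by positivity) h1
    rw [Real.log_pow] at h2
    have h3 := (hT b (Finset.mem_filter.1 hb).1).2.1
    have h4 : 0.6931471803 < Real.log 2 := Real.log_two_gt_d9
    have h5 : (0 : ℝ) ≤ Nat.log 2 (b - 1) := Nat.cast_nonneg _
    nlinarith
  rw [← Finset.sum_fiberwise_of_maps_to hmaps]
  have hblock : ∀ i ∈ Finset.range J,
      ∑ b ∈ T₂ with Nat.log 2 (b - 1) = i, (b : ℝ) ^ (-(1 - η)) ≤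
        Real.exp (η * V) * (2 / Real.log z + 2 * Real.exp (X - W)) := by
    intro i _
    set F := T₂.filter fun b => Nat.log 2 (b - 1) = i with hF
    rcases F.eq_empty_or_nonempty with h0 | ⟨b₀, hb₀⟩
    · rw [h0, Finset.sum_empty]
      positivity
    have hi0 : Real.exp W ≤ 2 * 2 ^ i := by
      have h1 := Finset.mem_filter.1 hb₀
      have h2 : (b₀ : ℝ) ≤ 2 * 2 ^ i := by
        rw [← h1.2]
        exact_mod_cast (hpow b₀ h1.1).2
      exact (hlarge b₀ h1.1).le.trans h2
    have hcard : (F.card : ℝ) ≤ 2 * (2 ^ i : ℕ) / Real.log z + Real.exp X := by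
      refine le_trans ?_ (card_sifted_le' hz ha c (2 ^ i))
      refine Nat.cast_le.2 (Finset.card_le_card fun b hb => ?_)
      have h1 := Finset.mem_filter.1 hb
      have h2 := hpow b h1.1
      rw [h1.2] at h2
      refine Finset.mem_filter.2 ⟨Finset.mem_Ioc.2 h2, fun p hp hpz hpd => ?_⟩
      obtain ⟨q, hq, hqe⟩ := (hT b (Finset.mem_filter.1 h1.1).1).2.2
      -- A prime p ≤ z dividing the prime q = ab + c must equal q, but q ≥ b - 1 > z.
      rw [← hqe, Int.natCast_dvd_natCast, Nat.prime_dvd_prime_iff_eq hp hq] at hpd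
      have h3 := hzb b h1.1
      have h4 : (b : ℤ) ≤ a * b := by
        have : (1 : ℤ) ≤ a := by exact_mod_cast ha0
        nlinarith
      omega
    calc ∑ b ∈ F, (b : ℝ) ^ (-(1 - η)) ≤ ∑ b ∈ F, ((2 : ℝ) ^ i)⁻¹ * Real.exp (η * V) := by
          refine Finset.sum_le_sum fun b hb => ?_
          have h1 := Finset.mem_filter.1 hb
          have h2 := (hpow b h1.1).1
          rw [h1.2] at h2
          have h3 := hT b (Finset.mem_filter.1 h1.1).1
          refine (rpow_neg_one_sub_le_of_log_le h3.1 hη h3.2.1).trans ?_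
          gcongr
          exact_mod_cast h2.le
      _ = F.card * (((2 : ℝ) ^ i)⁻¹ * Real.exp (η * V)) := by
          rw [Finset.sum_const, nsmul_eq_mul]
      _ ≤ (2 * (2 ^ i : ℕ) / Real.log z + Real.exp X) * (((2 : ℝ) ^ i)⁻¹ * Real.exp (η * V)) := by
          gcongr
      _ = Real.exp (η * V) * (2 / Real.log z + Real.exp X * ((2 : ℝ) ^ i)⁻¹) := by
          push_cast
          field_simp
      _ ≤ Real.exp (η * V) * (2 / Real.log z + Real.exp X * (2 * (Real.exp W)⁻¹)) := by
          gcongr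
          rw [inv_le_comm₀ (by positivity) (by positivity), mul_inv, inv_inv]
          linarith
      _ = _ := by rw [Real.exp_sub]; ring
  refine (Finset.sum_le_sum hblock).trans ?_
  rw [Finset.sum_const, Finset.card_range, nsmul_eq_mul]
  have hJle : (J : ℝ) ≤ 2 * V + 1 := by
    rw [hJ]
    push_cast
    gcongr
    exact Nat.floor_le (by linarith)
  calc (J : ℝ) * (Real.exp (η * V) * (2 / Real.log z + 2 * Real.exp (X - W)))
      ≤ (2 * V + 1) * (Real.exp (η * V) * (2 / Real.log z + 2 * Real.exp (X - W))) := by gcongr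
    _ = _ := by ring

/-- All prime factors of `k` have logarithm at most `V`. -/
def LogSmooth (V : ℝ) (k : ℕ) : Prop := ∀ p : ℕ, p.Prime → p ∣ k → Real.log p ≤ V

theorem LogSmooth.of_dvd {V : ℝ} {k l : ℕ} (h : LogSmooth V l) (hkl : k ∣ l) : LogSmooth V k :=
  fun p hp hpk => h p hp (hpk.trans hkl)

theorem sum_rpow_smooth_le {u : ℝ} (hu : Real.log 2 ≤ u) {η : ℝ} (hη1 : η ≤ 1 / 2)
    (T : Finset ℕ) (hT : ∀ b ∈ T, b ≠ 0 ∧ LogSmooth u b) :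
    ∑ b ∈ T, (b : ℝ) ^ (-(1 - η)) ≤
      Real.exp (4 * (5 + 6 * Real.log (u / Real.log 2) + 3 * Real.exp (η * u))) := by
  classical
  -- The prime 2 is adjoined separately because `logPrimes` excludes its lower endpoint.
  have h := sum_rpow_neg_le_exp (σ := 1 - η) (by linarith) (insert 2 (logPrimes (Real.log 2) u))
    (by
      intro p hp
      rcases Finset.mem_insert.1 hp with rfl | hp
      · exact Nat.prime_two
      · exact (mem_logPrimes.1 hp).1) T (by
      intro b hb
      refine ⟨(hT b hb).1, fun p hp hpb => ?_⟩
      have h1 := (hT b hb).2 p hp hpb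
      rcases hp.two_le.eq_or_lt with h2 | h2
      · exact Finset.mem_insert.2 (Or.inl h2.symm)
      · refine Finset.mem_insert_of_mem (mem_logPrimes.2 ⟨hp, ?_, h1⟩)
        exact Real.log_lt_log (by norm_num) (by exact_mod_cast h2))
  refine h.trans (Real.exp_le_exp.2 (mul_le_mul_of_nonneg_left ?_ (by norm_num)))
  have h2 := sum_rpow_logPrimes_le η le_rfl hu
  have h3 : ((2 : ℕ) : ℝ) ^ (-(1 - η)) ≤ 1 := by
    refine (prime_rpow_neg_le le_rfl (by linarith)).trans (by norm_num)
  have h4 : (2 : ℕ) ∉ logPrimes (Real.log 2) u := by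
    intro h
    have := (mem_logPrimes.1 h).2.1
    norm_num at this
  rw [Finset.sum_insert h4]
  exact (add_le_add h3 h2).trans (by linarith)

/-- The contribution of large smooth numbers, by Rankin's method. -/
theorem sum_rpow_smooth_tail_le {u : ℝ} (hu : Real.log 2 ≤ u) {η κ V : ℝ}
    (hκ : 0 ≤ κ) (hη1 : η + κ ≤ 1 / 2)
    (T : Finset ℕ) (hT : ∀ b ∈ T, b ≠ 0 ∧ LogSmooth u b ∧ V < Real.log b) :
    ∑ b ∈ T, (b : ℝ) ^ (-(1 - η)) ≤
      Real.exp (4 * (5 + 6 * Real.log (u / Real.log 2) + 3 * Real.exp ((η + κ) * u)) - κ * V) := by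
  -- The full sum is taken with η + κ in place of η; on the tail the extra weight b^κ is at least
  -- e^(κV).
  have h := sum_rpow_smooth_le hu hη1 T fun b hb => ⟨(hT b hb).1, (hT b hb).2.1⟩
  rw [sub_eq_add_neg _ (κ * V), Real.exp_add]
  refine le_trans ?_ (mul_le_mul_of_nonneg_right h (Real.exp_pos _).le)
  rw [Finset.sum_mul]
  refine Finset.sum_le_sum fun b hb => ?_
  obtain ⟨h0, -, h2⟩ := hT b hb
  rw [rpow_neg_one_sub_eq h0, rpow_neg_one_sub_eq h0, mul_assoc, ← Real.exp_add]
  gcongr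
  nlinarith

theorem exists_rough_mul_smooth (u : ℝ) {k : ℕ} (hk : k ≠ 0) :
    ∃ a b : ℕ, k = a * b ∧ LogSmooth u b ∧ ∀ p : ℕ, p.Prime → p ∣ a → u < Real.log p := by
  induction k using Nat.recOnMul with
  | zero => exact absurd rfl hk
  | one => exact ⟨1, 1, rfl, fun p hp h => absurd (Nat.dvd_one.1 h) hp.ne_one,
      fun p hp h => absurd (Nat.dvd_one.1 h) hp.ne_one⟩
  | prime q hq =>
    rcases le_or_gt (Real.log q) u with h | h
    · refine ⟨1, q, (one_mul q).symm, fun p hp hpq => ?_,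
        fun p hp h => absurd (Nat.dvd_one.1 h) hp.ne_one⟩
      rwa [(Nat.prime_dvd_prime_iff_eq hp hq).1 hpq]
    · refine ⟨q, 1, (mul_one q).symm, fun p hp h => absurd (Nat.dvd_one.1 h) hp.ne_one,
        fun p hp hpq => ?_⟩
      rwa [(Nat.prime_dvd_prime_iff_eq hp hq).1 hpq]
  | mul m n hm hn =>
    obtain ⟨a, b, h1, h2, h3⟩ := hm (left_ne_zero_of_mul hk)
    obtain ⟨a', b', h1', h2', h3'⟩ := hn (right_ne_zero_of_mul hk)
    refine ⟨a * a', b * b', by rw [h1, h1']; ring, fun p hp h => ?_, fun p hp h => ?_⟩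
    · exact (hp.dvd_mul.1 h).elim (h2 p hp) (h2' p hp)
    · exact (hp.dvd_mul.1 h).elim (h3 p hp) (h3' p hp)

/-- The sum over smooth shifted primes with explicit parameters. -/
theorem sum_smooth_shifted_prime_le {u V W η κ : ℝ} {z : ℕ} {c : ℤ} (hc : -1 ≤ c)
    (hz : 2 ≤ z) (hzu : Real.log z ≤ u) (hu2 : Real.log 2 ≤ u) (huV : u ≤ V)
    (hW : 0 ≤ W) (hWV : W ≤ V) (hzW : (z : ℝ) + 2 ≤ Real.exp W) (hη : 0 ≤ η)
    (hκ : 0 ≤ κ) (hηκ : η + κ ≤ 1 / 2) (T : Finset ℕ)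
    (hT : ∀ k ∈ T, k ≠ 0 ∧ LogSmooth V k ∧ ∃ p : ℕ, p.Prime ∧ (p : ℤ) = k + c) :
    ∑ k ∈ T, (k : ℝ) ^ (-(1 - η)) ≤
      Real.exp (4 * (4 + 6 * Real.log (V / u) + 3 * Real.exp (η * V))) *
      (Real.exp (η * V) * (1 + W) +
      Real.exp (η * V) * ((2 * V + 1) * (2 / Real.log z +
        2 * Real.exp ((6 + 4 * Real.log z) * Real.log (z + 1) - W))) +
      Real.exp (4 * (5 + 6 * Real.log (u / Real.log 2) + 3 * Real.exp ((η + κ) * u)) - κ * V)) := by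
  classical
  choose! A B hAB using fun (k : ℕ) (hk : k ≠ 0) => exists_rough_mul_smooth u hk
  set S := _ + Real.exp (4 * (5 + 6 * Real.log (u / Real.log 2) +
    3 * Real.exp ((η + κ) * u)) - κ * V) with hS
  have hA0 : ∀ k ∈ T, A k ≠ 0 ∧ B k ≠ 0 := by
    intro k hk
    have h := (hAB k (hT k hk).1).1
    have h0 := (hT k hk).1
    rw [h] at h0
    exact ⟨left_ne_zero_of_mul h0, right_ne_zero_of_mul h0⟩
  -- For a fixed rough part a, no prime up to z divides a since log z ≤ u, so the form ab + c can be
  -- sieved over b ≤ e^V. Larger smooth parts fall under the Rankin tail.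
  have hinner : ∀ a ∈ T.image A, ∑ k ∈ T with A k = a, (B k : ℝ) ^ (-(1 - η)) ≤ S := by
    intro a ha
    obtain ⟨k₀, hk₀, rfl⟩ := Finset.mem_image.1 ha
    have hrough : ∀ p : ℕ, p.Prime → p ≤ z → ¬ p ∣ A k₀ := by
      intro p hp hpz hpa
      have h1 := (hAB k₀ (hT k₀ hk₀).1).2.2 p hp hpa
      have h2 : Real.log p ≤ Real.log z :=
        Real.log_le_log (by exact_mod_cast hp.pos) (by exact_mod_cast hpz)
      linarith
    have hinj : Set.InjOn B (T.filter fun k => A k = A k₀) := by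
      intro k hk l hl hkl
      rw [Finset.mem_coe, Finset.mem_filter] at hk hl
      rw [(hAB k (hT k hk.1).1).1, (hAB l (hT l hl.1).1).1, hk.2, hl.2, hkl]
    rw [← Finset.sum_image (f := fun b : ℕ => (b : ℝ) ^ (-(1 - η))) hinj]
    set TB := (T.filter fun k => A k = A k₀).image B with hTB
    have hTB' : ∀ b ∈ TB, b ≠ 0 ∧ LogSmooth u b ∧
        ∃ p : ℕ, p.Prime ∧ (p : ℤ) = A k₀ * b + c := by
      intro b hb
      obtain ⟨k, hk, rfl⟩ := Finset.mem_image.1 hb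
      obtain ⟨hk, hkA⟩ := Finset.mem_filter.1 hk
      obtain ⟨p, hp, hpk⟩ := (hT k hk).2.2
      refine ⟨(hA0 k hk).2, (hAB k (hT k hk).1).2.1, p, hp, ?_⟩
      rw [hpk, ← hkA]
      conv_lhs => rw [(hAB k (hT k hk).1).1]
      push_cast
      ring
    rw [← Finset.sum_filter_add_sum_filter_not TB (fun b : ℕ => Real.log b ≤ V), hS]
    refine add_le_add ?_ ?_
    · refine sum_sifted_le hz hrough hc hη hW hWV hzW _ fun b hb => ?_
      obtain ⟨h1, h2⟩ := Finset.mem_filter.1 hb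
      exact ⟨(hTB' b h1).1, h2, (hTB' b h1).2.2⟩
    · refine sum_rpow_smooth_tail_le hu2 hκ hηκ _ fun b hb => ?_
      obtain ⟨h1, h2⟩ := Finset.mem_filter.1 hb
      exact ⟨(hTB' b h1).1, (hTB' b h1).2.1, not_le.1 h2⟩
  have hS0 : 0 ≤ S := by
    have : 0 < Real.log z := Real.log_pos (by exact_mod_cast hz)
    have : 0 ≤ V := hW.trans hWV
    rw [hS]
    positivity
  have hAsum : ∑ a ∈ T.image A, (a : ℝ) ^ (-(1 - η)) ≤
      Real.exp (4 * (4 + 6 * Real.log (V / u) + 3 * Real.exp (η * V))) := by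
    refine (sum_rpow_neg_le_exp (σ := 1 - η) (by linarith) (logPrimes u V)
      (fun p hp => (mem_logPrimes.1 hp).1) _ ?_).trans ?_
    · intro a ha
      obtain ⟨k, hk, rfl⟩ := Finset.mem_image.1 ha
      refine ⟨(hA0 k hk).1, fun p hp hpa => mem_logPrimes.2 ⟨hp, ?_, ?_⟩⟩
      · exact (hAB k (hT k hk).1).2.2 p hp hpa
      · refine (hT k hk).2.1 p hp (hpa.trans ?_)
        conv_rhs => rw [(hAB k (hT k hk).1).1]
        exact dvd_mul_right _ _
    · gcongr
      exact sum_rpow_logPrimes_le η hu2 huV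
  calc ∑ k ∈ T, (k : ℝ) ^ (-(1 - η))
      = ∑ k ∈ T, (A k : ℝ) ^ (-(1 - η)) * (B k : ℝ) ^ (-(1 - η)) := by
        refine Finset.sum_congr rfl fun k hk => ?_
        conv_lhs => rw [(hAB k (hT k hk).1).1]
        rw [Nat.cast_mul, Real.mul_rpow (by positivity) (by positivity)]
    _ = ∑ a ∈ T.image A, ∑ k ∈ T with A k = a,
          (A k : ℝ) ^ (-(1 - η)) * (B k : ℝ) ^ (-(1 - η)) :=
        (Finset.sum_fiberwise_of_maps_to (fun k hk => Finset.mem_image_of_mem A hk) _).symm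
    _ = ∑ a ∈ T.image A, (a : ℝ) ^ (-(1 - η)) *
          ∑ k ∈ T with A k = a, (B k : ℝ) ^ (-(1 - η)) := by
        refine Finset.sum_congr rfl fun a _ => ?_
        rw [Finset.mul_sum]
        refine Finset.sum_congr rfl fun k hk => ?_
        rw [(Finset.mem_filter.1 hk).2]
    _ ≤ ∑ a ∈ T.image A, (a : ℝ) ^ (-(1 - η)) * S :=
        Finset.sum_le_sum fun a ha => mul_le_mul_of_nonneg_left (hinner a ha) (by positivity)
    _ = (∑ a ∈ T.image A, (a : ℝ) ^ (-(1 - η))) * S := by rw [Finset.sum_mul]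
    _ ≤ _ := mul_le_mul_of_nonneg_right hAsum hS0

/-- With l = log V, the left side bounds the exponent of the rough-part factor. It is o(l) because
19/20 < 1, so that factor is at most V^(1/16). -/
theorem eventually_log_combination_le :
    ∀ᶠ l : ℝ in atTop, 16 + 48 * Real.log l + 12 * l ^ (19 / 20 : ℝ) ≤ l / 16 := by
  have h1 : (fun l : ℝ => 48 * Real.log l) =o[atTop] (fun l => l) :=
    Real.isLittleO_log_id_atTop.const_mul_left 48
  have h2 : (fun l : ℝ => 12 * l ^ (19 / 20 : ℝ)) =o[atTop] (fun l : ℝ => l) := by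
    refine IsLittleO.const_mul_left ?_ 12
    rw [isLittleO_iff_tendsto' (by filter_upwards [eventually_ne_atTop 0] with l h h'; exact absurd h' h)]
    refine (tendsto_rpow_neg_atTop (show (0 : ℝ) < 1 / 20 by norm_num)).congr' ?_
    filter_upwards [eventually_gt_atTop 0] with l hl
    rw [show -(1 / 20 : ℝ) = 19 / 20 - 1 by norm_num, Real.rpow_sub hl, Real.rpow_one]
  have h3 : (fun _ : ℝ => (16 : ℝ)) =o[atTop] (fun l : ℝ => l) := isLittleO_const_id_atTop 16
  filter_upwards [((h3.add h1).add h2).bound (show (0 : ℝ) < 1 / 16 by norm_num),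
    eventually_ge_atTop 0] with l hl hl0
  rw [Real.norm_eq_abs, Real.norm_of_nonneg hl0] at hl
  linarith [le_abs_self (16 + 48 * Real.log l + 12 * l ^ (19 / 20 : ℝ))]

set_option maxHeartbeats 1000000 in
/-- The sum of `p ^ (-(1 - η))` over primes `p` for which `p + ε` is `e ^ V`-smooth is at most a
power of `V` with exponent less than `1`, provided that `η` is small. -/
theorem eventually_sum_smooth_shifted_prime_le {ε : ℤ} (hε1 : -1 ≤ ε) (hε2 : ε ≤ 1) :
    ∀ᶠ V : ℝ in atTop, ∀ η : ℝ, 0 ≤ η → Real.exp (η * V) ≤ Real.log V ^ (19 / 20 : ℝ) →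
      ∀ T : Finset ℕ, (∀ p ∈ T, p.Prime ∧ LogSmooth V ((p : ℤ) + ε).toNat) →
        ∑ p ∈ T, (p : ℝ) ^ (-(1 - η)) ≤ V ^ (7 / 8 : ℝ) := by
  have hlog := Real.tendsto_log_atTop
  have F1 := hlog.eventually eventually_log_combination_le
  have F2 := hlog.eventually (eventually_ge_atTop (61 : ℝ))
  have F3 : ∀ᶠ V : ℝ in atTop, Real.log V ^ 2 ≤ V / 4 := by
    filter_upwards [(Real.isLittleO_pow_log_id_atTop (n := 2)).bound
      (show (0 : ℝ) < 1 / 4 by norm_num), eventually_ge_atTop 0] with V h1 h2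
    rw [id_eq, Real.norm_of_nonneg h2, Real.norm_of_nonneg (sq_nonneg _)] at h1
    linarith
  have F5 : ∀ᶠ V : ℝ in atTop, 42 * Real.log V ≤ V ^ (1 / 16 : ℝ) := by
    filter_upwards [(isLittleO_log_rpow_atTop (show (0 : ℝ) < 1 / 16 by norm_num)).bound
      (show (0 : ℝ) < 1 / 42 by norm_num), eventually_ge_atTop 1] with V h1 h2
    rw [Real.norm_of_nonneg (Real.log_nonneg h2), Real.norm_of_nonneg (by positivity)] at h1
    linarith
  filter_upwards [F1, F2, F3, F5, eventually_ge_atTop (20 ^ 4 : ℝ)] with V f1 f2 f3 f5 f6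
  intro η hη hE T hT
  have hV0 : 0 < V := by linarith
  set l := Real.log V with hl
  -- The sieve limit is z about e^v and the threshold is W = v³. Below W the harmonic sum costs v³;
  -- above it the sieve gives about V/v = v³, and its remainder exp(O(v²)) is dwarfed by e^(v³). As
  -- v³ = V^(3/4), there is room V^(1/8) for the rough part and the logarithms.
  set v := V ^ (1 / 4 : ℝ) with hv
  have hv4 : v ^ 4 = V := by
    rw [hv, ← Real.rpow_natCast, ← Real.rpow_mul hV0.le]; norm_num
  have hv0 : 0 < v := by positivity
  have hv10 : 20 ≤ v := by
    by_contra h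
    have : v ^ 4 < 20 ^ 4 := pow_lt_pow_left₀ (not_le.1 h) hv0.le (by norm_num)
    linarith
  have hv2 : 20 * v ≤ v ^ 2 := by
    rw [pow_two]; exact mul_le_mul_of_nonneg_right hv10 hv0.le
  have hv3 : 20 * v ^ 2 ≤ v ^ 3 := by
    rw [pow_succ' v 2]; exact mul_le_mul_of_nonneg_right hv10 (sq_nonneg v)
  have hl61 : 61 * l ≤ l ^ 2 := by
    rw [pow_two]; exact mul_le_mul_of_nonneg_right f2 (by linarith)
  have hlv : l ≤ 4 * v := by
    rw [hl, ← hv4, Real.log_pow]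
    have := Real.log_le_sub_one_of_pos hv0
    push_cast
    linarith
  set E := Real.exp (η * V) with hEdef
  have hE0 : 0 < E := Real.exp_pos _
  have hl95 : l ^ (19 / 20 : ℝ) ≤ l := by
    conv_rhs => rw [← Real.rpow_one l]
    exact Real.rpow_le_rpow_of_exponent_le (by linarith) (by norm_num)
  have hEl : E ≤ l := hE.trans hl95
  set z := ⌊Real.exp v⌋₊ with hz
  have hev : 11 ≤ Real.exp v := by linarith [Real.add_one_le_exp v]
  have hz1 : (z : ℝ) ≤ Real.exp v := Nat.floor_le (Real.exp_pos v).le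
  have hz2 : Real.exp v - 1 < z := Nat.sub_one_lt_floor _
  have hz10 : (10 : ℝ) < z := by linarith
  have hzlog1 : Real.log z ≤ v := by
    rwa [Real.log_le_iff_le_exp (by linarith)]
  have hzlog2 : v / 2 ≤ Real.log z := by
    rw [Real.le_log_iff_exp_le (by linarith)]
    have h1 : Real.exp v = Real.exp (v / 2) * Real.exp (v / 2) := by
      rw [← Real.exp_add]; ring_nf
    have h2 : 6 ≤ Real.exp (v / 2) := by linarith [Real.add_one_le_exp (v / 2)]
    have h3 := mul_le_mul_of_nonneg_right h2 (Real.exp_pos (v / 2)).le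
    linarith
  have hzlog3 : Real.log (z + 1) ≤ v + 1 := by
    rw [Real.log_le_iff_le_exp (by linarith), Real.exp_add]
    have : 2 ≤ Real.exp 1 := by linarith [Real.add_one_le_exp 1]
    have := mul_le_mul_of_nonneg_left this (Real.exp_pos v).le
    linarith
  have hW : (z : ℝ) + 2 ≤ Real.exp (v ^ 3) := by
    have h1 : Real.exp (v + 1) ≤ Real.exp (v ^ 3) := by
      apply Real.exp_le_exp.2
      linarith
    have : 2 ≤ Real.exp 1 := by linarith [Real.add_one_le_exp 1]
    have := mul_le_mul_of_nonneg_left this (Real.exp_pos v).le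
    rw [Real.exp_add] at h1
    linarith
  have hl2 : 0 < l ^ 2 := by positivity
  have hln2 : 0.6931471803 < Real.log 2 := Real.log_two_gt_d9
  have hln2' : Real.log 2 < 0.6931471808 := Real.log_two_lt_d9
  have hVl : 4 ≤ V / l ^ 2 := by rw [le_div_iff₀ hl2]; linarith
  have hl2big : 61 ^ 2 ≤ l ^ 2 := pow_le_pow_left₀ (by norm_num) f2 2
  have huV : V / l ^ 2 ≤ V := div_le_self hV0.le (by linarith)
  have hul : V / l ^ 2 ≤ V * Real.log 2 := by
    rw [div_le_iff₀ hl2, mul_assoc]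
    have h1 := mul_le_mul hln2.le hl2big (by norm_num) (by linarith)
    have h2 : 1 ≤ Real.log 2 * l ^ 2 := le_trans (by norm_num) h1
    exact le_mul_of_one_le_right hV0.le h2
  have hηl : η * V ≤ l := by linarith [Real.add_one_le_exp (η * V)]
  have hηκ : η + l ^ 2 / V ≤ 1 / 2 := by
    have h1 : η ≤ l / V := (le_div_iff₀ hV0).2 hηl
    have h2 : l / V + l ^ 2 / V ≤ 1 / 2 := by
      rw [← add_div, div_le_iff₀ hV0]
      linarith
    linarith
  have hzu : Real.log z ≤ V / l ^ 2 := by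
    refine hzlog1.trans ?_
    rw [le_div_iff₀ hl2, ← hv4]
    have h16 : l ^ 2 ≤ 16 * v ^ 2 := by
      calc l ^ 2 ≤ (4 * v) ^ 2 := pow_le_pow_left₀ (by linarith) hlv 2
        _ = 16 * v ^ 2 := by ring
    calc v * l ^ 2 ≤ v * (16 * v ^ 2) := by gcongr
      _ = 16 * v ^ 3 := by ring
      _ ≤ v * v ^ 3 := by gcongr; linarith
      _ = v ^ 4 := by ring
  have hc : -1 ≤ -ε := by linarith
  -- With u = V/l² and κ = l²/V one has log(V/u) = 2 log l, κu = 1 and κV = l². The rough part stays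
  -- cheap, while the smooth tail gains e^(-l²).
  have hmain := sum_smooth_shifted_prime_le (u := V / l ^ 2) (V := V) (W := v ^ 3) (η := η)
    (κ := l ^ 2 / V) (z := z) hc (by exact_mod_cast (show (2 : ℝ) ≤ z by linarith)) hzu
    (by linarith) huV (by positivity) (by rw [← hv4]; exact pow_le_pow_right₀ (by linarith) (by norm_num)) hW hη
    (by positivity) hηκ (T.image fun p : ℕ => ((p : ℤ) + ε).toNat) (by
      intro k hk
      obtain ⟨p, hp, rfl⟩ := Finset.mem_image.1 hk
      have h2 := (hT p hp).1.two_le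
      refine ⟨by omega, (hT p hp).2, p, (hT p hp).1, ?_⟩
      rw [Int.toNat_of_nonneg (by omega)]
      ring)
  have hinj : Set.InjOn (fun p : ℕ => ((p : ℤ) + ε).toNat) T := by
    intro p hp q hq hpq
    have h1 := (hT p hp).1.two_le
    have h2 := (hT q hq).1.two_le
    simp only at hpq
    omega
  rw [Finset.sum_image hinj] at hmain
  -- Passing from p to k = p + ε ≤ 2p costs a factor of at most 2.
  have hcomp : ∑ p ∈ T, (p : ℝ) ^ (-(1 - η)) ≤
      2 * ∑ p ∈ T, ((((p : ℤ) + ε).toNat : ℕ) : ℝ) ^ (-(1 - η)) := by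
    rw [Finset.mul_sum]
    refine Finset.sum_le_sum fun p hp => ?_
    have h2 := (hT p hp).1.two_le
    set k := ((p : ℤ) + ε).toNat with hk
    have hk1 : 1 ≤ k := by omega
    have hk2 : k ≤ 2 * p := by omega
    have hk0 : (0 : ℝ) < k := by exact_mod_cast hk1
    have hη1 : η ≤ 1 / 2 := by
      have : 0 ≤ l ^ 2 / V := by positivity
      linarith
    calc (p : ℝ) ^ (-(1 - η)) ≤ ((k : ℝ) / 2) ^ (-(1 - η)) := by
          apply Real.rpow_le_rpow_of_nonpos (by positivity) _ (by linarith)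
          have : (k : ℝ) ≤ 2 * p := by exact_mod_cast hk2
          linarith
      _ = 2 ^ (1 - η) * (k : ℝ) ^ (-(1 - η)) := by
          rw [Real.div_rpow hk0.le (by norm_num), Real.rpow_neg (by norm_num : (0 : ℝ) ≤ 2),
            div_inv_eq_mul, mul_comm]
      _ ≤ 2 * (k : ℝ) ^ (-(1 - η)) := by
          gcongr
          calc (2 : ℝ) ^ (1 - η) ≤ 2 ^ (1 : ℝ) :=
                Real.rpow_le_rpow_of_exponent_le (by norm_num) (by linarith)
            _ = 2 := Real.rpow_one 2
  have hA : Real.exp (4 * (4 + 6 * Real.log (V / (V / l ^ 2)) + 3 * E)) ≤ V ^ (1 / 16 : ℝ) := by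
    rw [Real.rpow_def_of_pos hV0, div_div_cancel₀ hV0.ne', Real.log_pow]
    apply Real.exp_le_exp.2
    push_cast
    linarith
  have hB2 : 2 / Real.log z ≤ 4 / v := by
    rw [div_le_div_iff₀ (by linarith) hv0]
    linarith
  have hB3 : Real.exp ((6 + 4 * Real.log z) * Real.log (z + 1) - v ^ 3) ≤ 1 / v := by
    have h1 : (6 + 4 * Real.log z) * Real.log (z + 1) ≤ (6 + 4 * v) * (v + 1) := by
      have : 0 ≤ Real.log (z + 1) := Real.log_nonneg (by linarith)
      gcongr
    calc _ ≤ Real.exp (-Real.log v) := by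
          apply Real.exp_le_exp.2
          have := Real.log_le_sub_one_of_pos hv0
          linarith
      _ = 1 / v := by rw [Real.exp_neg, Real.exp_log hv0, one_div]
  have hC : Real.exp (4 * (5 + 6 * Real.log (V / l ^ 2 / Real.log 2) +
      3 * Real.exp ((η + l ^ 2 / V) * (V / l ^ 2))) - l ^ 2 / V * V) ≤ 1 := by
    rw [← Real.exp_zero]
    apply Real.exp_le_exp.2
    have h1 : Real.log (V / l ^ 2 / Real.log 2) ≤ l := by
      apply Real.log_le_log (by positivity)
      rw [div_le_iff₀ (by linarith)]
      exact hul
    have h2 : Real.exp ((η + l ^ 2 / V) * (V / l ^ 2)) ≤ 3 * E := by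
      have h3 : (η + l ^ 2 / V) * (V / l ^ 2) = η * (V / l ^ 2) + 1 := by field_simp
      rw [h3, Real.exp_add, mul_comm]
      have h4 : Real.exp 1 ≤ 3 := by linarith [Real.exp_one_lt_d9]
      have h5 : Real.exp (η * (V / l ^ 2)) ≤ E := Real.exp_le_exp.2 (by gcongr)
      gcongr
    rw [div_mul_cancel₀ _ hV0.ne']
    linarith
  have hinner : E * (1 + v ^ 3) + E * ((2 * V + 1) * (2 / Real.log z +
      2 * Real.exp ((6 + 4 * Real.log z) * Real.log (z + 1) - v ^ 3))) +
      Real.exp (4 * (5 + 6 * Real.log (V / l ^ 2 / Real.log 2) +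
      3 * Real.exp ((η + l ^ 2 / V) * (V / l ^ 2))) - l ^ 2 / V * V) ≤ l * (21 * v ^ 3) := by
    have h1 : 2 / Real.log z +
        2 * Real.exp ((6 + 4 * Real.log z) * Real.log (z + 1) - v ^ 3) ≤ 6 / v := by
      calc _ ≤ 4 / v + 2 * (1 / v) := by gcongr
        _ = 6 / v := by ring
    have h2 : (2 * V + 1) * (2 / Real.log z +
        2 * Real.exp ((6 + 4 * Real.log z) * Real.log (z + 1) - v ^ 3)) ≤ 18 * v ^ 3 := by
      calc _ ≤ (3 * V) * (6 / v) := by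
            gcongr
            linarith
        _ = 18 * v ^ 3 := by rw [← hv4]; field_simp; ring
    have hv3 : 1 ≤ v ^ 3 := one_le_pow₀ (by linarith)
    calc _ ≤ l * (1 + v ^ 3) + l * (18 * v ^ 3) + 1 := by gcongr
      _ ≤ l * (21 * v ^ 3) := by
          have := le_mul_of_one_le_right (show 0 ≤ l by linarith) hv3
          linarith
  have hfin : 2 * (V ^ (1 / 16 : ℝ) * (l * (21 * v ^ 3))) ≤ V ^ (7 / 8 : ℝ) := by
    have h1 : V ^ (7 / 8 : ℝ) = V ^ (1 / 16 : ℝ) * V ^ (1 / 16 : ℝ) * v ^ 3 := by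
      rw [hv, ← Real.rpow_natCast, ← Real.rpow_mul hV0.le, ← Real.rpow_add hV0,
        ← Real.rpow_add hV0]
      norm_num
    rw [h1]
    have : 0 < V ^ (1 / 16 : ℝ) := by positivity
    have h3 : 0 < V ^ (1 / 16 : ℝ) * v ^ 3 := by positivity
    have h4 := mul_le_mul_of_nonneg_right f5 h3.le
    linarith
  refine hcomp.trans (le_trans ?_ hfin)
  gcongr
  refine hmain.trans ?_
  gcongr

/-! ### A common framework for φ and σ. -/

/-- Multiplicative functions with `f p = p + ε` at primes and `f (p ^ e) ≤ 2 p ^ e`, such as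
Euler's function (`ε = -1`) and the sum of divisors (`ε = 1`). -/
structure TotientLike (f : ℕ → ℕ) (ε : ℤ) : Prop where
  neg_one_le : -1 ≤ ε
  le_one : ε ≤ 1
  map_one : f 1 = 1
  map_mul : ∀ m n : ℕ, m.Coprime n → f (m * n) = f m * f n
  map_prime : ∀ p : ℕ, p.Prime → (f p : ℤ) = p + ε
  pos : ∀ n : ℕ, n ≠ 0 → 0 < f n
  map_prime_pow_le : ∀ p e : ℕ, p.Prime → f (p ^ e) ≤ 2 * p ^ e

theorem totientLike_totient : TotientLike Nat.totient (-1) where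
  neg_one_le := le_rfl
  le_one := by norm_num
  map_one := Nat.totient_one
  map_mul _ _ h := Nat.totient_mul h
  map_prime p hp := by
    rw [Nat.totient_prime hp, Nat.cast_sub hp.one_le]
    rfl
  pos n hn := Nat.totient_pos.2 (Nat.pos_of_ne_zero hn)
  map_prime_pow_le p e _ := (Nat.totient_le _).trans (by omega)

theorem totientLike_sigma : TotientLike (fun n => ArithmeticFunction.sigma 1 n) 1 where
  neg_one_le := by norm_num
  le_one := le_rfl
  map_one := by simp
  map_mul _ _ h := ArithmeticFunction.isMultiplicative_sigma.map_mul_of_coprime h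
  map_prime p hp := by
    have := ArithmeticFunction.sigma_one_apply_prime_pow (i := 1) hp
    rw [pow_one] at this
    rw [this]
    simp [Finset.sum_range_succ]
    ring
  pos n hn := ArithmeticFunction.sigma_pos 1 n hn
  map_prime_pow_le p e hp := by
    simp only [ArithmeticFunction.sigma_one_apply_prime_pow hp]
    induction e with
    | zero => simp
    | succ e ih =>
      rw [Finset.sum_range_succ, pow_succ]
      have := Nat.mul_le_mul_left (p ^ e) hp.two_le
      omega

/-- By multiplicativity `f A` is a product over the exact prime powers of `A`, and a prime divides
one of the factors. -/
theorem TotientLike.exists_prime_pow {f : ℕ → ℕ} {ε : ℤ} (hf : TotientLike f ε) {r : ℕ}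
    (hr : r.Prime) {A : ℕ} (hA : A ≠ 0) (hrA : r ∣ f A) :
    ∃ p e m : ℕ, p.Prime ∧ 1 ≤ e ∧ A = p ^ e * m ∧ ¬ p ∣ m ∧ r ∣ f (p ^ e) := by
  induction A using Nat.recOnPosPrimePosCoprime with
  | zero => exact absurd rfl hA
  | one =>
    rw [hf.map_one] at hrA
    exact absurd (Nat.dvd_one.1 hrA) hr.ne_one
  | prime_pow p n hp hn =>
    exact ⟨p, n, 1, hp, hn, (mul_one _).symm, fun h => hp.ne_one (Nat.dvd_one.1 h), hrA⟩
  | coprime a b ha hb hab iha ihb =>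
    rw [hf.map_mul a b hab] at hrA
    rcases hr.dvd_mul.1 hrA with h | h
    · obtain ⟨p, e, m, hp, he, hm, hpm, hrp⟩ := iha (by omega) h
      refine ⟨p, e, m * b, hp, he, by rw [hm]; ring, fun hd => ?_, hrp⟩
      refine (hp.dvd_mul.1 hd).elim hpm fun hpb => ?_
      have hpa : p ∣ a := hm ▸ Dvd.dvd.mul_right (dvd_pow_self p (by omega)) m
      exact hp.not_dvd_one (hab ▸ Nat.dvd_gcd hpa hpb)
    · obtain ⟨p, e, m, hp, he, hm, hpm, hrp⟩ := ihb (by omega) h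
      refine ⟨p, e, a * m, hp, he, by rw [hm]; ring, fun hd => ?_, hrp⟩
      refine (hp.dvd_mul.1 hd).elim (fun hpa => ?_) hpm
      have hpb : p ∣ b := hm ▸ Dvd.dvd.mul_right (dvd_pow_self p (by omega)) m
      exact hp.not_dvd_one (hab ▸ Nat.dvd_gcd hpa hpb)

theorem TotientLike.map_prime_toNat {f : ℕ → ℕ} {ε : ℤ} (hf : TotientLike f ε) {p : ℕ}
    (hp : p.Prime) : f p = ((p : ℤ) + ε).toNat := by
  have := hf.map_prime p hp
  omega

theorem TotientLike.dvd_of_eq_mul {f : ℕ → ℕ} {ε : ℤ} (hf : TotientLike f ε) {p e m A : ℕ}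
    (hp : p.Prime) (hA : A = p ^ e * m) (hpm : ¬ p ∣ m) : f A = f (p ^ e) * f m := by
  rw [hA, hf.map_mul _ _ (Nat.Coprime.pow_left e ((Nat.Prime.coprime_iff_not_dvd hp).2 hpm))]

/-- The sum of `m ^ (-(1 - η))` over integers `m` with smooth `f m`, in terms of the sum over
primes. -/
theorem TotientLike.sum_smooth_le {f : ℕ → ℕ} {ε : ℤ} (hf : TotientLike f ε) {V η S : ℝ}
    (hη : η ≤ 1 / 10)
    (hS : ∀ T : Finset ℕ, (∀ p ∈ T, p.Prime ∧ LogSmooth V ((p : ℤ) + ε).toNat) →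
        ∑ p ∈ T, (p : ℝ) ^ (-(1 - η)) ≤ S)
    (T : Finset ℕ) (hT : ∀ m ∈ T, m ≠ 0 ∧ LogSmooth V (f m)) :
    ∑ m ∈ T, (m : ℝ) ^ (-(1 - η)) ≤
      Real.exp (S + 4 * ∑' n : ℕ, (n : ℝ) ^ (-(7 / 6) : ℝ)) := by
  classical
  -- Smoothness of `f m` is exploited only at primes dividing m exactly once, where p + ε divides `f
  -- m`. Higher powers are left unrestricted: their local contributions are O(p^(-2(1-η))), which
  -- converges.
  let Q : ℕ → Prop := fun m => ∀ p : ℕ, p.Prime → p ∣ m → ¬ p ^ 2 ∣ m →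
    LogSmooth V ((p : ℤ) + ε).toNat
  let g : ℕ → ℝ := fun m => if Q m then (m : ℝ) ^ (-(1 - η)) else 0
  have hg0 : ∀ m, 0 ≤ g m := fun m => by
    simp only [g]; split_ifs <;> positivity
  have hgle : ∀ m : ℕ, g m ≤ (m : ℝ) ^ (-(1 - η)) := fun m => by
    simp only [g]; split_ifs
    · exact le_rfl
    · positivity
  let t : ℕ → ℝ := fun p => (p : ℝ) ^ (-(1 - η))
  have ht0 : ∀ p, 0 ≤ t p := fun p => by positivity
  let h : ℕ → ℝ := fun p =>
    Real.exp ((if LogSmooth V ((p : ℤ) + ε).toNat then t p else 0) + 4 * t p ^ 2)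
  have hTQ : ∀ m ∈ T, Q m := by
    intro m hm p hp hpm hpm2
    obtain ⟨k, hk⟩ := hpm
    have hpk : ¬ p ∣ k := fun h => hpm2 (by rw [hk, pow_two]; exact Nat.mul_dvd_mul_left p h)
    have h1 := hf.dvd_of_eq_mul (e := 1) hp (by simpa using hk) hpk
    rw [pow_one, hf.map_prime_toNat hp] at h1
    exact (hT m hm).2.of_dvd (by rw [h1]; exact dvd_mul_right _ _)
  set P := T.biUnion Nat.primeFactors with hP
  have hPp : ∀ p ∈ P, p.Prime := by
    intro p hp
    obtain ⟨m, -, hm⟩ := Finset.mem_biUnion.1 hp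
    exact Nat.prime_of_mem_primeFactors hm
  have hsum : ∑ m ∈ T, (m : ℝ) ^ (-(1 - η)) = ∑ m ∈ T, g m :=
    Finset.sum_congr rfl fun m hm => by simp only [g, if_pos (hTQ m hm)]
  have hprod : ∑ m ∈ T, g m ≤ ∏ p ∈ P, h p := by
    refine sum_le_prod_of_multiplicative hg0 (by simpa using hgle 1) ?_ P hPp ?_ T ?_
    · intro p e m hp hpm
      have hcop : (p ^ e).Coprime m :=
        Nat.Coprime.pow_left e ((Nat.Prime.coprime_iff_not_dvd hp).2 hpm)
      by_cases hQ : Q (p ^ e * m)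
      · have h1 : Q (p ^ e) := fun q hq hqd hqd2 =>
          hQ q hq (hqd.mul_right _) fun hd => hqd2 (by
            refine Nat.Coprime.dvd_of_dvd_mul_right ?_ hd
            exact Nat.Coprime.pow_left 2 (hcop.coprime_dvd_left hqd))
        have h2 : Q m := fun q hq hqd hqd2 =>
          hQ q hq (hqd.mul_left _) fun hd => hqd2 (by
            refine Nat.Coprime.dvd_of_dvd_mul_left ?_ hd
            exact Nat.Coprime.pow_left 2 (hcop.symm.coprime_dvd_left hqd))
        simp only [g, if_pos hQ, if_pos h1, if_pos h2]
        rw [Nat.cast_mul, Real.mul_rpow (by positivity) (by positivity)]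
      · have : g (p ^ e * m) = 0 := by simp only [g, if_neg hQ]
        rw [this]
        exact mul_nonneg (hg0 _) (hg0 _)
    · intro p hp E
      have hpp := hPp p hp
      have ht34 : t p ≤ 3 / 4 := prime_rpow_neg_le hpp.two_le (by linarith)
      have hpow : ∀ e : ℕ, g (p ^ e) ≤ t p ^ e := by
        intro e
        refine (hgle _).trans (le_of_eq ?_)
        simp only [t]
        rw [Nat.cast_pow, ← Real.rpow_natCast, ← Real.rpow_natCast, ← Real.rpow_mul (by positivity),
          ← Real.rpow_mul (by positivity), mul_comm]
      have hone : g (p ^ (0 + 1)) ≤ if LogSmooth V ((p : ℤ) + ε).toNat then t p else 0 := by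
        split_ifs with hs
        · simpa using hpow 1
        · have hnQ : ¬ Q (p ^ (0 + 1)) := fun hQ => hs (hQ p hpp (by simp) (by
            rw [zero_add]
            intro hd
            have := (Nat.pow_dvd_pow_iff_le_right hpp.one_lt).1 hd
            omega))
          simp only [g, if_neg hnQ, le_refl]
      calc ∑ e ∈ Finset.range E, g (p ^ e) ≤ ∑ e ∈ Finset.range (E + 1 + 1), g (p ^ e) := by
            refine Finset.sum_le_sum_of_subset_of_nonneg ?_ fun _ _ _ => hg0 _
            exact Finset.range_subset_range.2 (by omega)
        _ = ∑ e ∈ Finset.range E, g (p ^ (e + 1 + 1)) + g (p ^ (0 + 1)) + g (p ^ 0) := by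
            rw [Finset.sum_range_succ', Finset.sum_range_succ']
        _ ≤ ∑ e ∈ Finset.range E, t p ^ 2 * t p ^ e +
            (if LogSmooth V ((p : ℤ) + ε).toNat then t p else 0) + 1 := by
            gcongr with e he
            · refine (hpow _).trans (le_of_eq ?_)
              ring
            · simpa using hpow 0
        _ ≤ 4 * t p ^ 2 + (if LogSmooth V ((p : ℤ) + ε).toNat then t p else 0) + 1 := by
            gcongr
            rw [← Finset.mul_sum, mul_comm]
            gcongr
            refine (geom_sum_le_inv (ht0 p) (by linarith) E).trans ?_
            calc (1 - t p)⁻¹ ≤ (1 / 4)⁻¹ := inv_anti₀ (by norm_num) (by linarith)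
              _ = 4 := by norm_num
        _ ≤ h p := by
            simp only [h]
            have := Real.add_one_le_exp
              ((if LogSmooth V ((p : ℤ) + ε).toNat then t p else 0) + 4 * t p ^ 2)
            linarith
    · intro m hm
      refine ⟨(hT m hm).1, fun p hp hpm => Finset.mem_biUnion.2 ⟨m, hm, ?_⟩⟩
      exact Nat.mem_primeFactors.2 ⟨hp, hpm, (hT m hm).1⟩
  rw [hsum]
  refine hprod.trans ?_
  simp only [h]
  rw [← Real.exp_sum, Finset.sum_add_distrib, ← Finset.mul_sum]
  apply Real.exp_le_exp.2
  refine add_le_add ?_ (mul_le_mul_of_nonneg_left ?_ (by norm_num))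
  · rw [← Finset.sum_filter]
    exact hS _ fun p hp => ⟨hPp p (Finset.mem_filter.1 hp).1, (Finset.mem_filter.1 hp).2⟩
  · have hsm : Summable fun n : ℕ => (n : ℝ) ^ (-(7 / 6) : ℝ) :=
      Real.summable_nat_rpow.2 (by norm_num)
    refine le_trans (Finset.sum_le_sum fun p hp => ?_)
      (hsm.sum_le_tsum P fun _ _ => by positivity)
    have h1 : (1 : ℝ) ≤ p := by exact_mod_cast (hPp p hp).one_le
    simp only [t]
    rw [← Real.rpow_natCast, ← Real.rpow_mul (by positivity)]
    apply Real.rpow_le_rpow_of_exponent_le h1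
    push_cast
    linarith

/-! ### Counting with Rankin weights and proper prime powers. -/

theorem one_le_rpow_mul_rpow_neg {m : ℕ} (hm : m ≠ 0) {t σ : ℝ} (hσ : 0 ≤ σ) (hmt : (m : ℝ) ≤ t) :
    1 ≤ t ^ σ * (m : ℝ) ^ (-σ) := by
  have hm0 : (0 : ℝ) < m := by exact_mod_cast Nat.pos_of_ne_zero hm
  rw [Real.rpow_neg hm0.le, ← div_eq_mul_inv, one_le_div (by positivity)]
  exact Real.rpow_le_rpow hm0.le hmt hσ

theorem card_le_rpow_mul {t σ Z : ℝ} (hσ : 0 ≤ σ) (ht : 0 ≤ t) (T : Finset ℕ)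
    (hT : ∀ m ∈ T, m ≠ 0 ∧ (m : ℝ) ≤ t) (hZ : ∑ m ∈ T, (m : ℝ) ^ (-σ) ≤ Z) :
    (T.card : ℝ) ≤ t ^ σ * Z := by
  calc (T.card : ℝ) = ∑ m ∈ T, 1 := by simp
    _ ≤ ∑ m ∈ T, t ^ σ * (m : ℝ) ^ (-σ) :=
        Finset.sum_le_sum fun m hm => one_le_rpow_mul_rpow_neg (hT m hm).1 hσ (hT m hm).2
    _ = t ^ σ * ∑ m ∈ T, (m : ℝ) ^ (-σ) := by rw [Finset.mul_sum]
    _ ≤ _ := by gcongr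

/-- The Rankin weight (t/(m₁m₂))^σ ≥ 1 factors, so the pair count is controlled by the product of
the sums over the two projections. -/
theorem card_pairs_le_rpow_mul {t σ Z : ℝ} (hσ : 0 ≤ σ) (ht : 0 ≤ t) (T : Finset (ℕ × ℕ))
    (hT : ∀ m ∈ T, m.1 ≠ 0 ∧ m.2 ≠ 0 ∧ (m.1 * m.2 : ℝ) ≤ t)
    (hZ1 : ∑ m ∈ T.image Prod.fst, (m : ℝ) ^ (-σ) ≤ Z)
    (hZ2 : ∑ m ∈ T.image Prod.snd, (m : ℝ) ^ (-σ) ≤ Z) :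
    (T.card : ℝ) ≤ t ^ σ * Z ^ 2 := by
  have h0 : 0 ≤ ∑ m ∈ T.image Prod.snd, (m : ℝ) ^ (-σ) :=
    Finset.sum_nonneg fun _ _ => by positivity
  have h0' : 0 ≤ ∑ m ∈ T.image Prod.fst, (m : ℝ) ^ (-σ) :=
    Finset.sum_nonneg fun _ _ => by positivity
  calc (T.card : ℝ) = ∑ m ∈ T, 1 := by simp
    _ ≤ ∑ m ∈ T, t ^ σ * ((m.1 : ℝ) ^ (-σ) * (m.2 : ℝ) ^ (-σ)) := by
        refine Finset.sum_le_sum fun m hm => ?_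
        obtain ⟨h1, h2, h3⟩ := hT m hm
        rw [← Real.mul_rpow (by positivity) (by positivity), ← Nat.cast_mul]
        exact one_le_rpow_mul_rpow_neg (mul_ne_zero h1 h2) hσ (by exact_mod_cast h3)
    _ = t ^ σ * ∑ m ∈ T, (m.1 : ℝ) ^ (-σ) * (m.2 : ℝ) ^ (-σ) := by rw [Finset.mul_sum]
    _ ≤ t ^ σ * ∑ m ∈ T.image Prod.fst ×ˢ T.image Prod.snd,
          (m.1 : ℝ) ^ (-σ) * (m.2 : ℝ) ^ (-σ) := by
        gcongr
        intro m hm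
        exact Finset.mem_product.2 ⟨Finset.mem_image_of_mem _ hm, Finset.mem_image_of_mem _ hm⟩
    _ = t ^ σ * ((∑ m ∈ T.image Prod.fst, (m : ℝ) ^ (-σ)) *
          ∑ m ∈ T.image Prod.snd, (m : ℝ) ^ (-σ)) := by
        rw [Finset.sum_product, Finset.sum_mul_sum]
    _ ≤ t ^ σ * (Z * Z) :=
        mul_le_mul_of_nonneg_left (mul_le_mul hZ1 hZ2 h0 (h0'.trans hZ1)) (by positivity)
    _ = _ := by ring

/-- The sum over proper prime powers exceeding `U`. -/
theorem sum_prime_pow_rpow_neg_le {U σ α : ℝ} (hU : 0 < U) (hα : 0 ≤ α) (hσα : 7 / 12 ≤ σ - α)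
    (Q : Finset (ℕ × ℕ)) (hQ : ∀ q ∈ Q, q.1.Prime ∧ 2 ≤ q.2 ∧ U < ((q.1 ^ q.2 : ℕ) : ℝ)) :
    ∑ q ∈ Q, ((q.1 ^ q.2 : ℕ) : ℝ) ^ (-σ) ≤
      U ^ (-α) * (4 * ∑' n : ℕ, (n : ℝ) ^ (-(7 / 6) : ℝ)) := by
  set δ := σ - α with hδ
  have hstep : ∀ q ∈ Q, ((q.1 ^ q.2 : ℕ) : ℝ) ^ (-σ) ≤ U ^ (-α) * (((q.1 : ℝ) ^ (-δ)) ^ q.2) := by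
    intro q hq
    obtain ⟨h1, -, h3⟩ := hQ q hq
    have hq0 : (0 : ℝ) < ((q.1 ^ q.2 : ℕ) : ℝ) := hU.trans h3
    have h4 : ((q.1 : ℝ) ^ (-δ)) ^ q.2 = ((q.1 ^ q.2 : ℕ) : ℝ) ^ (-δ) := by
      rw [Nat.cast_pow, ← Real.rpow_natCast, ← Real.rpow_natCast, ← Real.rpow_mul (by positivity),
        ← Real.rpow_mul (by positivity), mul_comm]
    -- The part α of the exponent is spent on q > U. The remainder δ ≥ 7/12 still lets proper prime
    -- powers converge, since 2δ ≥ 7/6 > 1.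
    rw [h4, show -σ = -α + -δ by rw [hδ]; ring, Real.rpow_add hq0]
    exact mul_le_mul_of_nonneg_right (Real.rpow_le_rpow_of_nonpos hU h3.le (by linarith))
      (by positivity)
  have hsm : Summable fun n : ℕ => (n : ℝ) ^ (-(7 / 6) : ℝ) :=
    Real.summable_nat_rpow.2 (by norm_num)
  set E := Q.sup Prod.snd with hE
  calc ∑ q ∈ Q, ((q.1 ^ q.2 : ℕ) : ℝ) ^ (-σ)
      ≤ ∑ q ∈ Q, U ^ (-α) * (((q.1 : ℝ) ^ (-δ)) ^ q.2) := Finset.sum_le_sum hstep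
    _ = U ^ (-α) * ∑ q ∈ Q, ((q.1 : ℝ) ^ (-δ)) ^ q.2 := by rw [Finset.mul_sum]
    _ ≤ U ^ (-α) * ∑ q ∈ Q.image Prod.fst ×ˢ Finset.Ico 2 (E + 1), ((q.1 : ℝ) ^ (-δ)) ^ q.2 := by
        gcongr
        intro q hq
        refine Finset.mem_product.2 ⟨Finset.mem_image_of_mem _ hq, Finset.mem_Ico.2 ⟨(hQ q hq).2.1, ?_⟩⟩
        exact Nat.lt_succ_of_le (Finset.le_sup (f := Prod.snd) hq)
    _ ≤ U ^ (-α) * ∑ p ∈ Q.image Prod.fst, 4 * (p : ℝ) ^ (-(7 / 6) : ℝ) := by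
        rw [Finset.sum_product]
        gcongr with p hp
        obtain ⟨q, hq, rfl⟩ := Finset.mem_image.1 hp
        have hpp := (hQ q hq).1
        have ht34 : (q.1 : ℝ) ^ (-δ) ≤ 3 / 4 := prime_rpow_neg_le hpp.two_le (by linarith)
        have ht0 : 0 ≤ (q.1 : ℝ) ^ (-δ) := by positivity
        have h1 : (1 : ℝ) ≤ q.1 := by exact_mod_cast hpp.one_le
        rw [Finset.sum_Ico_eq_sum_range]
        simp_rw [pow_add]
        rw [← Finset.mul_sum, mul_comm]
        refine mul_le_mul ?_ ?_ (by positivity) (by norm_num)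
        · refine (geom_sum_le_inv ht0 (by linarith) _).trans ?_
          calc (1 - (q.1 : ℝ) ^ (-δ))⁻¹ ≤ (1 / 4)⁻¹ := inv_anti₀ (by norm_num) (by linarith)
            _ = 4 := by norm_num
        · rw [← Real.rpow_natCast, ← Real.rpow_mul (by positivity)]
          apply Real.rpow_le_rpow_of_exponent_le h1
          push_cast
          linarith
    _ ≤ _ := by
        rw [← Finset.mul_sum]
        gcongr
        exact hsm.sum_le_tsum _ fun _ _ => by positivity

/-- Integers up to `t` with a proper prime power unitary divisor exceeding `U` and cofactor
satisfying `P`. -/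
theorem card_prime_pow_dvd_le {t σ α U Z : ℝ} {P : ℕ → Prop} (hU : 0 < U) (hα : 0 ≤ α)
    (hσα : 7 / 12 ≤ σ - α) (ht : 0 ≤ t)
    (hZ : ∀ M : Finset ℕ, (∀ m ∈ M, m ≠ 0 ∧ (m : ℝ) ≤ t ∧ P m) →
      ∑ m ∈ M, (m : ℝ) ^ (-σ) ≤ Z)
    (T : Finset ℕ) (hT : ∀ A ∈ T, A ≠ 0 ∧ (A : ℝ) ≤ t ∧ ∃ p e m : ℕ, p.Prime ∧ 2 ≤ e ∧
      A = p ^ e * m ∧ U < ((p ^ e : ℕ) : ℝ) ∧ P m) :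
    (T.card : ℝ) ≤ t ^ σ * (U ^ (-α) * (4 * ∑' n : ℕ, (n : ℝ) ^ (-(7 / 6) : ℝ)) * Z) := by
  choose! p e m hp he hA hUp hPm using fun A hA => (hT A hA).2.2
  refine card_le_rpow_mul (by linarith) ht T (fun A hA => ⟨(hT A hA).1, (hT A hA).2.1⟩) ?_
  have hm0 : ∀ A ∈ T, m A ≠ 0 := fun A h h0 => (hT A h).1 (by rw [hA A h, h0, mul_zero])
  have hinner := hZ (T.image m) (by
    intro k hk
    obtain ⟨A, h, rfl⟩ := Finset.mem_image.1 hk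
    refine ⟨hm0 A h, le_trans ?_ (hT A h).2.1, hPm A h⟩
    have : m A ≤ A := by
      conv_rhs => rw [hA A h]
      exact Nat.le_mul_of_pos_left _ (pow_pos (hp A h).pos _)
    exact_mod_cast this)
  have h0 : 0 ≤ ∑ k ∈ T.image m, (k : ℝ) ^ (-σ) := Finset.sum_nonneg fun _ _ => by positivity
  calc ∑ A ∈ T, (A : ℝ) ^ (-σ)
      = ∑ A ∈ T, ((p A ^ e A : ℕ) : ℝ) ^ (-σ) * (m A : ℝ) ^ (-σ) := by
        refine Finset.sum_congr rfl fun A h => ?_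
        conv_lhs => rw [hA A h]
        rw [Nat.cast_mul, Real.mul_rpow (by positivity) (by positivity)]
    _ = ∑ w ∈ T.image fun A => ((p A, e A), m A),
          ((w.1.1 ^ w.1.2 : ℕ) : ℝ) ^ (-σ) * (w.2 : ℝ) ^ (-σ) := by
        rw [Finset.sum_image]
        intro A h A' h' hAA
        simp only [Prod.mk.injEq] at hAA
        rw [hA A h, hA A' h', hAA.1.1, hAA.1.2, hAA.2]
    _ ≤ ∑ w ∈ (T.image fun A => (p A, e A)) ×ˢ T.image m,
          ((w.1.1 ^ w.1.2 : ℕ) : ℝ) ^ (-σ) * (w.2 : ℝ) ^ (-σ) := by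
        refine Finset.sum_le_sum_of_subset_of_nonneg ?_ fun _ _ _ => by positivity
        intro w hw
        obtain ⟨A, h, rfl⟩ := Finset.mem_image.1 hw
        exact Finset.mem_product.2 ⟨Finset.mem_image.2 ⟨A, h, rfl⟩, Finset.mem_image_of_mem _ h⟩
    _ = (∑ q ∈ T.image fun A => (p A, e A), ((q.1 ^ q.2 : ℕ) : ℝ) ^ (-σ)) *
          ∑ k ∈ T.image m, (k : ℝ) ^ (-σ) := by
        rw [Finset.sum_product, Finset.sum_mul_sum]
    _ ≤ _ := by
        refine mul_le_mul (sum_prime_pow_rpow_neg_le hU hα hσα _ ?_) hinner h0 ?_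
        · intro q hq
          obtain ⟨A, h, rfl⟩ := Finset.mem_image.1 hq
          exact ⟨hp A h, he A h, hUp A h⟩
        · have : 0 ≤ ∑' n : ℕ, (n : ℝ) ^ (-(7 / 6) : ℝ) := tsum_nonneg fun _ => by positivity
          positivity

/-! ### Prime divisors in a common residue class. -/

theorem card_le_of_modEq {S : Finset ℤ} {lo hi d : ℤ} (hd : 0 < d) (hlo : lo ≤ hi)
    (hS : ∀ n ∈ S, lo ≤ n ∧ n ≤ hi) (hmod : ∀ n ∈ S, ∀ n' ∈ S, d ∣ n - n') :
    (S.card : ℝ) ≤ 1 + (hi - lo + 1) / d := by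
  have hdR : (0 : ℝ) < d := by exact_mod_cast hd
  have hlen : (0 : ℝ) ≤ (hi - lo + 1 : ℝ) := by
    have : (lo : ℝ) ≤ hi := by exact_mod_cast hlo
    linarith
  rcases S.eq_empty_or_nonempty with rfl | ⟨n₀, hn₀⟩
  · simp only [Finset.card_empty, Nat.cast_zero]
    positivity
  have hsub : S ⊆ (Finset.Ioc (lo - 1) hi).filter fun n => n ≡ n₀ [ZMOD d] := by
    intro n hn
    have := hS n hn
    refine Finset.mem_filter.2 ⟨Finset.mem_Ioc.2 ⟨by omega, this.2⟩, ?_⟩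
    exact Int.modEq_iff_dvd.2 (hmod n₀ hn₀ n hn)
  have hcard := Finset.card_le_card hsub
  have h := Int.Ioc_filter_modEq_card (lo - 1) hi hd n₀
  set c := ((Finset.Ioc (lo - 1) hi).filter fun n => n ≡ n₀ [ZMOD d]).card
  have hdQ : (0 : ℚ) < d := by exact_mod_cast hd
  have hle : (((lo - 1 : ℤ) : ℚ) - n₀) / d ≤ ((hi : ℚ) - n₀) / d := by
    gcongr
    omega
  rw [max_eq_left (sub_nonneg.2 (Int.floor_mono hle))] at h
  have h1 := Int.floor_le (((hi : ℚ) - n₀) / d)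
  have h2 := Int.lt_floor_add_one ((((lo - 1 : ℤ) : ℚ) - n₀) / d)
  have h3 : ((hi : ℚ) - n₀) / d = (((lo - 1 : ℤ) : ℚ) - n₀) / d + (hi - lo + 1) / d := by
    push_cast; ring
  have h4 : (c : ℚ) = ⌊((hi : ℚ) - n₀) / d⌋ - ⌊(((lo - 1 : ℤ) : ℚ) - n₀) / d⌋ := by
    exact_mod_cast h
  have h5 : (c : ℚ) ≤ 1 + (hi - lo + 1) / d := by linarith
  have h6 : ((c : ℚ) : ℝ) ≤ ((1 + (hi - lo + 1) / d : ℚ) : ℝ) := Rat.cast_le.2 h5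
  push_cast at h6
  exact (Nat.cast_le.2 hcard).trans h6

/-- Primality is mostly discarded: p + ε = rj with 1 ≤ j ≤ N + 1, and p + ε ≤ 2p, so a harmonic sum
remains. Two such factors give 1/r², summable over r > R. -/
theorem sum_inv_primes_dvd_add_le {ε : ℤ} (hε1 : -1 ≤ ε) (hε2 : ε ≤ 1) {r : ℕ} (hr : 0 < r) (N : ℕ) :
    ∑ p ∈ (Finset.range (N + 1)).filter (fun p : ℕ => p.Prime ∧ (r : ℤ) ∣ p + ε), (p : ℝ)⁻¹ ≤
      2 / r * (1 + Real.log (N + 1)) := by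
  set Q := (Finset.range (N + 1)).filter (fun p : ℕ => p.Prime ∧ (r : ℤ) ∣ p + ε) with hQ
  have hrR : (0 : ℝ) < r := by exact_mod_cast hr
  have hj : ∀ p ∈ Q, r * (((p : ℤ) + ε).toNat / r) = ((p : ℤ) + ε).toNat ∧
      1 ≤ ((p : ℤ) + ε).toNat ∧ ((p : ℤ) + ε).toNat ≤ N + 1 ∧ ((p : ℤ) + ε).toNat ≤ 2 * p := by
    intro p hp
    obtain ⟨h1, h2, h3⟩ := Finset.mem_filter.1 hp
    have h4 := Finset.mem_range.1 h1
    have h5 := h2.two_le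
    refine ⟨Nat.mul_div_cancel' ?_, by omega, by omega, by omega⟩
    rw [← Int.natCast_dvd_natCast, Int.toNat_of_nonneg (by omega)]
    exact h3
  have hinj : Set.InjOn (fun p : ℕ => ((p : ℤ) + ε).toNat / r) Q := by
    intro p hp q hq hpq
    have h1 := (hj p hp).1
    have h2 := (hj q hq).1
    simp only at hpq
    rw [hpq, h2] at h1
    have h3 := (Finset.mem_filter.1 hp).2.1.two_le
    have h4 := (Finset.mem_filter.1 hq).2.1.two_le
    omega
  have hharm := harmonic_le_one_add_log (N + 1)
  rw [harmonic_eq_sum_Icc] at hharm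
  push_cast at hharm
  calc ∑ p ∈ Q, (p : ℝ)⁻¹
      ≤ ∑ p ∈ Q, 2 / r * ((((p : ℤ) + ε).toNat / r : ℕ) : ℝ)⁻¹ := by
        refine Finset.sum_le_sum fun p hp => ?_
        obtain ⟨h1, h2, h3, h4⟩ := hj p hp
        set k := ((p : ℤ) + ε).toNat / r
        have hpp : (0 : ℝ) < p := by exact_mod_cast (Finset.mem_filter.1 hp).2.1.pos
        have hk0 : 0 < k := by
          rcases Nat.eq_zero_or_pos k with h | h
          · rw [h] at h1; omega
          · exact h
        have hkR : (0 : ℝ) < k := by exact_mod_cast hk0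
        have h5 : (r : ℝ) * k ≤ 2 * p := by
          have : r * k ≤ 2 * p := by omega
          exact_mod_cast this
        rw [← div_eq_mul_inv, div_div, inv_eq_one_div, div_le_div_iff₀ hpp (by positivity)]
        linarith
    _ = 2 / r * ∑ j ∈ Q.image (fun p : ℕ => ((p : ℤ) + ε).toNat / r), (j : ℝ)⁻¹ := by
        rw [Finset.sum_image hinj, Finset.mul_sum]
    _ ≤ 2 / r * ∑ j ∈ Finset.Icc 1 (N + 1), (j : ℝ)⁻¹ := by
        gcongr
        intro j hjm
        obtain ⟨p, hp, rfl⟩ := Finset.mem_image.1 hjm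
        obtain ⟨h1, h2, h3, h4⟩ := hj p hp
        refine Finset.mem_Icc.2 ⟨?_, (Nat.div_le_self _ _).trans h3⟩
        by_contra h
        simp only [not_le, Nat.lt_one_iff] at h
        rw [h] at h1
        omega
    _ ≤ 2 / r * (1 + Real.log (N + 1)) := by gcongr

/-- Integers `n` in an interval with prime divisors `p ∣ a₁ n + b₁` and `q ∣ a₂ n + b₂` such that
`p + ε` and `q + ε` have a large common factor. -/
theorem card_common_factor_le {a₁ b₁ a₂ b₂ ε lo hi : ℤ} (hε1 : -1 ≤ ε) (hε2 : ε ≤ 1)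
    (hlo : lo ≤ hi) {N : ℕ} {R H : ℝ} (hR : 1 ≤ R) (hH : 0 ≤ H) (S : Finset ℤ)
    (hS : ∀ n ∈ S, lo ≤ n ∧ n ≤ hi ∧ ∃ p q r : ℕ, p.Prime ∧ q.Prime ∧ p ≠ q ∧ p ≤ N ∧ q ≤ N ∧
      R < r ∧ (r : ℤ) ∣ p + ε ∧ (r : ℤ) ∣ q + ε ∧ ¬ (p : ℤ) ∣ a₁ ∧ ¬ (q : ℤ) ∣ a₂ ∧
      (p : ℤ) ∣ a₁ * n + b₁ ∧ (q : ℤ) ∣ a₂ * n + b₂ ∧ (p * q : ℝ) ≤ H) :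
    (S.card : ℝ) ≤ (H + (hi - lo + 1)) * (4 * (1 + Real.log (N + 1)) ^ 2 * (2 / R)) := by
  classical
  have hlen : (0 : ℝ) ≤ (hi - lo + 1 : ℝ) := by
    have : (lo : ℝ) ≤ hi := by exact_mod_cast hlo
    linarith
  set G := H + (hi - lo + 1 : ℝ) with hG
  let Q : ℕ → Finset ℕ := fun r =>
    (Finset.range (N + 1)).filter (fun p : ℕ => p.Prime ∧ (r : ℤ) ∣ p + ε)
  let F : ℕ × ℕ → Finset ℤ := fun w => S.filter fun n => w.1 ≠ w.2 ∧ ¬ (w.1 : ℤ) ∣ a₁ ∧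
    ¬ (w.2 : ℤ) ∣ a₂ ∧ (w.1 : ℤ) ∣ a₁ * n + b₁ ∧ (w.2 : ℤ) ∣ a₂ * n + b₂ ∧ (w.1 * w.2 : ℝ) ≤ H
  have hQ2 : ∀ r, ∀ p ∈ Q r, p.Prime ∧ p ≤ N ∧ (r : ℤ) ∣ p + ε := fun r p hp => by
    obtain ⟨h1, h2, h3⟩ := Finset.mem_filter.1 hp
    exact ⟨h2, Nat.lt_succ_iff.1 (Finset.mem_range.1 h1), h3⟩
  -- In fact r ≤ N + 1; the upper end is padded by ⌊R⌋ so that the range is ordered even when R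
  -- exceeds N + 1.
  have hcover : S ⊆ (Finset.Ioc ⌊R⌋₊ (N + 1 + ⌊R⌋₊)).biUnion fun r => (Q r ×ˢ Q r).biUnion F := by
    intro n hn
    obtain ⟨-, -, p, q, r, hp, hq, hpq, hpN, hqN, hRr, hrp, hrq, h1, h2, h3, h4, h5⟩ := hS n hn
    have hr1 : ⌊R⌋₊ < r := (Nat.floor_lt (by linarith)).2 hRr
    have hr2 : r ≤ N + 1 := by
      have := Int.le_of_dvd (by have := hp.two_le; omega) hrp
      omega
    simp only [Finset.mem_biUnion]
    refine ⟨r, Finset.mem_Ioc.2 ⟨hr1, by omega⟩, (p, q), Finset.mem_product.2 ⟨?_, ?_⟩, ?_⟩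
    · exact Finset.mem_filter.2 ⟨Finset.mem_range.2 (by omega), hp, hrp⟩
    · exact Finset.mem_filter.2 ⟨Finset.mem_range.2 (by omega), hq, hrq⟩
    · exact Finset.mem_filter.2 ⟨hn, hpq, h1, h2, h3, h4, h5⟩
  have hF : ∀ r, ∀ w ∈ Q r ×ˢ Q r, ((F w).card : ℝ) ≤ G * ((w.1 : ℝ)⁻¹ * (w.2 : ℝ)⁻¹) := by
    rintro r ⟨p, q⟩ hw
    obtain ⟨hwp, hwq⟩ := Finset.mem_product.1 hw
    have hp := (hQ2 r p hwp).1
    have hq := (hQ2 r q hwq).1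
    have hp0 : (0 : ℝ) < p := by exact_mod_cast hp.pos
    have hq0 : (0 : ℝ) < q := by exact_mod_cast hq.pos
    rcases (F (p, q)).eq_empty_or_nonempty with h0 | ⟨n₀, hn₀⟩
    · rw [h0]
      simp only [Finset.card_empty, Nat.cast_zero]
      positivity
    obtain ⟨-, hpq, h1, h2, -, -, h5⟩ := Finset.mem_filter.1 hn₀
    have hstep : ∀ {a b m m' : ℤ} {s : ℕ}, s.Prime → ¬ (s : ℤ) ∣ a → (s : ℤ) ∣ a * m + b →
        (s : ℤ) ∣ a * m' + b → (s : ℤ) ∣ m - m' := by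
      intro a b m m' s hs ha hm hm'
      have h6 : (s : ℤ) ∣ a * (m - m') := by
        have := dvd_sub hm hm'
        rwa [show a * m + b - (a * m' + b) = a * (m - m') by ring] at this
      exact ((Nat.prime_iff_prime_int.1 hs).dvd_mul.1 h6).resolve_left ha
    have hcard := card_le_of_modEq (S := F (p, q)) (d := (p : ℤ) * q) (lo := lo) (hi := hi)
      (by have := hp.pos; have := hq.pos; positivity) hlo
      (fun n hn => by
        have := hS n (Finset.mem_filter.1 hn).1
        exact ⟨this.1, this.2.1⟩)
      (fun n hn n' hn' => by
        obtain ⟨-, -, -, -, h6, h7, -⟩ := Finset.mem_filter.1 hn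
        obtain ⟨-, -, -, -, h8, h9, -⟩ := Finset.mem_filter.1 hn'
        refine IsCoprime.mul_dvd ?_ (hstep hp h1 h6 h8) (hstep hq h2 h7 h9)
        exact Nat.isCoprime_iff_coprime.2 ((Nat.coprime_primes hp hq).2 hpq))
    refine hcard.trans ?_
    -- The two divisibilities fix n modulo pq; the stray 1 in the count is absorbed because pq ≤ H.
    have h6 : 1 ≤ H / ((p : ℝ) * q) := by
      rw [le_div_iff₀ (by positivity), one_mul]
      exact h5
    rw [Int.cast_mul, Int.cast_natCast, Int.cast_natCast, ← mul_inv, ← div_eq_mul_inv, hG]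
    change 1 + (hi - lo + 1 : ℝ) / ((p : ℝ) * q) ≤ (H + (hi - lo + 1)) / ((p : ℝ) * q)
    rw [add_div H]
    exact add_le_add h6 le_rfl
  have hr : ∀ r ∈ Finset.Ioc ⌊R⌋₊ (N + 1 + ⌊R⌋₊), (((Q r ×ˢ Q r).biUnion F).card : ℝ) ≤
      G * (4 * (1 + Real.log (N + 1)) ^ 2) * ((r : ℝ) ^ 2)⁻¹ := by
    intro r hr
    have hr0 : 0 < r := by have := (Finset.mem_Ioc.1 hr).1; omega
    have hrR : (0 : ℝ) < r := by exact_mod_cast hr0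
    calc (((Q r ×ˢ Q r).biUnion F).card : ℝ) ≤ ((∑ w ∈ Q r ×ˢ Q r, (F w).card : ℕ) : ℝ) :=
          Nat.cast_le.2 Finset.card_biUnion_le
      _ = ∑ w ∈ Q r ×ˢ Q r, ((F w).card : ℝ) := by push_cast; rfl
      _ ≤ ∑ w ∈ Q r ×ˢ Q r, G * ((w.1 : ℝ)⁻¹ * (w.2 : ℝ)⁻¹) := Finset.sum_le_sum (hF r)
      _ = G * ((∑ p ∈ Q r, (p : ℝ)⁻¹) * ∑ p ∈ Q r, (p : ℝ)⁻¹) := by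
          rw [← Finset.mul_sum, Finset.sum_product, Finset.sum_mul_sum]
      _ ≤ G * ((2 / r * (1 + Real.log (N + 1))) * (2 / r * (1 + Real.log (N + 1)))) := by
          have h1 := sum_inv_primes_dvd_add_le hε1 hε2 hr0 N
          have h2 : 0 ≤ ∑ p ∈ Q r, (p : ℝ)⁻¹ := Finset.sum_nonneg fun _ _ => by positivity
          exact mul_le_mul_of_nonneg_left (mul_le_mul h1 h1 h2 (h2.trans h1)) (by positivity)
      _ = _ := by field_simp; ring
  have hfl : 1 ≤ ⌊R⌋₊ := (Nat.one_le_floor_iff _).2 hR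
  calc (S.card : ℝ) ≤ ((∑ r ∈ Finset.Ioc ⌊R⌋₊ (N + 1 + ⌊R⌋₊),
        ((Q r ×ˢ Q r).biUnion F).card : ℕ) : ℝ) :=
        Nat.cast_le.2 ((Finset.card_le_card hcover).trans Finset.card_biUnion_le)
    _ = ∑ r ∈ Finset.Ioc ⌊R⌋₊ (N + 1 + ⌊R⌋₊), (((Q r ×ˢ Q r).biUnion F).card : ℝ) := by
        push_cast; rfl
    _ ≤ ∑ r ∈ Finset.Ioc ⌊R⌋₊ (N + 1 + ⌊R⌋₊),
          G * (4 * (1 + Real.log (N + 1)) ^ 2) * ((r : ℝ) ^ 2)⁻¹ := Finset.sum_le_sum hr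
    _ = G * (4 * (1 + Real.log (N + 1)) ^ 2) *
          ∑ r ∈ Finset.Ioc ⌊R⌋₊ (N + 1 + ⌊R⌋₊), ((r : ℝ) ^ 2)⁻¹ := by rw [Finset.mul_sum]
    _ ≤ G * (4 * (1 + Real.log (N + 1)) ^ 2) * (2 / R) := by
        gcongr
        refine (sum_Ioc_inv_sq_le_sub (by omega) (by omega)).trans ?_
        have h1 : (1 : ℝ) ≤ ⌊R⌋₊ := by exact_mod_cast hfl
        have h2 := Nat.lt_floor_add_one R
        have h3 : (⌊R⌋₊ : ℝ)⁻¹ ≤ 2 / R := by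
          rw [inv_eq_one_div, div_le_div_iff₀ (by linarith) (by linarith)]
          linarith
        have h4 : (0 : ℝ) ≤ ((N + 1 + ⌊R⌋₊ : ℕ) : ℝ)⁻¹ := by positivity
        linarith
    _ = _ := by ring

/-! ### Generic solutions. -/

/-- The integer `n` solves `f (a₁ n + b₁) = f (a₂ n + b₂)` and, for every pair of unitary prime
divisors of the two arguments, the associated linear system is nonsingular. -/
def IsGenericSolution (f : ℕ → ℕ) (a₁ b₁ a₂ b₂ n : ℤ) : Prop :=
  0 < a₁ * n + b₁ ∧ 0 < a₂ * n + b₂ ∧ f (a₁ * n + b₁).toNat = f (a₂ * n + b₂).toNat ∧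
    ∀ m₁ m₂ p q : ℕ, p.Prime → q.Prime → ¬ p ∣ m₁ → ¬ q ∣ m₂ →
      (a₁ * n + b₁).toNat = m₁ * p → (a₂ * n + b₂).toNat = m₂ * q →
      a₁ * m₂ * f m₁ ≠ a₂ * m₁ * f m₂

/-- For fixed cofactors, p and q satisfy f(m₁)(p + ε) = f(m₂)(q + ε) and a₁m₂q - a₂m₁p = a₁b₂ -
a₂b₁. Genericity says that the determinant is nonzero, so p, q and therefore n are unique. -/
theorem IsGenericSolution.eq_of_cofactors_eq {f : ℕ → ℕ} {ε a₁ b₁ a₂ b₂ n n' : ℤ}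
    (hf : TotientLike f ε) (ha₁ : 0 < a₁) (h : IsGenericSolution f a₁ b₁ a₂ b₂ n)
    (h' : IsGenericSolution f a₁ b₁ a₂ b₂ n') {m₁ m₂ p q p' q' : ℕ} (hp : p.Prime) (hq : q.Prime)
    (hp' : p'.Prime) (hq' : q'.Prime) (hpm : ¬ p ∣ m₁) (hqm : ¬ q ∣ m₂) (hpm' : ¬ p' ∣ m₁)
    (hqm' : ¬ q' ∣ m₂) (h1 : (a₁ * n + b₁).toNat = m₁ * p) (h2 : (a₂ * n + b₂).toNat = m₂ * q)
    (h1' : (a₁ * n' + b₁).toNat = m₁ * p') (h2' : (a₂ * n' + b₂).toNat = m₂ * q') : n = n' := by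
  have hsplit : ∀ {m s : ℕ}, s.Prime → ¬ s ∣ m → (f (m * s) : ℤ) = f m * (s + ε) := by
    intro m s hs hsm
    rw [hf.map_mul _ _ ((Nat.Prime.coprime_iff_not_dvd hs).2 hsm).symm, Nat.cast_mul,
      hf.map_prime s hs]
  have e1 : a₁ * n + b₁ = m₁ * p := by
    rw [← Int.toNat_of_nonneg h.1.le, h1]; push_cast; rfl
  have e2 : a₂ * n + b₂ = m₂ * q := by
    rw [← Int.toNat_of_nonneg h.2.1.le, h2]; push_cast; rfl
  have e1' : a₁ * n' + b₁ = m₁ * p' := by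
    rw [← Int.toNat_of_nonneg h'.1.le, h1']; push_cast; rfl
  have e2' : a₂ * n' + b₂ = m₂ * q' := by
    rw [← Int.toNat_of_nonneg h'.2.1.le, h2']; push_cast; rfl
  have g : (f m₁ : ℤ) * (p + ε) = f m₂ * (q + ε) := by
    rw [← hsplit hp hpm, ← hsplit hq hqm, ← h1, ← h2, h.2.2.1]
  have g' : (f m₁ : ℤ) * (p' + ε) = f m₂ * (q' + ε) := by
    rw [← hsplit hp' hpm', ← hsplit hq' hqm', ← h1', ← h2', h'.2.2.1]
  have hns := h.2.2.2 m₁ m₂ p q hp hq hpm hqm h1 h2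
  have k1 : (f m₁ : ℤ) * (p - p') = f m₂ * (q - q') := by linear_combination g - g'
  have k2 : a₂ * m₁ * ((p : ℤ) - p') = a₁ * m₂ * (q - q') := by
    linear_combination a₁ * e2 - a₁ * e2' - a₂ * e1 + a₂ * e1'
  have hpp : (p : ℤ) - p' = 0 := by
    by_contra hne
    have hqq : (q : ℤ) - q' ≠ 0 := by
      intro hqq
      rw [hqq, mul_zero] at k1
      have hm0 : m₁ ≠ 0 := by rintro rfl; exact hpm (dvd_zero p)
      have : (f m₁ : ℤ) ≠ 0 := by exact_mod_cast (hf.pos m₁ hm0).ne'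
      exact (mul_ne_zero this hne) k1
    refine hns (mul_right_cancel₀ (mul_ne_zero hne hqq) ?_)
    linear_combination a₁ * m₂ * ((q : ℤ) - q') * k1 - f m₂ * ((q : ℤ) - q') * k2
  have : a₁ * (n - n') = 0 := by linear_combination e1 - e1' + m₁ * hpp
  rcases mul_eq_zero.1 this with h0 | h0 <;> omega

theorem card_generic_le_rpow_mul {f : ℕ → ℕ} {ε a₁ b₁ a₂ b₂ : ℤ}
    (hf : TotientLike f ε) (ha₁ : 0 < a₁) {X t σ Z : ℝ} (hσ : 0 ≤ σ) (ht : 0 ≤ t) {P : ℕ → Prop}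
    (hZ : ∀ M : Finset ℕ, (∀ m ∈ M, m ≠ 0 ∧ (m : ℝ) ≤ X ∧ P m) →
      ∑ m ∈ M, (m : ℝ) ^ (-σ) ≤ Z) (S : Finset ℤ)
    (hS : ∀ n ∈ S, IsGenericSolution f a₁ b₁ a₂ b₂ n ∧ ∃ m₁ m₂ p q : ℕ, p.Prime ∧ q.Prime ∧
      ¬ p ∣ m₁ ∧ ¬ q ∣ m₂ ∧ (a₁ * n + b₁).toNat = m₁ * p ∧ (a₂ * n + b₂).toNat = m₂ * q ∧
      P m₁ ∧ P m₂ ∧ (m₁ : ℝ) ≤ X ∧ (m₂ : ℝ) ≤ X ∧ (m₁ * m₂ : ℝ) ≤ t) :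
    (S.card : ℝ) ≤ t ^ σ * Z ^ 2 := by
  choose! hgen m₁ m₂ p q hp hq hpm hqm h1 h2 hP1 hP2 hX1 hX2 hmt using hS
  have hinj : Set.InjOn (fun n => (m₁ n, m₂ n)) S := by
    intro n hn n' hn' hnn
    simp only [Prod.mk.injEq] at hnn
    refine (hgen n hn).eq_of_cofactors_eq hf ha₁ (hgen n' hn') (hp n hn) (hq n hn) (hp n' hn')
      (hq n' hn') (hpm n hn) (hqm n hn) ?_ ?_ (h1 n hn) (h2 n hn) ?_ ?_
    · rw [hnn.1]; exact hpm n' hn'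
    · rw [hnn.2]; exact hqm n' hn'
    · rw [hnn.1]; exact h1 n' hn'
    · rw [hnn.2]; exact h2 n' hn'
  have h10 : ∀ n ∈ S, m₁ n ≠ 0 := fun n hn h0 => hpm n hn (h0 ▸ dvd_zero _)
  have h20 : ∀ n ∈ S, m₂ n ≠ 0 := fun n hn h0 => hqm n hn (h0 ▸ dvd_zero _)
  rw [← Finset.card_image_of_injOn hinj]
  refine card_pairs_le_rpow_mul hσ ht _ ?_ ?_ ?_
  · intro m hm
    obtain ⟨n, hn, rfl⟩ := Finset.mem_image.1 hm
    exact ⟨h10 n hn, h20 n hn, hmt n hn⟩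
  · refine hZ _ fun m hm => ?_
    obtain ⟨w, hw, rfl⟩ := Finset.mem_image.1 hm
    obtain ⟨n, hn, rfl⟩ := Finset.mem_image.1 hw
    exact ⟨h10 n hn, hX1 n hn, hP1 n hn⟩
  · refine hZ _ fun m hm => ?_
    obtain ⟨w, hw, rfl⟩ := Finset.mem_image.1 hm
    obtain ⟨n, hn, rfl⟩ := Finset.mem_image.1 hw
    exact ⟨h20 n hn, hX2 n hn, hP2 n hn⟩

theorem card_prime_pow_dvd_linear_le {a b : ℤ} (ha : 0 < a) {X σ α U Z : ℝ} {P : ℕ → Prop}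
    (hU : 0 < U) (hα : 0 ≤ α) (hσα : 7 / 12 ≤ σ - α) (hX : 0 ≤ X)
    (hZ : ∀ M : Finset ℕ, (∀ m ∈ M, m ≠ 0 ∧ (m : ℝ) ≤ X ∧ P m) →
      ∑ m ∈ M, (m : ℝ) ^ (-σ) ≤ Z) (S : Finset ℤ)
    (hS : ∀ n ∈ S, 0 < a * n + b ∧ ((a * n + b : ℤ) : ℝ) ≤ X ∧ ∃ p e m : ℕ, p.Prime ∧ 2 ≤ e ∧
      (a * n + b).toNat = p ^ e * m ∧ U < ((p ^ e : ℕ) : ℝ) ∧ P m) :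
    (S.card : ℝ) ≤ X ^ σ * (U ^ (-α) * (4 * ∑' n : ℕ, (n : ℝ) ^ (-(7 / 6) : ℝ)) * Z) := by
  have hinj : Set.InjOn (fun n : ℤ => (a * n + b).toNat) S := by
    intro n hn n' hn' hnn
    have h1 := (hS n hn).1
    have h2 := (hS n' hn').1
    simp only at hnn
    have h3 : a * n + b = a * n' + b := by omega
    exact mul_left_cancel₀ ha.ne' (add_right_cancel h3)
  rw [← Finset.card_image_of_injOn hinj]
  refine card_prime_pow_dvd_le hU hα hσα hX hZ _ fun A hA => ?_
  obtain ⟨n, hn, rfl⟩ := Finset.mem_image.1 hA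
  obtain ⟨h1, h2, h3⟩ := hS n hn
  refine ⟨by omega, ?_, h3⟩
  have h4 : (((a * n + b).toNat : ℕ) : ℝ) = ((a * n + b : ℤ) : ℝ) := by
    exact_mod_cast congrArg (Int.cast (R := ℝ)) (Int.toNat_of_nonneg h1.le)
  rw [h4]
  exact h2

/-- The number of generic solutions for which the common value has a prime factor exceeding `R`,
and all unitary cofactors of prime powers satisfy `P`. -/
theorem card_generic_large_prime_factor_le {f : ℕ → ℕ} {ε a₁ b₁ a₂ b₂ lo hi : ℤ}
    (hf : TotientLike f ε) (ha₁ : 0 < a₁) (ha₂ : 0 < a₂) (hD : a₁ * b₂ - a₂ * b₁ ≠ 0)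
    (hlo : lo ≤ hi) {X R B σ α Z : ℝ} (hX : 1 ≤ X) (hlen : (hi - lo + 1 : ℝ) ≤ X) (hB : 1 ≤ B)
    (hR : ((a₁ + a₂ + |a₁ * b₂ - a₂ * b₁| + 2 : ℤ) : ℝ) ≤ R)
    (hα : 0 ≤ α) (hσα : 7 / 12 ≤ σ - α) {P : ℕ → Prop}
    (hZ : ∀ M : Finset ℕ, (∀ m ∈ M, m ≠ 0 ∧ (m : ℝ) ≤ X ∧ P m) →
      ∑ m ∈ M, (m : ℝ) ^ (-σ) ≤ Z) (S : Finset ℤ)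
    (hS : ∀ n ∈ S, IsGenericSolution f a₁ b₁ a₂ b₂ n ∧ lo ≤ n ∧ n ≤ hi ∧
      ((a₁ * n + b₁ : ℤ) : ℝ) ≤ X ∧ ((a₂ * n + b₂ : ℤ) : ℝ) ≤ X ∧
      (∃ r : ℕ, r.Prime ∧ R < r ∧ r ∣ f (a₁ * n + b₁).toNat) ∧
      (∀ p e m : ℕ, p.Prime → ¬ p ∣ m → (a₁ * n + b₁).toNat = p ^ e * m → P m) ∧
      (∀ p e m : ℕ, p.Prime → ¬ p ∣ m → (a₂ * n + b₂).toNat = p ^ e * m → P m)) :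
    (S.card : ℝ) ≤ 2 * (X ^ σ * ((R / 2) ^ (-α) * (4 * ∑' n : ℕ, (n : ℝ) ^ (-(7 / 6) : ℝ)) * Z)) +
      2 * (X * B) * (4 * (1 + Real.log (X + 1)) ^ 2 * (2 / R)) + (X / B) ^ σ * Z ^ 2 := by
  classical
  have hR3 : (3 : ℝ) ≤ R := by
    refine le_trans ?_ hR
    have : (3 : ℤ) ≤ a₁ + a₂ + |a₁ * b₂ - a₂ * b₁| + 2 := by
      have := abs_nonneg (a₁ * b₂ - a₂ * b₁)
      omega
    exact_mod_cast this
  -- The prime r enters through an exact prime power on each side. `T₁` and `T₂` hold the proper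
  -- powers; otherwise p and q are simple factors, with pq ≤ XB in `T₃` and pq > XB, hence m₁m₂ ≤
  -- X/B, in `T₄`.
  let T₁ := S.filter fun n => ∃ p e m : ℕ, p.Prime ∧ 2 ≤ e ∧
      (a₁ * n + b₁).toNat = p ^ e * m ∧ R / 2 < ((p ^ e : ℕ) : ℝ) ∧ P m
  let T₂ := S.filter fun n => ∃ p e m : ℕ, p.Prime ∧ 2 ≤ e ∧
      (a₂ * n + b₂).toNat = p ^ e * m ∧ R / 2 < ((p ^ e : ℕ) : ℝ) ∧ P m
  let T₃ := S.filter fun n => ∃ p q r : ℕ, p.Prime ∧ q.Prime ∧ p ≠ q ∧ p ≤ ⌊X⌋₊ ∧ q ≤ ⌊X⌋₊ ∧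
      R < r ∧ (r : ℤ) ∣ p + ε ∧ (r : ℤ) ∣ q + ε ∧ ¬ (p : ℤ) ∣ a₁ ∧ ¬ (q : ℤ) ∣ a₂ ∧
      (p : ℤ) ∣ a₁ * n + b₁ ∧ (q : ℤ) ∣ a₂ * n + b₂ ∧ (p * q : ℝ) ≤ X * B
  let T₄ := S.filter fun n => ∃ m₁ m₂ p q : ℕ, p.Prime ∧ q.Prime ∧
      ¬ p ∣ m₁ ∧ ¬ q ∣ m₂ ∧ (a₁ * n + b₁).toNat = m₁ * p ∧ (a₂ * n + b₂).toNat = m₂ * q ∧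
      P m₁ ∧ P m₂ ∧ (m₁ : ℝ) ≤ X ∧ (m₂ : ℝ) ≤ X ∧ (m₁ * m₂ : ℝ) ≤ X / B
  have hcover : S ⊆ T₁ ∪ T₂ ∪ T₃ ∪ T₄ := by
    intro n hn
    obtain ⟨hgen, -, -, hX1, hX2, ⟨r, hr, hRr, hrf⟩, hP1, hP2⟩ := hS n hn
    obtain ⟨hA1, hA2, hff, -⟩ := id hgen
    obtain ⟨p, e, m₁, hp, he, hm1, hpm, hrp⟩ := hf.exists_prime_pow hr (by omega) hrf
    rw [hff] at hrf
    obtain ⟨q, e', m₂, hq, he', hm2, hqm, hrq⟩ := hf.exists_prime_pow hr (by omega) hrf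
    have hlarge : ∀ {s i : ℕ}, s.Prime → r ∣ f (s ^ i) → R / 2 < ((s ^ i : ℕ) : ℝ) := by
      intro s i hs hd
      have h1 := Nat.le_of_dvd (hf.pos _ (pow_pos hs.pos i).ne') hd
      have h2 : (r : ℝ) ≤ 2 * ((s ^ i : ℕ) : ℝ) := by
        exact_mod_cast h1.trans (hf.map_prime_pow_le s i hs)
      linarith
    simp only [Finset.mem_union]
    rcases Nat.lt_or_ge 1 e with h2e | h2e
    · exact Or.inl (Or.inl (Or.inl (Finset.mem_filter.2
        ⟨hn, p, e, m₁, hp, h2e, hm1, hlarge hp hrp, hP1 p e m₁ hp hpm hm1⟩)))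
    rcases Nat.lt_or_ge 1 e' with h2e' | h2e'
    · exact Or.inl (Or.inl (Or.inr (Finset.mem_filter.2
        ⟨hn, q, e', m₂, hq, h2e', hm2, hlarge hq hrq, hP2 q e' m₂ hq hqm hm2⟩)))
    obtain rfl : e = 1 := by omega
    obtain rfl : e' = 1 := by omega
    have hPm1 := hP1 p 1 m₁ hp hpm hm1
    have hPm2 := hP2 q 1 m₂ hq hqm hm2
    rw [pow_one, mul_comm p] at hm1
    rw [pow_one, mul_comm q] at hm2
    rw [pow_one] at hrp hrq
    -- A prime s with r ∣ s + ε exceeds a₁, a₂ and |a₁b₂ - a₂b₁|. It therefore divides no leading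
    -- coefficient, and p = q is impossible since that prime would divide a₁b₂ - a₂b₁.
    have hshift : ∀ {s : ℕ}, s.Prime → r ∣ f s →
        (r : ℤ) ∣ s + ε ∧ a₁ + a₂ + |a₁ * b₂ - a₂ * b₁| + 1 < s := by
      intro s hs hd
      have h1 : (r : ℤ) ∣ s + ε := by
        rw [← hf.map_prime s hs]
        exact_mod_cast hd
      refine ⟨h1, ?_⟩
      have h2 := Int.le_of_dvd (by have := hs.two_le; have := hf.neg_one_le; omega) h1
      have h3 : a₁ + a₂ + |a₁ * b₂ - a₂ * b₁| + 2 < r := by exact_mod_cast hR.trans_lt hRr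
      have := hf.le_one
      omega
    obtain ⟨hrp', hpbig⟩ := hshift hp hrp
    obtain ⟨hrq', hqbig⟩ := hshift hq hrq
    have habs := abs_nonneg (a₁ * b₂ - a₂ * b₁)
    have hpa : ¬ (p : ℤ) ∣ a₁ := fun hd => by have := Int.le_of_dvd ha₁ hd; omega
    have hqa : ¬ (q : ℤ) ∣ a₂ := fun hd => by have := Int.le_of_dvd ha₂ hd; omega
    have e1 : a₁ * n + b₁ = m₁ * p := by
      rw [← Int.toNat_of_nonneg hA1.le, hm1]; push_cast; rfl
    have e2 : a₂ * n + b₂ = m₂ * q := by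
      rw [← Int.toNat_of_nonneg hA2.le, hm2]; push_cast; rfl
    have hpd : (p : ℤ) ∣ a₁ * n + b₁ := e1 ▸ dvd_mul_left _ _
    have hqd : (q : ℤ) ∣ a₂ * n + b₂ := e2 ▸ dvd_mul_left _ _
    have hpq : p ≠ q := by
      rintro rfl
      have h1 : (p : ℤ) ∣ a₁ * b₂ - a₂ * b₁ := by
        have := dvd_sub (hqd.mul_left a₁) (hpd.mul_left a₂)
        rwa [show a₁ * (a₂ * n + b₂) - a₂ * (a₁ * n + b₁) = a₁ * b₂ - a₂ * b₁ by ring] at this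
      have h2 := Int.le_of_dvd (abs_pos.2 hD) ((dvd_abs _ _).2 h1)
      omega
    have e1R : (m₁ : ℝ) * p ≤ X := by
      rw [e1] at hX1; exact_mod_cast hX1
    have e2R : (m₂ : ℝ) * q ≤ X := by
      rw [e2] at hX2; exact_mod_cast hX2
    have hm10 : 1 ≤ m₁ := Nat.one_le_iff_ne_zero.2 (by rintro rfl; exact hpm (dvd_zero p))
    have hm20 : 1 ≤ m₂ := Nat.one_le_iff_ne_zero.2 (by rintro rfl; exact hqm (dvd_zero q))
    have hm1R : (1 : ℝ) ≤ m₁ := by exact_mod_cast hm10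
    have hm2R : (1 : ℝ) ≤ m₂ := by exact_mod_cast hm20
    have hpR : (1 : ℝ) ≤ p := by exact_mod_cast hp.one_le
    have hqR : (1 : ℝ) ≤ q := by exact_mod_cast hq.one_le
    rcases le_or_gt (p * q : ℝ) (X * B) with hle | hgt
    · refine Or.inl (Or.inr (Finset.mem_filter.2 ⟨hn, p, q, r, hp, hq, hpq, ?_, ?_, hRr, hrp', hrq',
        hpa, hqa, hpd, hqd, hle⟩))
      · exact Nat.le_floor ((le_mul_of_one_le_left (by linarith) hm1R).trans e1R)
      · exact Nat.le_floor ((le_mul_of_one_le_left (by linarith) hm2R).trans e2R)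
    · refine Or.inr (Finset.mem_filter.2 ⟨hn, m₁, m₂, p, q, hp, hq, hpm, hqm, hm1, hm2, hPm1, hPm2,
        (le_mul_of_one_le_right (by linarith) hpR).trans e1R,
        (le_mul_of_one_le_right (by linarith) hqR).trans e2R, ?_⟩)
      have h1 : (m₁ * p : ℝ) * (m₂ * q) ≤ X * X := by gcongr
      have h2 : (m₁ * m₂ : ℝ) * (X * B) ≤ (m₁ * m₂ : ℝ) * (p * q) := by gcongr
      have h3 : X * ((m₁ * m₂ : ℝ) * B) ≤ X * X := by linarith
      rw [le_div_iff₀ (by linarith)]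
      exact le_of_mul_le_mul_left h3 (by linarith)
  have hcard : (S.card : ℝ) ≤ T₁.card + T₂.card + T₃.card + T₄.card := by
    have h1 := Finset.card_le_card hcover
    have h2 := Finset.card_union_le (T₁ ∪ T₂ ∪ T₃) T₄
    have h3 := Finset.card_union_le (T₁ ∪ T₂) T₃
    have h4 := Finset.card_union_le T₁ T₂
    exact_mod_cast (by omega : S.card ≤ T₁.card + T₂.card + T₃.card + T₄.card)
  have hT₁ := card_prime_pow_dvd_linear_le (b := b₁) ha₁ (U := R / 2) (by linarith) hα hσα
    (by linarith) hZ T₁ fun n hn => by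
      obtain ⟨h1, h2⟩ := Finset.mem_filter.1 hn
      have h3 := hS n h1
      exact ⟨h3.1.1, h3.2.2.2.1, h2⟩
  have hT₂ := card_prime_pow_dvd_linear_le (b := b₂) ha₂ (U := R / 2) (by linarith) hα hσα
    (by linarith) hZ T₂ fun n hn => by
      obtain ⟨h1, h2⟩ := Finset.mem_filter.1 hn
      have h3 := hS n h1
      exact ⟨h3.1.2.1, h3.2.2.2.2.1, h2⟩
  have hT₃ := card_common_factor_le (a₁ := a₁) (b₁ := b₁) (a₂ := a₂) (b₂ := b₂)
    hf.neg_one_le hf.le_one hlo (N := ⌊X⌋₊) (R := R) (H := X * B) (by linarith) (by positivity)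
    T₃ fun n hn => by
      obtain ⟨h1, h2⟩ := Finset.mem_filter.1 hn
      have h3 := hS n h1
      exact ⟨h3.2.1, h3.2.2.1, h2⟩
  have hT₄ := card_generic_le_rpow_mul hf ha₁ (b₁ := b₁) (a₂ := a₂) (b₂ := b₂) (t := X / B)
    (by linarith) (by positivity) hZ T₄ fun n hn => by
      obtain ⟨h1, h2⟩ := Finset.mem_filter.1 hn
      exact ⟨(hS n h1).1, h2⟩
  have hT₃' : (T₃.card : ℝ) ≤ 2 * (X * B) * (4 * (1 + Real.log (X + 1)) ^ 2 * (2 / R)) := by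
    refine hT₃.trans ?_
    have h1 : X ≤ X * B := le_mul_of_one_le_right (by linarith) hB
    have h2 : (⌊X⌋₊ : ℝ) ≤ X := Nat.floor_le (by linarith)
    have h3 : 0 ≤ Real.log ((⌊X⌋₊ : ℝ) + 1) := Real.log_nonneg (by
      have : (0 : ℝ) ≤ ⌊X⌋₊ := Nat.cast_nonneg _
      linarith)
    gcongr
    linarith
  linarith

theorem card_smooth_linear_le {a b : ℤ} (ha : 0 < a) {X σ Z : ℝ} {P : ℕ → Prop}
    (hσ : 0 ≤ σ) (hX : 0 ≤ X)
    (hZ : ∀ M : Finset ℕ, (∀ m ∈ M, m ≠ 0 ∧ P m) → ∑ m ∈ M, (m : ℝ) ^ (-σ) ≤ Z) (S : Finset ℤ)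
    (hS : ∀ n ∈ S, 0 < a * n + b ∧ ((a * n + b : ℤ) : ℝ) ≤ X ∧ P (a * n + b).toNat) :
    (S.card : ℝ) ≤ X ^ σ * Z := by
  have hinj : Set.InjOn (fun n : ℤ => (a * n + b).toNat) S := by
    intro n hn n' hn' hnn
    have h1 := (hS n hn).1
    have h2 := (hS n' hn').1
    simp only at hnn
    have h3 : a * n + b = a * n' + b := by omega
    exact mul_left_cancel₀ ha.ne' (add_right_cancel h3)
  rw [← Finset.card_image_of_injOn hinj]
  refine card_le_rpow_mul hσ hX _ ?_ (hZ _ ?_)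
  · intro A hA
    obtain ⟨n, hn, rfl⟩ := Finset.mem_image.1 hA
    obtain ⟨h1, h2, -⟩ := hS n hn
    refine ⟨by omega, ?_⟩
    have h4 : (((a * n + b).toNat : ℕ) : ℝ) = ((a * n + b : ℤ) : ℝ) := by
      exact_mod_cast congrArg (Int.cast (R := ℝ)) (Int.toNat_of_nonneg h1.le)
    rw [h4]
    exact h2
  · intro A hA
    obtain ⟨n, hn, rfl⟩ := Finset.mem_image.1 hA
    obtain ⟨h1, -, h3⟩ := hS n hn
    exact ⟨by omega, h3⟩

theorem not_logSmooth {V : ℝ} {k : ℕ} (h : ¬ LogSmooth V k) :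
    ∃ r : ℕ, r.Prime ∧ Real.exp V < r ∧ r ∣ k := by
  simp only [LogSmooth, not_forall, not_le] at h
  obtain ⟨r, hr, hrk, hV⟩ := h
  exact ⟨r, hr, (Real.lt_log_iff_exp_lt (by exact_mod_cast hr.pos)).1 hV, hrk⟩

/-! ### Choice of parameters and the final estimate. -/

/-- The scale `(log x log log log x) ^ (1/2)`. -/
noncomputable def savingScale (x : ℝ) : ℝ :=
  (Real.log x * Real.log (Real.log (Real.log x))) ^ (1 / 2 : ℝ)

theorem savingScale_sq {x : ℝ} (h1 : 0 ≤ Real.log x)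
    (h3 : 0 ≤ Real.log (Real.log (Real.log x))) :
    savingScale x ^ 2 = Real.log x * Real.log (Real.log (Real.log x)) := by
  rw [savingScale, ← Real.sqrt_eq_rpow, Real.sq_sqrt (mul_nonneg h1 h3)]

theorem tendsto_savingScale : Tendsto savingScale atTop atTop := by
  refine (tendsto_rpow_atTop (by norm_num)).comp ?_
  exact Real.tendsto_log_atTop.atTop_mul_atTop₀
    (Real.tendsto_log_atTop.comp (Real.tendsto_log_atTop.comp Real.tendsto_log_atTop))

/-- Here the exponent 7/8 < 1 pays off: the Euler product over cofactors with smooth value is at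
most e^(L/200). -/
theorem eventually_rpow_add_le (c : ℝ) :
    ∀ᶠ L : ℝ in atTop, (9 / 5 * L) ^ (7 / 8 : ℝ) + c ≤ L / 200 := by
  have h1 : Tendsto (fun L : ℝ => L ^ (1 / 8 : ℝ)) atTop atTop := tendsto_rpow_atTop (by norm_num)
  filter_upwards [h1.eventually_ge_atTop 800, eventually_ge_atTop (400 * |c|),
    eventually_gt_atTop 0] with L h2 h3 h4
  have h5 : L = L ^ (1 / 8 : ℝ) * L ^ (7 / 8 : ℝ) := by
    rw [← Real.rpow_add h4]; norm_num
  have h6 : (9 / 5 * L) ^ (7 / 8 : ℝ) ≤ 2 * L ^ (7 / 8 : ℝ) := by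
    rw [Real.mul_rpow (by norm_num) h4.le]
    gcongr
    calc (9 / 5 : ℝ) ^ (7 / 8 : ℝ) ≤ (9 / 5 : ℝ) ^ (1 : ℝ) :=
          Real.rpow_le_rpow_of_exponent_le (by norm_num) (by norm_num)
      _ ≤ 2 := by norm_num
  have h7 : 800 * L ^ (7 / 8 : ℝ) ≤ L := by
    conv_rhs => rw [h5]
    gcongr
  linarith [le_abs_self c]

theorem eventually_add_sq_le_exp (c : ℝ) :
    ∀ᶠ L : ℝ in atTop, c + L ^ 2 ≤ Real.exp (L / 200) := by
  have h1 : Tendsto (fun L : ℝ => Real.exp (L / 200) / (L / 200) ^ 2) atTop atTop :=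
    (Real.tendsto_exp_div_pow_atTop 2).comp (tendsto_id.atTop_div_const (by norm_num))
  filter_upwards [h1.eventually_ge_atTop 80000, eventually_ge_atTop (|c| + 1)] with L h2 h3
  have h0 := abs_nonneg c
  have hL : 0 < L := by linarith
  rw [le_div_iff₀ (by positivity)] at h2
  have : c ≤ L ^ 2 := by nlinarith [le_abs_self c]
  nlinarith

/-- Used with u = log L: raising the exponent from 9/10 to 19/20 absorbs the factor 2 in log log x ≤
2 log L. -/
theorem eventually_two_mul_rpow_le :
    ∀ᶠ u : ℝ in atTop, (2 * u) ^ (9 / 10 : ℝ) ≤ u ^ (19 / 20 : ℝ) := by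
  have h1 : Tendsto (fun u : ℝ => u ^ (1 / 20 : ℝ)) atTop atTop := tendsto_rpow_atTop (by norm_num)
  filter_upwards [h1.eventually_ge_atTop 2, eventually_gt_atTop 0] with u h2 h3
  rw [Real.mul_rpow (by norm_num) h3.le, show (19 / 20 : ℝ) = 1 / 20 + 9 / 10 by norm_num,
    Real.rpow_add h3]
  gcongr
  calc (2 : ℝ) ^ (9 / 10 : ℝ) ≤ (2 : ℝ) ^ (1 : ℝ) :=
        Real.rpow_le_rpow_of_exponent_le (by norm_num) (by norm_num)
    _ = 2 := Real.rpow_one 2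
    _ ≤ _ := h2

/-- The saving from Rankin's method at height `X ≥ x`. -/
theorem rpow_one_sub_le {x X c η : ℝ} (hx : 0 < x) (hxX : x ≤ X) (hη : 0 ≤ η)
    (hc : η * Real.log x = c) : X ^ (1 - η) ≤ X * Real.exp (-c) := by
  have hX : 0 < X := hx.trans_le hxX
  rw [sub_eq_add_neg, Real.rpow_add hX, Real.rpow_one]
  gcongr
  calc X ^ (-η) ≤ x ^ (-η) := Real.rpow_le_rpow_of_nonpos hx hxX (by linarith)
    _ = Real.exp (-c) := by rw [Real.rpow_def_of_pos hx, ← hc]; ring_nf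

/-- The saving 147/200 = 0.735 obtained below exceeds 2^(-1/2). -/
theorem savingBound_ge {x : ℝ} (hx : 0 ≤ x) (hL : 0 ≤ savingScale x) :
    x * Real.exp (-(147 / 200) * savingScale x) ≤ savingBound x := by
  unfold savingBound
  rw [← savingScale]
  gcongr
  rw [Real.rpow_neg (by norm_num), ← Real.sqrt_eq_rpow, inv_le_comm₀ (by positivity) (by norm_num)]
  exact Real.le_sqrt_of_sq_le (by norm_num)

/-- In units of L the main savings are 9/10 for smooth values; (9/5)(5/12) = 3/4, 9/5 - 9/10 and
9/10 for R = e^(9L/5); and 1/2 + 1/4, 1 - 1/4 and 1/2 + 1/4 for R = e^L. All are at least 3/4, and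
the auxiliary losses fit into E³ = e^(3L/200), leaving 147/200. -/
theorem sum_terms_le {x X L E C₀ η₁ η₂ l : ℝ} (hx0 : 0 < x) (hxX : x ≤ X) (hX1 : 1 ≤ X)
    (hL0 : 0 < L) (hE : E = Real.exp (L / 200)) (hC₀nn : 0 ≤ C₀)
    (hlogX1 : 1 + Real.log (X + 1) ≤ E) (hη₁0 : 0 ≤ η₁) (hη₂0 : 0 ≤ η₂)
    (hη₁x : η₁ * Real.log x = 9 / 10 * L) (hη₂x : η₂ * Real.log x = 1 / 2 * L)
    (hη₂L : η₂ * (9 / 5 * L) = 9 / 10 * l) (hl : l ≤ L / 200) :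
    X ^ (1 - η₁) * E +
      (2 * (X ^ (1 : ℝ) * ((Real.exp (9 / 5 * L) / 2) ^ (-(5 / 12) : ℝ) * (4 * C₀) * E)) +
        2 * (X * Real.exp (9 / 10 * L)) *
          (4 * (1 + Real.log (X + 1)) ^ 2 * (2 / Real.exp (9 / 5 * L))) +
        (X / Real.exp (9 / 10 * L)) ^ (1 : ℝ) * E ^ 2) +
      (2 * (X ^ (1 - η₂) * ((Real.exp L / 2) ^ (-(1 / 4) : ℝ) * (4 * C₀) * E)) +
        2 * (X * Real.exp (1 / 4 * L)) *
          (4 * (1 + Real.log (X + 1)) ^ 2 * (2 / Real.exp L)) +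
        (X / Real.exp (1 / 4 * L)) ^ (1 - η₂) * E ^ 2) ≤
      (35 + 32 * C₀) * (X * Real.exp (-(147 / 200) * L)) := by
  have hE1 : 1 ≤ E := hE ▸ Real.one_le_exp (by positivity)
  set Y := Real.exp (-(3 / 4) * L) with hY
  have hY0 : 0 < Y := Real.exp_pos _
  have hcomb : ∀ u v : ℝ, Real.exp u * Real.exp v = Real.exp (u + v) :=
    fun u v => (Real.exp_add u v).symm
  have hfinal : Real.exp (-(147 / 200) * L) = Y * E ^ 3 := by
    rw [hY, hE, ← Real.exp_nat_mul, ← Real.exp_add]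
    congr 1
    push_cast
    ring
  have hEE2 : E ≤ E ^ 2 := le_self_pow₀ hE1 (by norm_num)
  have hE23 : E ^ 2 ≤ E ^ 3 := pow_le_pow_right₀ hE1 (by norm_num)
  have hE3 : 0 < E ^ 3 := by positivity
  have hX0 : 0 < X := by linarith
  have t1 : X ^ (1 - η₁) * E ≤ X * (Y * E ^ 3) := by
    have h1 := rpow_one_sub_le hx0 hxX hη₁0 hη₁x
    have h2 : Real.exp (-(9 / 10 * L)) ≤ Y := Real.exp_le_exp.2 (by linarith)
    calc X ^ (1 - η₁) * E ≤ (X * Y) * E ^ 3 := by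
          gcongr
          · exact h1.trans (by gcongr)
          · linarith
      _ = _ := by ring
  have hhalf : ∀ {v α : ℝ}, 0 ≤ α → α ≤ 1 →
      (Real.exp v / 2) ^ (-α) ≤ 2 * Real.exp (-(α * v)) := by
    intro v α hα0 hα1
    rw [Real.div_rpow (Real.exp_pos v).le (by norm_num), ← Real.exp_mul,
      Real.rpow_neg (by norm_num : (0 : ℝ) ≤ 2), div_inv_eq_mul, mul_comm]
    have h1 : (2 : ℝ) ^ α ≤ 2 := by
      calc (2 : ℝ) ^ α ≤ 2 ^ (1 : ℝ) :=
            Real.rpow_le_rpow_of_exponent_le (by norm_num) hα1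
        _ = 2 := Real.rpow_one 2
    have h2 : v * -α = -(α * v) := by ring
    rw [h2]
    gcongr
  have hdiv : ∀ u v : ℝ, Real.exp u * (2 / Real.exp v) = 2 * Real.exp (u - v) := by
    intro u v
    rw [Real.exp_sub]; ring
  have t2 : 2 * (X ^ (1 : ℝ) * ((Real.exp (9 / 5 * L) / 2) ^ (-(5 / 12) : ℝ) * (4 * C₀) * E)) ≤
      16 * C₀ * (X * (Y * E ^ 3)) := by
    have h1 : (Real.exp (9 / 5 * L) / 2) ^ (-(5 / 12) : ℝ) ≤ 2 * Y := by
      refine (hhalf (by norm_num) (by norm_num)).trans ?_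
      rw [hY]
      gcongr
      linarith
    rw [Real.rpow_one]
    calc _ ≤ 2 * (X * ((2 * Y) * (4 * C₀) * E ^ 3)) := by
          gcongr
          linarith
      _ = _ := by ring
  have t3 : 2 * (X * Real.exp (9 / 10 * L)) *
      (4 * (1 + Real.log (X + 1)) ^ 2 * (2 / Real.exp (9 / 5 * L))) ≤
      16 * (X * (Y * E ^ 3)) := by
    have h2 : Real.exp (9 / 10 * L - 9 / 5 * L) ≤ Y := Real.exp_le_exp.2 (by linarith)
    have h3 : 0 ≤ Real.log (X + 1) := Real.log_nonneg (by linarith)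
    calc _ = 8 * X * (1 + Real.log (X + 1)) ^ 2 *
          (Real.exp (9 / 10 * L) * (2 / Real.exp (9 / 5 * L))) := by ring
      _ = 16 * X * (1 + Real.log (X + 1)) ^ 2 * Real.exp (9 / 10 * L - 9 / 5 * L) := by
          rw [hdiv]; ring
      _ ≤ 16 * X * E ^ 2 * Y := by gcongr
      _ ≤ 16 * X * E ^ 3 * Y := by gcongr
      _ = _ := by ring
  have t4 : (X / Real.exp (9 / 10 * L)) ^ (1 : ℝ) * E ^ 2 ≤ X * (Y * E ^ 3) := by
    have h2 : Real.exp (-(9 / 10 * L)) ≤ Y := Real.exp_le_exp.2 (by linarith)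
    rw [Real.rpow_one, div_eq_mul_inv, ← Real.exp_neg]
    calc _ ≤ X * Y * E ^ 3 := by gcongr
      _ = _ := by ring
  have hXη₂ := rpow_one_sub_le hx0 hxX hη₂0 hη₂x
  have t5 : 2 * (X ^ (1 - η₂) * ((Real.exp L / 2) ^ (-(1 / 4) : ℝ) * (4 * C₀) * E)) ≤
      16 * C₀ * (X * (Y * E ^ 3)) := by
    have h1 : (Real.exp L / 2) ^ (-(1 / 4) : ℝ) ≤ 2 * Real.exp (-(1 / 4 * L)) :=
      hhalf (by norm_num) (by norm_num)
    have h2 : Real.exp (-(1 / 2 * L)) * Real.exp (-(1 / 4 * L)) = Y := by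
      rw [hcomb, hY]; ring_nf
    calc _ ≤ 2 * ((X * Real.exp (-(1 / 2 * L))) *
          ((2 * Real.exp (-(1 / 4 * L))) * (4 * C₀) * E ^ 3)) := by
          gcongr
          linarith
      _ = 16 * C₀ * (X * ((Real.exp (-(1 / 2 * L)) * Real.exp (-(1 / 4 * L))) * E ^ 3)) := by
          ring
      _ = _ := by rw [h2]
  have t6 : 2 * (X * Real.exp (1 / 4 * L)) *
      (4 * (1 + Real.log (X + 1)) ^ 2 * (2 / Real.exp L)) ≤ 16 * (X * (Y * E ^ 3)) := by
    have h2 : Real.exp (1 / 4 * L - L) ≤ Y := Real.exp_le_exp.2 (by linarith)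
    have h3 : 0 ≤ Real.log (X + 1) := Real.log_nonneg (by linarith)
    calc _ = 8 * X * (1 + Real.log (X + 1)) ^ 2 *
          (Real.exp (1 / 4 * L) * (2 / Real.exp L)) := by ring
      _ = 16 * X * (1 + Real.log (X + 1)) ^ 2 * Real.exp (1 / 4 * L - L) := by
          rw [hdiv]; ring
      _ ≤ 16 * X * E ^ 2 * Y := by gcongr
      _ ≤ 16 * X * E ^ 3 * Y := by gcongr
      _ = _ := by ring
  have t7 : (X / Real.exp (1 / 4 * L)) ^ (1 - η₂) * E ^ 2 ≤ X * (Y * E ^ 3) := by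
    rw [Real.div_rpow hX0.le (Real.exp_pos _).le, ← Real.exp_mul, div_eq_mul_inv, ← Real.exp_neg]
    have h1 : Real.exp (-(1 / 4 * L * (1 - η₂))) ≤ Real.exp (-(1 / 4 * L)) * E := by
      rw [hE, hcomb]
      apply Real.exp_le_exp.2
      -- The loss η₂L/4 equals l/8, which is well within the single factor E allotted to it.
      have h4 : 1 / 4 * L * (1 - η₂) = 1 / 4 * L - 5 / 36 * (η₂ * (9 / 5 * L)) := by ring
      rw [h4, hη₂L]
      linarith
    have h2 : Real.exp (-(1 / 2 * L)) * Real.exp (-(1 / 4 * L)) = Y := by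
      rw [hcomb, hY]; ring_nf
    calc _ ≤ (X * Real.exp (-(1 / 2 * L))) * (Real.exp (-(1 / 4 * L)) * E) * E ^ 2 := by gcongr
      _ = X * ((Real.exp (-(1 / 2 * L)) * Real.exp (-(1 / 4 * L))) * E ^ 3) := by ring
      _ = _ := by rw [h2]
  rw [hfinal]
  linarith

set_option maxHeartbeats 800000 in
/-- The bound for the number of generic solutions up to `x`. -/
theorem isBigO_card_generic {f : ℕ → ℕ} {ε a₁ b₁ a₂ b₂ : ℤ} (hf : TotientLike f ε)
    (ha₁ : 0 < a₁) (ha₂ : 0 < a₂) (hD : a₁ * b₂ - a₂ * b₁ ≠ 0) (S : ℝ → Finset ℤ)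
    (hS : ∀ x, ∀ n ∈ S x, (n : ℝ) ≤ x ∧ IsGenericSolution f a₁ b₁ a₂ b₂ n) :
    (fun x => ((S x).card : ℝ)) =O[atTop] savingBound := by
  classical
  set C₀ := ∑' n : ℕ, (n : ℝ) ^ (-(7 / 6) : ℝ) with hC₀
  have hC₀nn : 0 ≤ C₀ := tsum_nonneg fun _ => by positivity
  set K : ℝ := ((a₁ + a₂ + |b₁| + |b₂| + 2 : ℤ) : ℝ) with hK
  have hK1 : 1 ≤ K := by
    have : (1 : ℤ) ≤ a₁ + a₂ + |b₁| + |b₂| + 2 := by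
      have := abs_nonneg b₁
      have := abs_nonneg b₂
      omega
    rw [hK]
    exact_mod_cast this
  have hLt := tendsto_savingScale
  have hV₂t : Tendsto (fun x => 9 / 5 * savingScale x) atTop atTop :=
    hLt.const_mul_atTop (by norm_num)
  have hloglog : Tendsto (fun x : ℝ => Real.log (Real.log x)) atTop atTop :=
    Real.tendsto_log_atTop.comp Real.tendsto_log_atTop
  have hlogL : Tendsto (fun x : ℝ => Real.log (savingScale x)) atTop atTop :=
    Real.tendsto_log_atTop.comp hLt
  have hsmall : ∀ᶠ L : ℝ in atTop, 2 * Real.log L ≤ L / 200 := by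
    filter_upwards [Real.isLittleO_log_id_atTop.bound (show (0 : ℝ) < 1 / 400 by norm_num),
      eventually_ge_atTop 1] with L h1 h2
    rw [id_eq, Real.norm_of_nonneg (Real.log_nonneg h2), Real.norm_of_nonneg (by linarith)] at h1
    linarith
  refine IsBigO.of_bound (K * (35 + 32 * C₀)) ?_
  filter_upwards [eventually_ge_atTop (1 : ℝ), Real.tendsto_log_atTop.eventually_gt_atTop 0,
    hloglog.eventually_gt_atTop 0,
    (Real.tendsto_log_atTop.comp hloglog).eventually_ge_atTop 1,
    hLt.eventually_ge_atTop 1,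
    hLt.eventually (eventually_rpow_add_le (4 * C₀)),
    hLt.eventually (eventually_add_sq_le_exp (1 + Real.log (2 * K))),
    hLt.eventually hsmall,
    hlogL.eventually eventually_two_mul_rpow_le,
    hLt.eventually (eventually_sum_smooth_shifted_prime_le hf.neg_one_le hf.le_one),
    hV₂t.eventually (eventually_sum_smooth_shifted_prime_le hf.neg_one_le hf.le_one),
    (Real.tendsto_exp_atTop.comp hLt).eventually_ge_atTop
      ((a₁ + a₂ + |a₁ * b₂ - a₂ * b₁| + 2 : ℤ) : ℝ)]
    with x hx1 hlx hllx hlllx hL1 e3 e4 e5 e8 e6 e6' e7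
  simp only [Function.comp_apply] at hlllx e7
  set L := savingScale x with hL
  set lll := Real.log (Real.log (Real.log x)) with hlll
  have hx0 : 0 < x := by linarith
  have hL0 : 0 < L := by linarith
  have hLsq : L ^ 2 = Real.log x * lll := savingScale_sq hlx.le (by linarith)
  have hlogx : Real.log x ≤ L ^ 2 := by
    rw [hLsq]
    exact le_mul_of_one_le_right hlx.le hlllx
  have hll2 : Real.log (Real.log x) ≤ 2 * Real.log L := by
    have := Real.log_le_log hlx hlogx
    rwa [Real.log_pow, Nat.cast_ofNat] at this
  have hlll2 : lll ≤ L / 200 := by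
    have := Real.log_le_sub_one_of_pos hllx
    linarith
  set E := Real.exp (L / 200) with hE
  have hE1 : 1 ≤ E := Real.one_le_exp (by positivity)
  set X := K * x with hX
  have hxX : x ≤ X := le_mul_of_one_le_left hx0.le hK1
  have hX1 : 1 ≤ X := hx1.trans hxX
  have hlogX1 : 1 + Real.log (X + 1) ≤ E := by
    refine le_trans ?_ e4
    have : Real.log (X + 1) ≤ Real.log (2 * K) + Real.log x := by
      rw [← Real.log_mul (by positivity) (by positivity)]
      exact Real.log_le_log (by linarith) (by linarith)
    linarith
  have hlogX : 1 + Real.log X ≤ E := by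
    have := Real.log_le_log (by linarith) (show X ≤ X + 1 by linarith)
    linarith
  -- This is the source of the triple logarithm: e^(ηV) = (log log x)^(9/10) is just within what the
  -- smooth shifted prime sum allows.
  have hexp : Real.exp (9 / 10 * lll) ≤ Real.log L ^ (19 / 20 : ℝ) := by
    refine le_trans ?_ e8
    rw [mul_comm, hlll, ← Real.rpow_def_of_pos hllx]
    exact Real.rpow_le_rpow hllx.le hll2 (by norm_num)
  -- Both exponents satisfy ηV = (9/10) log log log x, with V = L and V = 9L/5 respectively. The
  -- relation L² = log x · log log log x then gives η log x = 9L/10 and L/2.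
  set η₁ := 9 / 10 * lll / L with hη₁
  set η₂ := lll / (2 * L) with hη₂
  have hη₁0 : 0 ≤ η₁ := by positivity
  have hη₂0 : 0 ≤ η₂ := by positivity
  have hη₁1 : η₁ ≤ 1 / 10 := by
    rw [hη₁, div_le_iff₀ hL0]; linarith
  have hη₂1 : η₂ ≤ 1 / 10 := by
    rw [hη₂, div_le_iff₀ (by positivity)]; linarith
  have hη₁L : η₁ * L = 9 / 10 * lll := by rw [hη₁]; field_simp
  have hη₂L : η₂ * (9 / 5 * L) = 9 / 10 * lll := by rw [hη₂]; field_simp; ring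
  have hη₁x : η₁ * Real.log x = 9 / 10 * L := by
    rw [hη₁, div_mul_eq_mul_div, div_eq_iff hL0.ne']; linear_combination -(9 / 10) * hLsq
  have hη₂x : η₂ * Real.log x = 1 / 2 * L := by
    rw [hη₂, div_mul_eq_mul_div, div_eq_iff (by positivity)]; linear_combination -hLsq
  have hZ₁ : ∀ M : Finset ℕ, (∀ m ∈ M, m ≠ 0 ∧ LogSmooth L (f m)) →
      ∑ m ∈ M, (m : ℝ) ^ (-(1 - η₁)) ≤ E := by
    intro M hM
    refine (hf.sum_smooth_le hη₁1 (e6 η₁ hη₁0 (by rw [hη₁L]; exact hexp)) M hM).trans ?_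
    apply Real.exp_le_exp.2
    have : L ^ (7 / 8 : ℝ) ≤ (9 / 5 * L) ^ (7 / 8 : ℝ) :=
      Real.rpow_le_rpow hL0.le (by linarith) (by norm_num)
    linarith
  have hZ₂ : ∀ M : Finset ℕ, (∀ m ∈ M, m ≠ 0 ∧ LogSmooth (9 / 5 * L) (f m)) →
      ∑ m ∈ M, (m : ℝ) ^ (-(1 - η₂)) ≤ E := by
    intro M hM
    refine (hf.sum_smooth_le hη₂1 (e6' η₂ hη₂0 ?_) M hM).trans ?_
    · rw [hη₂L]
      refine hexp.trans (Real.rpow_le_rpow (Real.log_nonneg hL1) ?_ (by norm_num))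
      exact Real.log_le_log hL0 (by linarith)
    · exact Real.exp_le_exp.2 e3
  have hZ₃ : ∀ M : Finset ℕ, (∀ m ∈ M, m ≠ 0 ∧ (m : ℝ) ≤ X ∧ True) →
      ∑ m ∈ M, (m : ℝ) ^ (-(1 : ℝ)) ≤ E := by
    intro M hM
    refine le_trans ?_ hlogX
    simp_rw [Real.rpow_neg_one]
    refine sum_inv_le_of_log_le M (Real.log_nonneg hX1) fun m hm => ⟨(hM m hm).1, ?_⟩
    have : (0 : ℝ) < m := by exact_mod_cast Nat.pos_of_ne_zero (hM m hm).1
    exact Real.log_le_log this (hM m hm).2.1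
  have hrange : ∀ n ∈ S x, -|b₁| ≤ n ∧ n ≤ ⌊x⌋ ∧ ((a₁ * n + b₁ : ℤ) : ℝ) ≤ X ∧
      ((a₂ * n + b₂ : ℤ) : ℝ) ≤ X := by
    intro n hn
    obtain ⟨h1, h2, -⟩ := hS x n hn
    have hlin : ∀ {a b : ℤ}, 0 < a → ((a + |b| : ℤ) : ℝ) ≤ K → ((a * n + b : ℤ) : ℝ) ≤ X := by
      intro a b ha hab
      have h3 : (b : ℝ) ≤ |b| * x := by
        have h4 : (b : ℝ) ≤ |(b : ℝ)| := le_abs_self _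
        have h5 : |(b : ℝ)| ≤ |(b : ℝ)| * x := le_mul_of_one_le_right (abs_nonneg _) hx1
        push_cast
        linarith
      have ha' : (0 : ℝ) < a := by exact_mod_cast ha
      calc ((a * n + b : ℤ) : ℝ) = a * n + b := by push_cast; ring
        _ ≤ a * x + |b| * x := by gcongr
        _ = ((a + |b| : ℤ) : ℝ) * x := by push_cast; ring
        _ ≤ K * x := by gcongr
    have hb₁ := abs_nonneg b₁
    have hb₂ := abs_nonneg b₂
    refine ⟨?_, Int.le_floor.2 h1, hlin ha₁ (Int.cast_le.2 (by omega)),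
      hlin ha₂ (Int.cast_le.2 (by omega))⟩
    by_contra h
    have := le_abs_self b₁
    nlinarith
  have hlo : -|b₁| ≤ ⌊x⌋ := by
    have := abs_nonneg b₁
    have : 0 ≤ ⌊x⌋ := Int.floor_nonneg.2 hx0.le
    omega
  have hlen : ((⌊x⌋ : ℝ) - ((-|b₁| : ℤ) : ℝ) + 1) ≤ X := by
    have h1 : |(b₁ : ℝ)| + 1 ≤ (|(b₁ : ℝ)| + 1) * x := le_mul_of_one_le_right (by positivity) hx1
    have h2 : (⌊x⌋ : ℝ) ≤ x := Int.floor_le x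
    have h3 : ((|b₁| + 2 : ℤ) : ℝ) ≤ K := Int.cast_le.2 (by have := abs_nonneg b₂; omega)
    push_cast at h3 ⊢
    have h4 : (|(b₁ : ℝ)| + 2) * x ≤ K * x := by gcongr
    linarith
  have hR₂ : Real.exp L ≤ Real.exp (9 / 5 * L) := Real.exp_le_exp.2 (by linarith)
  -- Three ranges for the largest prime factor of the common value: at most e^L, above e^(9L/5), and
  -- between.
  set T₁ := (S x).filter fun n => LogSmooth L (f (a₁ * n + b₁).toNat) with hT₁
  set T₂ := (S x).filter fun n => ¬ LogSmooth (9 / 5 * L) (f (a₁ * n + b₁).toNat) with hT₂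
  set T₃ := (S x).filter fun n => ¬ LogSmooth L (f (a₁ * n + b₁).toNat) ∧
    LogSmooth (9 / 5 * L) (f (a₁ * n + b₁).toNat) with hT₃
  have hcover : S x ⊆ T₁ ∪ T₂ ∪ T₃ := by
    intro n hn
    simp only [hT₁, hT₂, hT₃, Finset.mem_union, Finset.mem_filter, hn, true_and]
    tauto
  have hcard : ((S x).card : ℝ) ≤ T₁.card + T₂.card + T₃.card := by
    have h1 := Finset.card_le_card hcover
    have h2 := Finset.card_union_le (T₁ ∪ T₂) T₃
    have h3 := Finset.card_union_le T₁ T₂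
    exact_mod_cast (by omega : (S x).card ≤ T₁.card + T₂.card + T₃.card)
  have hc₁ : (T₁.card : ℝ) ≤ X ^ (1 - η₁) * E := by
    refine card_smooth_linear_le (b := b₁) ha₁ (by linarith) (by linarith) hZ₁ T₁ fun n hn => ?_
    obtain ⟨h1, h2⟩ := Finset.mem_filter.1 hn
    exact ⟨(hS x n h1).2.1, (hrange n h1).2.2.1, h2⟩
  have hc₂ := card_generic_large_prime_factor_le hf ha₁ ha₂ hD hlo hX1 hlen
    (B := Real.exp (9 / 10 * L)) (R := Real.exp (9 / 5 * L)) (α := 5 / 12) (σ := 1)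
    (Real.one_le_exp (by positivity)) (e7.trans hR₂) (by norm_num) (by norm_num) hZ₃ T₂ (by
      intro n hn
      obtain ⟨h1, h2⟩ := Finset.mem_filter.1 hn
      have h3 := hrange n h1
      exact ⟨(hS x n h1).2, h3.1, h3.2.1, h3.2.2.1, h3.2.2.2, not_logSmooth h2,
        fun _ _ _ _ _ _ => trivial, fun _ _ _ _ _ _ => trivial⟩)
  have hc₃ := card_generic_large_prime_factor_le hf ha₁ ha₂ hD hlo hX1 hlen
    (B := Real.exp (1 / 4 * L)) (R := Real.exp L) (α := 1 / 4) (σ := 1 - η₂)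
    (P := fun m => LogSmooth (9 / 5 * L) (f m))
    (Real.one_le_exp (by positivity)) e7 (by norm_num) (by linarith)
    (fun M hM => hZ₂ M fun m hm => ⟨(hM m hm).1, (hM m hm).2.2⟩) T₃ (by
      intro n hn
      obtain ⟨h1, h2, h4⟩ := Finset.mem_filter.1 hn
      have h3 := hrange n h1
      refine ⟨(hS x n h1).2, h3.1, h3.2.1, h3.2.2.1, h3.2.2.2, not_logSmooth h2, ?_, ?_⟩
      -- The value at a unitary cofactor divides the common value, so it inherits its smoothness.
      · intro p e m hp hpm hA
        refine h4.of_dvd ?_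
        rw [hf.dvd_of_eq_mul hp hA hpm]
        exact dvd_mul_left _ _
      · intro p e m hp hpm hA
        rw [(hS x n h1).2.2.2.1] at h4
        refine h4.of_dvd ?_
        rw [hf.dvd_of_eq_mul hp hA hpm]
        exact dvd_mul_left _ _)
  rw [Real.norm_of_nonneg (Nat.cast_nonneg _)]
  have hmain : ((S x).card : ℝ) ≤ K * (35 + 32 * C₀) * (x * Real.exp (-(147 / 200) * L)) := by
    have h := sum_terms_le hx0 hxX hX1 hL0 hE hC₀nn hlogX1 hη₁0 hη₂0 hη₁x hη₂x hη₂L hlll2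
    calc ((S x).card : ℝ) ≤ T₁.card + T₂.card + T₃.card := hcard
      _ ≤ _ := add_le_add (add_le_add hc₁ hc₂) hc₃
      _ ≤ _ := h
      _ = _ := by rw [hX]; ring
  refine hmain.trans ?_
  have hC : 0 ≤ K * (35 + 32 * C₀) := by positivity
  refine mul_le_mul_of_nonneg_left ?_ hC
  exact (savingBound_ge hx0.le hL0.le).trans (le_abs_self _)

/-! ### Singular systems give the special form; conclusion. -/

/-- Singularity together with the equality of values gives a₁m₂(q + ε) = a₂m₁(p + ε). Subtracting
a₁m₂q - a₂m₁p = D, where D = a₁b₂ - a₂b₁, leaves D = ε(a₂m₁ - a₁m₂), and these linear equations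
determine m₁ and m₂. -/
theorem cofactor_relations {f : ℕ → ℕ} {ε a₁ b₁ a₂ b₂ n : ℤ} (hf : TotientLike f ε)
    (hn1 : 0 < a₁ * n + b₁) (hn2 : 0 < a₂ * n + b₂)
    (hfn : f (a₁ * n + b₁).toNat = f (a₂ * n + b₂).toNat) {m₁ m₂ p q : ℕ} (hp : p.Prime)
    (hq : q.Prime) (hpm : ¬ p ∣ m₁) (hqm : ¬ q ∣ m₂) (h1 : (a₁ * n + b₁).toNat = m₁ * p)
    (h2 : (a₂ * n + b₂).toNat = m₂ * q) (heq : a₁ * m₂ * f m₁ = a₂ * m₁ * f m₂) :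
    0 < m₁ ∧ 0 < m₂ ∧ a₁ * n + b₁ = m₁ * p ∧ ((p + ε) * f m₁ : ℤ) = (q + ε) * f m₂ ∧
      (m₁ : ℤ) * (a₂ * (ε * (q - p))) = (q + ε) * (a₁ * b₂ - a₂ * b₁) ∧
      (m₂ : ℤ) * (a₁ * (ε * (q - p))) = (p + ε) * (a₁ * b₂ - a₂ * b₁) := by
  have hsplit : ∀ {m s : ℕ}, s.Prime → ¬ s ∣ m → (f (m * s) : ℤ) = f m * (s + ε) := by
    intro m s hs hsm
    rw [hf.map_mul _ _ ((Nat.Prime.coprime_iff_not_dvd hs).2 hsm).symm, Nat.cast_mul,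
      hf.map_prime s hs]
  have hm1 : m₁ ≠ 0 := fun h0 => hpm (h0 ▸ dvd_zero _)
  have hm2 : m₂ ≠ 0 := fun h0 => hqm (h0 ▸ dvd_zero _)
  have e1 : a₁ * n + b₁ = m₁ * p := by
    rw [← Int.toNat_of_nonneg hn1.le, h1]; push_cast; rfl
  have e2 : a₂ * n + b₂ = m₂ * q := by
    rw [← Int.toNat_of_nonneg hn2.le, h2]; push_cast; rfl
  have e3 : (f m₁ : ℤ) * (p + ε) = f m₂ * (q + ε) := by
    rw [← hsplit hp hpm, ← hsplit hq hqm, ← h1, ← h2, hfn]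
  have hpos : (f m₁ : ℤ) ≠ 0 := by exact_mod_cast (hf.pos m₁ hm1).ne'
  have e4 : a₁ * m₂ * (q + ε) = a₂ * m₁ * (p + ε) :=
    mul_left_cancel₀ hpos (by linear_combination (q + ε) * heq - a₂ * m₁ * e3)
  have e5 : a₁ * b₂ - a₂ * b₁ = ε * (a₂ * m₁ - a₁ * m₂) := by
    linear_combination a₁ * e2 - a₂ * e1 + e4
  refine ⟨Nat.pos_of_ne_zero hm1, Nat.pos_of_ne_zero hm2, e1, by linear_combination e3, ?_, ?_⟩
  · linear_combination -(q + ε) * e5 + ε * e4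
  · linear_combination -(p + ε) * e5 + ε * e4

/-- A singular pair p, q puts n in the special form with k₁ = p - 1, k₂ = q - 1 and l = 1, since k₁,
k₂ need not be coprime. Equality k₁ = k₂ would force a₁b₂ = a₂b₁. -/
theorem isGenericSolution_of_not_phiForm {a₁ b₁ a₂ b₂ n : ℤ} (ha₁ : 0 < a₁) (ha₂ : 0 < a₂)
    (hD : a₁ * b₂ - a₂ * b₁ ≠ 0) (h : IsPhiSolution a₁ b₁ a₂ b₂ n)
    (hn : ¬ IsPhiForm a₁ b₁ a₂ b₂ n) : IsGenericSolution Nat.totient a₁ b₁ a₂ b₂ n := by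
  refine ⟨h.1, h.2.1, h.2.2, fun m₁ m₂ p q hp hq hpm hqm h1 h2 heq => hn ?_⟩
  obtain ⟨hm1, hm2, e1, e3, r1, r2⟩ := cofactor_relations totientLike_totient h.1 h.2.1 h.2.2 hp hq hpm
    hqm h1 h2 heq
  obtain ⟨k₁, hk₁⟩ : ∃ k : ℕ, (k : ℤ) = p - 1 := ⟨p - 1, by have := hp.one_le; omega⟩
  obtain ⟨k₂, hk₂⟩ : ∃ k : ℕ, (k : ℤ) = q - 1 := ⟨q - 1, by have := hq.one_le; omega⟩
  have hpk : (p : ℤ) = k₁ + 1 := by linarith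
  have hqk : (q : ℤ) = k₂ + 1 := by linarith
  have hk1 : 0 < k₁ := by have := hp.two_le; omega
  have hk2 : 0 < k₂ := by have := hq.two_le; omega
  rw [hpk, hqk] at e3 r1 r2
  have hne : k₁ ≠ k₂ := by
    rintro rfl
    have h0 : (k₁ : ℤ) * (a₁ * b₂ - a₂ * b₁) = 0 := by linear_combination -r1
    exact mul_ne_zero (by exact_mod_cast hk1.ne') hD h0
  have hneQ : (k₁ : ℚ) - k₂ ≠ 0 := sub_ne_zero.2 (by exact_mod_cast hne)
  have ha₁Q : (a₁ : ℚ) ≠ 0 := by exact_mod_cast ha₁.ne'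
  have ha₂Q : (a₂ : ℚ) ≠ 0 := by exact_mod_cast ha₂.ne'
  have r1Q := congrArg (Int.cast : ℤ → ℚ) r1
  have r2Q := congrArg (Int.cast : ℤ → ℚ) r2
  have e1Q := congrArg (Int.cast : ℤ → ℚ) e1
  push_cast at r1Q r2Q e1Q
  refine ⟨m₁, m₂, k₁, k₂, 1, p, q, hm1, hm2, hk1, hk2, one_pos, hne, ?_, ?_, ?_, ?_, ?_, hp, hq,
    hpm, hqm, ?_⟩
  · rw [eq_div_iff (mul_ne_zero ha₂Q hneQ)]
    linear_combination r1Q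
  · rw [eq_div_iff (mul_ne_zero ha₁Q hneQ)]
    linear_combination r2Q
  · zify
    linear_combination e3
  · push_cast
    linear_combination hpk
  · push_cast
    linear_combination hqk
  · rw [eq_div_iff ha₁Q]
    linear_combination e1Q

/-- As for φ, with k₁ = p + 1 and k₂ = q + 1; the opposite sign of ε reverses k₁ - k₂ in the
denominators. -/
theorem isGenericSolution_of_not_sigmaForm {a₁ b₁ a₂ b₂ n : ℤ} (ha₁ : 0 < a₁) (ha₂ : 0 < a₂)
    (hD : a₁ * b₂ - a₂ * b₁ ≠ 0) (h : IsSigmaSolution a₁ b₁ a₂ b₂ n)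
    (hn : ¬ IsSigmaForm a₁ b₁ a₂ b₂ n) :
    IsGenericSolution (fun n => ArithmeticFunction.sigma 1 n) a₁ b₁ a₂ b₂ n := by
  refine ⟨h.1, h.2.1, h.2.2, fun m₁ m₂ p q hp hq hpm hqm h1 h2 heq => hn ?_⟩
  obtain ⟨hm1, hm2, e1, e3, r1, r2⟩ := cofactor_relations totientLike_sigma h.1 h.2.1 h.2.2 hp hq hpm
    hqm h1 h2 heq
  obtain ⟨k₁, hk₁⟩ : ∃ k : ℕ, (k : ℤ) = p + 1 := ⟨p + 1, by have := hp.one_le; omega⟩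
  obtain ⟨k₂, hk₂⟩ : ∃ k : ℕ, (k : ℤ) = q + 1 := ⟨q + 1, by have := hq.one_le; omega⟩
  have hpk : (p : ℤ) = k₁ - 1 := by linarith
  have hqk : (q : ℤ) = k₂ - 1 := by linarith
  have hk1 : 0 < k₁ := by have := hp.two_le; omega
  have hk2 : 0 < k₂ := by have := hq.two_le; omega
  rw [hpk, hqk] at e3 r1 r2
  have hne : k₁ ≠ k₂ := by
    rintro rfl
    have h0 : (k₁ : ℤ) * (a₁ * b₂ - a₂ * b₁) = 0 := by linear_combination -r1
    exact mul_ne_zero (by exact_mod_cast hk1.ne') hD h0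
  have hneQ : (k₂ : ℚ) - k₁ ≠ 0 := sub_ne_zero.2 (by exact_mod_cast hne.symm)
  have ha₁Q : (a₁ : ℚ) ≠ 0 := by exact_mod_cast ha₁.ne'
  have ha₂Q : (a₂ : ℚ) ≠ 0 := by exact_mod_cast ha₂.ne'
  have r1Q := congrArg (Int.cast : ℤ → ℚ) r1
  have r2Q := congrArg (Int.cast : ℤ → ℚ) r2
  have e1Q := congrArg (Int.cast : ℤ → ℚ) e1
  push_cast at r1Q r2Q e1Q
  refine ⟨m₁, m₂, k₁, k₂, 1, p, q, hm1, hm2, hk1, hk2, one_pos, hne, ?_, ?_, ?_, ?_, ?_, hp, hq,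
    hpm, hqm, ?_⟩
  · rw [eq_div_iff (mul_ne_zero ha₂Q hneQ)]
    linear_combination r1Q
  · rw [eq_div_iff (mul_ne_zero ha₁Q hneQ)]
    linear_combination r2Q
  · zify
    linear_combination e3
  · push_cast
    linear_combination hpk
  · push_cast
    linear_combination hqk
  · rw [eq_div_iff ha₁Q]
    linear_combination e1Q

theorem theorem1p2 (a₁ b₁ a₂ b₂ : ℤ) (ha₁ : 0 < a₁) (ha₂ : 0 < a₂)
    (hD : a₁ * b₂ - a₂ * b₁ ≠ 0) :
    (fun x : ℝ => (countPhi a₁ b₁ a₂ b₂ x : ℝ)) =O[atTop] savingBound ∧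
      (fun x : ℝ => (countSigma a₁ b₁ a₂ b₂ x : ℝ)) =O[atTop] savingBound := by
  constructor
  · have h := isBigO_card_generic totientLike_totient ha₁ ha₂ hD
      (fun x => (phiExceptional_finite a₁ b₁ a₂ b₂ ha₁ x).toFinset) (by
        intro x n hn
        obtain ⟨h1, h2, h3⟩ := (Set.Finite.mem_toFinset _).1 hn
        exact ⟨h1, isGenericSolution_of_not_phiForm ha₁ ha₂ hD h2 h3⟩)
    simpa only [countPhi, Set.ncard_eq_toFinset_card _ (phiExceptional_finite a₁ b₁ a₂ b₂ ha₁ _)]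
      using h
  · have h := isBigO_card_generic totientLike_sigma ha₁ ha₂ hD
      (fun x => (sigmaExceptional_finite a₁ b₁ a₂ b₂ ha₁ x).toFinset) (by
        intro x n hn
        obtain ⟨h1, h2, h3⟩ := (Set.Finite.mem_toFinset _).1 hn
        exact ⟨h1, isGenericSolution_of_not_sigmaForm ha₁ ha₂ hD h2 h3⟩)
    simpa only [countSigma,
      Set.ncard_eq_toFinset_card _ (sigmaExceptional_finite a₁ b₁ a₂ b₂ ha₁ _)] using h
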